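/- Let $\gamma>0$, $p=\rho^\gamma$, and consider the nonconservative system $$(a\rho)_t+(a\rho u)_x=0,\qquad (a\rho(u+p))_t+(a\rho u(u+p))_x=\rho u p\,a_x,\qquad a_t=0,$$ with Riemann data $U_-=(u_-,\rho_-,a_0)$ for $x<0$ and $U_+=(u_+,\rho_+,a_1)$ for $x>0$, where $u_\pm,\rho_\pm>0$ and $0<a_0<a_1$. Put $\lambda_1=u-\gamma\rho^\gamma$, $D_1=\{\rho>0,\ 0<u<\gamma\rho^\gamma\}$, $D_2=\{\rho>0,\ u>\gamma\rho^\gamma\}$, $\Gamma_+=\{\rho>0,\ u=\gamma\rho^\gamma\}$. *Elementary waves.* The second argument is the left state. - $R(U,U_0)$, rarefaction: $a=a_0$, $u+\rho^\gamma=u_0+\rho_0^\gamma$, $0\le\rho<\rho_0$, $u>u_0$, with $\xi=x/t=\lambda_1$ inside the wave. - $S(U,U_0)$, shock of speed $\sigma$: $a=a_0$, $\rho,\rho_0>0$, the Rankine–Hugoniot relations $\sigma[\rho]=[\rho u]$, $\sigma[\rho(u+p)]=[\rho u(u+p)]$, and the Lax inequalities $\lambda_1(U)<\sigma<\lambda_1(U_0)$,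 $\sigma<u$. - $J(U,U_0)$, contact discontinuity of speed $u=u_0$: $a=a_0$, $u=u_0$, $\rho\ne\rho_0$. - $S_0(U,U_0)$, stationary wave of speed $0$: $a\neq a_0$, the two states are joined by a time-independent $C^1$ solution of $(a\rho u)'=0$, $(a\rho u(u+p))'=\rho u p\,a'$ with positive components, and the global entropy condition holds: along the part between $U_0$ and $U$ of the curve of all states so joined to $U_0$, $a$ is a monotone function of $\rho$. - Vacuum: $\rho=0$ on an interval of $\xi$ (there $u=\xi$). *Solutions.* A sequence of elementary waves, joined by $\oplus$, each starting at the state where the previous one ends, with nondecreasing speeds, solves the Riemann problem if the function $U(\xi)$, $\xi=x/t$, that it describes has $u,\rho\ge0$ and $a>0$; solves, outside a finite set of $\xi$, $$-\xi(a\rho)_\xi+(a\rho u)_\xi=0,\quad -\xi(a\rho(u+p))_\xi+(a\rho u(u+p))_\xi-\rho up\,a_\xi=0,\quad -\xi a_\xi=0;$$ has at the exceptional $\xi=\sigma$ one-sided limits that are equal, or joined by a shock or a contact discontinuity of speed $\sigma$, or, if $\sigma=0$, by finitely many stationary waves and zero-speed shocks along which $a$ is monotone; and tends to $U_\mp$ as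 $\xi\to\mp\infty$. In the fans below the final $J$ is absent if its two states coincide. **Case 1: $U_-\in D_2$.** There are unique states $U_{-*}$ of width $a_1$ reached from $U_-$ by a stationary wave; $\widetilde U_-$ and $\widetilde U_{-*}$ reached from $U_-$, respectively $U_{-*}$, by a zero-speed shock; and $\widetilde U_-^{*}$ of width $a_1$ reached from $\widetilde U_-$ by a stationary wave. Moreover $U_{-*}\in D_2$, the other three lie in $D_1$, and $\tilde u_-^*<\tilde u_{-*}<u_{-*}$. Put $\bar u=u_{-*}+\rho_{-*}^\gamma$, $\overline U=(\bar u,0,a_1)$, $M=(u_+,0,a_1)$. - 1.1. If $\tilde u_{-*}<u_+<u_{-*}$, there is a unique $U_{m_1}$ on the shock curve of $U_{-*}$ with velocity $u_+$, and $S_0(U_{-*},U_-)\oplus S(U_{m_1},U_{-*})\oplus J(U_+,U_{m_1})$ solves the problem. - 1.2. If $u_{-*}<u_+<\bar u$, there is a unique $U_{m_2}$ on the rarefaction curve of $U_{-*}$ with velocity $u_+$, and $S_0(U_{-*},U_-)\oplus R(U_{m_2},U_{-*})\oplus J(U_+,U_{m_2})$ solves the problem. - 1.3. If $u_+>\bar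 u$, then $S_0(U_{-*},U_-)\oplus R(\overline U,U_{-*})\oplus\mathrm{Vacuum}\oplus J(U_+,M)$ solves the problem, with the vacuum in $\bar u<\xi<u_+$. - 1.4. If $0<u_+<\tilde u_-^*$, there is a unique pair $(U_{m_3},U_{m_3}^*)$ such that $U_{m_3}$ is on the shock curve of $U_-$ with $\rho_{m_3}>\tilde\rho_-$, and $U_{m_3}^*$ has width $a_1$ and velocity $u_+$ and is reached from $U_{m_3}$ by a stationary wave; $U_{m_3}^*\in D_1$, and $S(U_{m_3},U_-)\oplus S_0(U_{m_3}^*,U_{m_3})\oplus J(U_+,U_{m_3}^*)$ solves the problem. - 1.5. If $\tilde u_-^*<u_+<\tilde u_{-*}$, there are $a\in(a_0,a_1)$ and states $U_1\in D_2$ of width $a$, $\widetilde U_1\in D_1$ of width $a$, $U_2\in D_1$ of width $a_1$ with $u_2=u_+$ such that $S(\widetilde U_1,U_1)$ has zero speed and $S_0(U_1,U_-)\oplus S(\widetilde U_1,U_1)\oplus S_0(U_2,\widetilde U_1)\oplus J(U_+,U_2)$, containing three coincident waves of speed zero, solves the problem. Conversely, whenever such waves $S_0(U_1,U_-)$, $S(\widetilde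 U_1,U_1)$ of speed zero and $S_0(U_2,\widetilde U_1)$ exist for some $a\in(a_0,a_1)$ with $U_2$ of width $a_1$ and $u_2=u_+$, this fan solves the problem. **Case 2: $U_-\in D_1$.** There are a unique $U_C\in\Gamma_+$ on the rarefaction curve of $U_-$; unique states $U_{C*}\in D_2$ and $U_C^*\in D_1$ of width $a_1$ reached from $U_C$ by stationary waves; a unique $\widetilde U_{C*}$ reached from $U_{C*}$ by a zero-speed shock; and a unique $U_-^*$ of width $a_1$ reached from $U_-$ by a stationary wave. Moreover $\widetilde U_{C*},U_-^*\in D_1$ and $u_-^*<u_C^*<\tilde u_{C*}<u_{C*}$. Put $\bar u=u_{C*}+\rho_{C*}^\gamma$, $\overline U=(\bar u,0,a_1)$, $M=(u_+,0,a_1)$. - 2.1. If $u_{C*}<u_+<\bar u$, there is a unique $U_{n_1}$ on the rarefaction curve of $U_{C*}$ with velocity $u_+$, and $R(U_C,U_-)\oplus S_0(U_{C*},U_C)\oplus R(U_{n_1},U_{C*})\oplus J(U_+,U_{n_1})$ solves the problem. - 2.2. If $\tilde u_{C*}<u_+<u_{C*}$, there is a unique $U_{n_2}$ on the shock curve of $U_{C*}$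 with velocity $u_+$, and $R(U_C,U_-)\oplus S_0(U_{C*},U_C)\oplus S(U_{n_2},U_{C*})\oplus J(U_+,U_{n_2})$ solves the problem. - 2.3. If $u_+>\bar u$, then $R(U_C,U_-)\oplus S_0(U_{C*},U_C)\oplus R(\overline U,U_{C*})\oplus\mathrm{Vacuum}\oplus J(U_+,M)$ solves the problem, with the vacuum in $\bar u<\xi<u_+$. - 2.4. If $0<u_+<u_-^*$ or $u_-^*<u_+<u_C^*$, there is a unique pair $(U_k,U_k^*)$ such that $U_k$ is $U_-$ or lies on the shock or rarefaction curve of $U_-$, $\rho_k>\rho_C$, and $U_k^*$ has width $a_1$ and velocity $u_+$ and is reached from $U_k$ by a stationary wave; $U_k^*\in D_1$. If $0<u_+<u_-^*$, then $S(U_k,U_-)\oplus S_0(U_k^*,U_k)\oplus J(U_+,U_k^*)$ solves the problem; if $u_-^*<u_+<u_C^*$, then $R(U_k,U_-)\oplus S_0(U_k^*,U_k)\oplus J(U_+,U_k^*)$ does. - 2.5. If $u_C^*<u_+<\tilde u_{C*}$, there are $a\in(a_0,a_1)$ and states $U_3\in D_2$ of width $a$, $\widetilde U_3\in D_1$ of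 width $a$, $U_4\in D_1$ of width $a_1$ with $u_4=u_+$ such that $S(\widetilde U_3,U_3)$ has zero speed and $R(U_C,U_-)\oplus S_0(U_3,U_C)\oplus S(\widetilde U_3,U_3)\oplus S_0(U_4,\widetilde U_3)\oplus J(U_+,U_4)$ solves the problem. Conversely, whenever such waves $S_0(U_3,U_C)$, $S(\widetilde U_3,U_3)$ of speed zero and $S_0(U_4,\widetilde U_3)$ exist for some $a\in(a_0,a_1)$ with $U_4$ of width $a_1$ and $u_4=u_+$, this fan solves the problem. **Global existence.** For all data as above (including $U_-\in\Gamma_+$ and the limiting values of $u_+$ between the cases) some finite sequence of elementary waves solves the Riemann problem. -/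

import Mathlib

open Set Filter Topology

namespace TrafficFlow

noncomputable section

/-- A state `U = (u, ρ, a)`: velocity, density and road width. -/
@[ext]
structure State where
  u : ℝ
  ρ : ℝ
  a : ℝ

/-- The first characteristic speed `λ₁ = u - γ ρ ^ γ`; the others are `λ₂ = u` and `λ₃ = 0`. -/
def lam (γ : ℝ) (V : State) : ℝ := V.u - γ * V.ρ ^ γ

/-- The region `0 < u < γ ρ ^ γ`. -/
def D₁ (γ : ℝ) : Set State := {V | 0 < V.ρ ∧ 0 < V.u ∧ V.u < γ * V.ρ ^ γ}

/-- The region `u > γ ρ ^ γ` (away from the vacuum). -/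
def D₂ (γ : ℝ) : Set State := {V | 0 < V.ρ ∧ 0 < V.u ∧ γ * V.ρ ^ γ < V.u}

/-- The curve `u = γ ρ ^ γ`. -/
def GammaPlus (γ : ℝ) : Set State := {V | 0 < V.ρ ∧ V.u = γ * V.ρ ^ γ}

/-! ### Elementary waves. The first state is the left one. -/

/-- `W` can be joined to the left state `V` by a centred 1-rarefaction wave
(`W` may be a vacuum state). -/
def Rarefaction (γ : ℝ) (V W : State) : Prop :=
  W.a = V.a ∧ W.u - V.u = -W.ρ ^ γ + V.ρ ^ γ ∧ 0 ≤ W.ρ ∧ W.ρ < V.ρ ∧ V.u < W.u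

/-- Rankine-Hugoniot relations for a discontinuity of speed `σ` across which the width is
constant. -/
def RankineHugoniot (γ σ : ℝ) (V W : State) : Prop :=
  W.a = V.a ∧
  -σ * (W.ρ - V.ρ) + (W.ρ * W.u - V.ρ * V.u) = 0 ∧
  -σ * (W.ρ * (W.u + W.ρ ^ γ) - V.ρ * (V.u + V.ρ ^ γ))
    + (W.ρ * W.u * (W.u + W.ρ ^ γ) - V.ρ * V.u * (V.u + V.ρ ^ γ)) = 0

/-- A 1-shock of speed `σ`: Rankine-Hugoniot relations and Lax inequalities. -/
def LaxShock (γ σ : ℝ) (V W : State) : Prop :=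
  0 < V.ρ ∧ 0 < W.ρ ∧ RankineHugoniot γ σ V W ∧
  lam γ W < σ ∧ σ < lam γ V ∧ σ < W.u

/-- A contact discontinuity (2-wave) of speed `σ`. -/
def Contact (σ : ℝ) (V W : State) : Prop :=
  W.a = V.a ∧ V.u = σ ∧ W.u = σ ∧ V.ρ ≠ W.ρ

/-- `V` and `W` are joined by a time-independent `C¹` solution of
`(a ρ u)' = 0`, `(a ρ u (u + p))' = ρ u p a'`, `p = ρ ^ γ`, with positive components. -/
def StationaryContact (γ : ℝ) (V W : State) : Prop :=
  ∃ u ρ a : ℝ → ℝ,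
    ContDiffOn ℝ 1 u (Icc 0 1) ∧ ContDiffOn ℝ 1 ρ (Icc 0 1) ∧ ContDiffOn ℝ 1 a (Icc 0 1) ∧
    (∀ x ∈ Icc (0 : ℝ) 1, 0 < u x ∧ 0 < ρ x ∧ 0 < a x) ∧
    (∀ x ∈ Icc (0 : ℝ) 1,
      derivWithin (fun y => a y * ρ y * u y) (Icc 0 1) x = 0 ∧
      derivWithin (fun y => a y * ρ y * u y * (u y + ρ y ^ γ)) (Icc 0 1) x
        = ρ x * u x * ρ x ^ γ * derivWithin a (Icc 0 1) x) ∧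
    (⟨u 0, ρ 0, a 0⟩ : State) = V ∧ (⟨u 1, ρ 1, a 1⟩ : State) = W

/-- Global entropy condition: along the part between `V` and `W` of the stationary curve through
`V`, the width is a monotone (nondecreasing or nonincreasing) function of the density. -/
def GlobalEntropy (γ : ℝ) (V W : State) : Prop :=
  (∀ X Y : State, StationaryContact γ V X → StationaryContact γ V Y →
    X.ρ ∈ uIcc V.ρ W.ρ → Y.ρ ∈ uIcc V.ρ W.ρ → X.ρ ≤ Y.ρ → X.a ≤ Y.a) ∨
  (∀ X Y : State, StationaryContact γ V X → StationaryContact γ V Y →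
    X.ρ ∈ uIcc V.ρ W.ρ → Y.ρ ∈ uIcc V.ρ W.ρ → X.ρ ≤ Y.ρ → Y.a ≤ X.a)

/-- A stationary wave: a stationary contact discontinuity with a genuine jump of the width that
satisfies the global entropy condition. -/
def StationaryWave (γ : ℝ) (V W : State) : Prop :=
  V.a ≠ W.a ∧ StationaryContact γ V W ∧ GlobalEntropy γ V W

/-- The curve of all right states that a single 1-wave (shock or rarefaction) joins to `V`,
together with `V` itself. -/
def OneWaveCurve (γ : ℝ) (V : State) : Set State :=
  {W | (∃ σ, LaxShock γ σ V W) ∨ Rarefaction γ V W ∨ W = V}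

/-! ### Self-similar solutions of the Riemann problem -/

def TendsToState (U : ℝ → State) (l : Filter ℝ) (V : State) : Prop :=
  Tendsto (fun ξ => (U ξ).u) l (𝓝 V.u) ∧ Tendsto (fun ξ => (U ξ).ρ) l (𝓝 V.ρ) ∧
    Tendsto (fun ξ => (U ξ).a) l (𝓝 V.a)

/-- The self-similar form of the system, `ξ = x / t`, holds classically at `ξ`. -/
def SolvesAt (γ : ℝ) (U : ℝ → State) (ξ : ℝ) : Prop :=
  DifferentiableAt ℝ (fun s => (U s).u) ξ ∧ DifferentiableAt ℝ (fun s => (U s).ρ) ξ ∧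
  ∃ m f n g b : ℝ,
    HasDerivAt (fun s => (U s).a * (U s).ρ) m ξ ∧
    HasDerivAt (fun s => (U s).a * (U s).ρ * (U s).u) f ξ ∧
    HasDerivAt (fun s => (U s).a * (U s).ρ * ((U s).u + (U s).ρ ^ γ)) n ξ ∧
    HasDerivAt (fun s => (U s).a * (U s).ρ * (U s).u * ((U s).u + (U s).ρ ^ γ)) g ξ ∧
    HasDerivAt (fun s => (U s).a) b ξ ∧
    -ξ * m + f = 0 ∧
    -ξ * n + g - (U ξ).ρ * (U ξ).u * (U ξ).ρ ^ γ * b = 0 ∧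
    -ξ * b = 0

/-- A single wave of zero speed. -/
def ZeroSpeedWave (γ : ℝ) (V W : State) : Prop :=
  StationaryWave γ V W ∨ LaxShock γ 0 V W

/-- Admissible pairs of one-sided limits `V = U(σ-)`, `W = U(σ+)`: continuity, a Lax shock,
a contact discontinuity or, at `σ = 0`, finitely many coincident zero-speed waves along which
the width is monotone. -/
def AdmissibleJump (γ σ : ℝ) (V W : State) : Prop :=
  V = W ∨ LaxShock γ σ V W ∨ Contact σ V W ∨
  (σ = 0 ∧
    (Relation.ReflTransGen (fun X Y => ZeroSpeedWave γ X Y ∧ X.a ≤ Y.a) V W ∨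
     Relation.ReflTransGen (fun X Y => ZeroSpeedWave γ X Y ∧ Y.a ≤ X.a) V W))

/-- `U` is an admissible piecewise smooth self-similar solution of the Riemann problem with left
state `Ul` and right state `Ur`. -/
def IsRiemannSolution (γ : ℝ) (Ul Ur : State) (U : ℝ → State) : Prop :=
  (∀ ξ, 0 ≤ (U ξ).u ∧ 0 ≤ (U ξ).ρ ∧ 0 < (U ξ).a) ∧
  (∃ D : Finset ℝ,
    (∀ ξ, ξ ∉ D → SolvesAt γ U ξ) ∧
    (∀ ξ ∈ D, ∃ V W : State,
      TendsToState U (𝓝[<] ξ) V ∧ TendsToState U (𝓝[>] ξ) W ∧ AdmissibleJump γ ξ V W)) ∧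
  TendsToState U atBot Ul ∧ TendsToState U atTop Ur

/-! ### Wave fans -/

/-- An elementary wave with its left and right states. -/
inductive Wave where
  | rarefaction (V W : State)
  | shock (V W : State)
  | contact (V W : State)
  | stationary (V W : State)
  | vacuum (V W : State)

def Wave.left : Wave → State
  | .rarefaction V _ => V
  | .shock V _ => V
  | .contact V _ => V
  | .stationary V _ => V
  | .vacuum V _ => V

def Wave.right : Wave → State
  | .rarefaction _ W => W
  | .shock _ W => W
  | .contact _ W => W
  | .stationary _ W => W
  | .vacuum _ W => W

/-- The speed of a discontinuity, from conservation of mass. -/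
def shockSpeed (V W : State) : ℝ := (W.ρ * W.u - V.ρ * V.u) / (W.ρ - V.ρ)

/-- Speed of the left edge of a wave. -/
def Wave.lo (γ : ℝ) : Wave → ℝ
  | .rarefaction V _ => lam γ V
  | .shock V W => shockSpeed V W
  | .contact V _ => V.u
  | .stationary _ _ => 0
  | .vacuum V _ => V.u

/-- Speed of the right edge of a wave. -/
def Wave.hi (γ : ℝ) : Wave → ℝ
  | .rarefaction _ W => lam γ W
  | .shock V W => shockSpeed V W
  | .contact _ W => W.u
  | .stationary _ _ => 0
  | .vacuum _ W => W.u

def Wave.Admissible (γ : ℝ) : Wave → Prop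
  | .rarefaction V W => Rarefaction γ V W
  | .shock V W => LaxShock γ (shockSpeed V W) V W
  | .contact V W => Contact V.u V W
  | .stationary V W => StationaryWave γ V W
  | .vacuum V W => V.ρ = 0 ∧ W.ρ = 0 ∧ W.a = V.a ∧ V.u < W.u

/-- Values strictly inside a wave: in a rarefaction, the solution of
`u - γ ρ ^ γ = ξ`, `u + ρ ^ γ = const`; in a vacuum, `ρ = 0` and `u = ξ`.
(For discontinuities this value is never used.) -/
def Wave.inside (γ : ℝ) : Wave → ℝ → State
  | .rarefaction V _, ξ =>
      ⟨(γ * (V.u + V.ρ ^ γ) + ξ) / (1 + γ), ((V.u + V.ρ ^ γ - ξ) / (1 + γ)) ^ (1 / γ), V.a⟩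
  | .vacuum V _, ξ => ⟨ξ, 0, V.a⟩
  | w, _ => w.left

/-- Starting from `V`, the waves of the list are admissible, fit together, have nondecreasing
speeds, and end in `Ur`. -/
def IsFan (γ : ℝ) (Ur : State) : State → List Wave → Prop
  | V, [] => V = Ur
  | V, w :: F => w.left = V ∧ w.Admissible γ ∧ (∀ w' ∈ F.head?, w.hi γ ≤ w'.lo γ) ∧
      IsFan γ Ur w.right F

/-- The self-similar function of `ξ` described by a wave fan. -/
def profile (γ : ℝ) : State → List Wave → ℝ → State
  | V, [], _ => V
  | V, w :: F, ξ =>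
      if ξ < w.lo γ then V
      else if ξ < w.hi γ then w.inside γ ξ
      else profile γ w.right F ξ

/-- The wave fan `F` solves the Riemann problem with data `Ul`, `Ur`. -/
def SolvedBy (γ : ℝ) (Ul Ur : State) (F : List Wave) : Prop :=
  IsFan γ Ur Ul F ∧ IsRiemannSolution γ Ul Ur (profile γ Ul F)

open Classical in
/-- The contact discontinuity from `V` to `W`; it is absent if the two states coincide. -/
def contactTail (V W : State) : List Wave := if V = W then [] else [Wave.contact V W]

/-- `x` is the only object with the property `P`. -/
def Uniquely {α : Type*} (P : α → Prop) (x : α) : Prop := P x ∧ ∀ y, P y → y = x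

/-! ### The two constructions -/

/-- The construction for a left state in `D₂`. -/
def CaseOne (γ : ℝ) (Ul Ur : State) : Prop :=
  -- `Us` is reached from `Ul` by a stationary wave, `Ut` by a zero-speed shock,
  -- `Ust` from `Us` by a zero-speed shock, `Uts` from `Ut` by a stationary wave.
  ∃ Us Ut Ust Uts : State,
    Uniquely (fun V => V.a = Ur.a ∧ StationaryWave γ Ul V) Us ∧ Us ∈ D₂ γ ∧
    Uniquely (LaxShock γ 0 Ul) Ut ∧ Ut ∈ D₁ γ ∧
    Uniquely (LaxShock γ 0 Us) Ust ∧ Ust ∈ D₁ γ ∧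
    Uniquely (fun V => V.a = Ur.a ∧ StationaryWave γ Ut V) Uts ∧ Uts ∈ D₁ γ ∧
    Uts.u < Ust.u ∧ Ust.u < Us.u ∧
    -- stationary wave, shock, contact
    (Ust.u < Ur.u → Ur.u < Us.u →
      ∃ M : State, Uniquely (fun V => V.u = Ur.u ∧ ∃ σ, LaxShock γ σ Us V) M ∧
        SolvedBy γ Ul Ur ([.stationary Ul Us, .shock Us M] ++ contactTail M Ur)) ∧
    -- stationary wave, rarefaction, contact
    (Us.u < Ur.u → Ur.u < Us.u + Us.ρ ^ γ →
      ∃ M : State, Uniquely (fun V => V.u = Ur.u ∧ Rarefaction γ Us V) M ∧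
        SolvedBy γ Ul Ur ([.stationary Ul Us, .rarefaction Us M] ++ contactTail M Ur)) ∧
    -- stationary wave, rarefaction, vacuum, contact
    (Us.u + Us.ρ ^ γ < Ur.u →
      SolvedBy γ Ul Ur
        [.stationary Ul Us, .rarefaction Us ⟨Us.u + Us.ρ ^ γ, 0, Ur.a⟩,
          .vacuum ⟨Us.u + Us.ρ ^ γ, 0, Ur.a⟩ ⟨Ur.u, 0, Ur.a⟩,
          .contact ⟨Ur.u, 0, Ur.a⟩ Ur]) ∧
    -- shock, stationary wave, contact
    (Ur.u < Uts.u →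
      ∃ M Ms : State,
        Uniquely (fun q : State × State =>
          (∃ σ, LaxShock γ σ Ul q.1) ∧ Ut.ρ < q.1.ρ ∧
            StationaryWave γ q.1 q.2 ∧ q.2.a = Ur.a ∧ q.2.u = Ur.u) (M, Ms) ∧
        Ms ∈ D₁ γ ∧
        SolvedBy γ Ul Ur ([.shock Ul M, .stationary M Ms] ++ contactTail Ms Ur)) ∧
    -- stationary wave, zero-speed shock, stationary wave, contact
    (Uts.u < Ur.u → Ur.u < Ust.u →
      ∃ V₁ V₁t V₂ : State,
        V₁.a ∈ Ioo Ul.a Ur.a ∧ V₁ ∈ D₂ γ ∧ LaxShock γ 0 V₁ V₁t ∧ V₁t ∈ D₁ γ ∧ V₂ ∈ D₁ γ ∧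
        SolvedBy γ Ul Ur
          ([.stationary Ul V₁, .shock V₁ V₁t, .stationary V₁t V₂] ++ contactTail V₂ Ur)) ∧
    (∀ V₁ V₁t V₂ : State, V₁.a ∈ Ioo Ul.a Ur.a → StationaryWave γ Ul V₁ → LaxShock γ 0 V₁ V₁t →
      StationaryWave γ V₁t V₂ → V₂.a = Ur.a → V₂.u = Ur.u →
        SolvedBy γ Ul Ur
          ([.stationary Ul V₁, .shock V₁ V₁t, .stationary V₁t V₂] ++ contactTail V₂ Ur))

/-- The construction for a left state in `D₁`. -/
def CaseTwo (γ : ℝ) (Ul Ur : State) : Prop :=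
  -- `C` is the point of the rarefaction curve on `u = γ ρ ^ γ`; stationary waves lead from `C`
  -- to `Cs` in `D₂` and to `Cu` in `D₁`, and from `Ul` to `Uu`; `Ct` is reached from `Cs` by a
  -- zero-speed shock.
  ∃ C Cs Cu Ct Uu : State,
    Uniquely (fun V => Rarefaction γ Ul V ∧ V ∈ GammaPlus γ) C ∧
    Uniquely (fun V => V.a = Ur.a ∧ StationaryWave γ C V ∧ V ∈ D₂ γ) Cs ∧
    Uniquely (fun V => V.a = Ur.a ∧ StationaryWave γ C V ∧ V ∈ D₁ γ) Cu ∧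
    Uniquely (LaxShock γ 0 Cs) Ct ∧ Ct ∈ D₁ γ ∧
    Uniquely (fun V => V.a = Ur.a ∧ StationaryWave γ Ul V) Uu ∧ Uu ∈ D₁ γ ∧
    Uu.u < Cu.u ∧ Cu.u < Ct.u ∧ Ct.u < Cs.u ∧
    -- rarefaction, stationary wave, rarefaction, contact
    (Cs.u < Ur.u → Ur.u < Cs.u + Cs.ρ ^ γ →
      ∃ N : State, Uniquely (fun V => V.u = Ur.u ∧ Rarefaction γ Cs V) N ∧
        SolvedBy γ Ul Ur
          ([.rarefaction Ul C, .stationary C Cs, .rarefaction Cs N] ++ contactTail N Ur)) ∧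
    -- rarefaction, stationary wave, shock, contact
    (Ct.u < Ur.u → Ur.u < Cs.u →
      ∃ N : State, Uniquely (fun V => V.u = Ur.u ∧ ∃ σ, LaxShock γ σ Cs V) N ∧
        SolvedBy γ Ul Ur
          ([.rarefaction Ul C, .stationary C Cs, .shock Cs N] ++ contactTail N Ur)) ∧
    -- rarefaction, stationary wave, rarefaction, vacuum, contact
    (Cs.u + Cs.ρ ^ γ < Ur.u →
      SolvedBy γ Ul Ur
        [.rarefaction Ul C, .stationary C Cs, .rarefaction Cs ⟨Cs.u + Cs.ρ ^ γ, 0, Ur.a⟩,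
          .vacuum ⟨Cs.u + Cs.ρ ^ γ, 0, Ur.a⟩ ⟨Ur.u, 0, Ur.a⟩,
          .contact ⟨Ur.u, 0, Ur.a⟩ Ur]) ∧
    -- shock, stationary wave, contact
    (Ur.u < Uu.u →
      ∃ K Ks : State,
        Uniquely (fun q : State × State =>
          q.1 ∈ OneWaveCurve γ Ul ∧ C.ρ < q.1.ρ ∧
            StationaryWave γ q.1 q.2 ∧ q.2.a = Ur.a ∧ q.2.u = Ur.u) (K, Ks) ∧
        Ks ∈ D₁ γ ∧
        SolvedBy γ Ul Ur ([.shock Ul K, .stationary K Ks] ++ contactTail Ks Ur)) ∧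
    -- rarefaction, stationary wave, contact
    (Uu.u < Ur.u → Ur.u < Cu.u →
      ∃ K Ks : State,
        Uniquely (fun q : State × State =>
          q.1 ∈ OneWaveCurve γ Ul ∧ C.ρ < q.1.ρ ∧
            StationaryWave γ q.1 q.2 ∧ q.2.a = Ur.a ∧ q.2.u = Ur.u) (K, Ks) ∧
        Ks ∈ D₁ γ ∧
        SolvedBy γ Ul Ur ([.rarefaction Ul K, .stationary K Ks] ++ contactTail Ks Ur)) ∧
    -- rarefaction, stationary wave, zero-speed shock, stationary wave, contact
    (Cu.u < Ur.u → Ur.u < Ct.u →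
      ∃ V₃ V₃t V₄ : State,
        V₃.a ∈ Ioo Ul.a Ur.a ∧ V₃ ∈ D₂ γ ∧ LaxShock γ 0 V₃ V₃t ∧ V₃t ∈ D₁ γ ∧ V₄ ∈ D₁ γ ∧
        SolvedBy γ Ul Ur
          ([.rarefaction Ul C, .stationary C V₃, .shock V₃ V₃t, .stationary V₃t V₄]
            ++ contactTail V₄ Ur)) ∧
    (∀ V₃ V₃t V₄ : State, V₃.a ∈ Ioo Ul.a Ur.a → StationaryWave γ C V₃ → LaxShock γ 0 V₃ V₃t →
      StationaryWave γ V₃t V₄ → V₄.a = Ur.a → V₄.u = Ur.u →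
        SolvedBy γ Ul Ur
          ([.rarefaction Ul C, .stationary C V₃, .shock V₃ V₃t, .stationary V₃t V₄]
            ++ contactTail V₄ Ur))

end

end TrafficFlow

open TrafficFlow

/-! Everything is measured by the ratio s = ρ^γ / u, which is 1/γ on the sonic curve, smaller in
`D₂` (supersonic) and larger in `D₁` (subsonic).

Shocks and rarefactions both move along a curve u + ρ^γ = c. On it the flux ρu = cρ - ρ^(γ+1) is
strictly concave in ρ with derivative λ₁. A shock speed is therefore the slope of a chord, and a
zero-speed shock joins the two points of equal flux, one on each side of the sonic point
(`Conjugate`). The logarithm of the flux is, up to scaling and a constant, `fluxFun`, with its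
maximum at γs = 1.

A stationary solution conserves `fluxInv` and `statInv`, and these two equalities characterise it
(`stationaryContact_iff`). Along its curve γ log a is `widthFun` up to a constant, with its minimum
at γs = 1. Hence a larger width is reached once on each side of the sonic point, and the global
entropy condition says exactly that this point is not crossed (`stationaryWave_iff`).

The resonant cases rest on `jumpFun`. A zero-speed shock changes `statInv` by the difference of
`jumpFun`, whose derivative is minus a square, so it decreases strictly through the sonic point.
This orders the velocities obtained with the shock at the narrow end and at the wide end
(`velocity_lt_of_conjugate`). The intermediate value theorem fills the interval between them by
placing the shock at an intermediate width (`exists_zero_speed_triple`). Small velocities on the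
right come from a second such argument along the subsonic part of u + ρ^γ = c
(`exists_subsonic_pair`), with uniqueness by monotonicity (`stationary_velocity_lt`).

For a subsonic left state, except in case 2.4, a rarefaction first leads to the sonic state C, where
λ₁ = 0. Since C is conjugate to itself, the construction for a supersonic state applies from there.

That a fan solves the problem is proved from right to left, one wave at a time (`FanSol`); all
zero-speed waves are collected in a single jump at ξ = 0. -/

namespace TrafficFlow

/-! ### Scalar functions of the ratio `s = ρ ^ γ / u` -/

noncomputable section

/-- The logarithm `(γ + 1)² / (2γ + 1) * log ((2γ + 1) s + γ)` entering the stationary invariant. -/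
def statLog (γ s : ℝ) : ℝ := (γ + 1) ^ 2 / (2 * γ + 1) * Real.log ((2 * γ + 1) * s + γ)

/-- Up to a constant, `γ log a` along a stationary curve. -/
def widthFun (γ s : ℝ) : ℝ := statLog γ s - Real.log s

/-- Up to a constant, `γ log (ρ u)` along a curve `u + ρ ^ γ = const`. -/
def fluxFun (γ s : ℝ) : ℝ := Real.log s - (γ + 1) * Real.log (1 + s)

/-- The combination of `widthFun` and `fluxFun` that is monotone across `γ s = 1`. -/
def jumpFun (γ s : ℝ) : ℝ := widthFun γ s + γ / (γ + 1) * fluxFun γ s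

end

variable {γ : ℝ}

/-! ### Derivatives and monotonicity on the two sides of the sonic ratio. -/

lemma lt_of_hasDerivAt_pos {f f' : ℝ → ℝ} {s t : ℝ} (hst : s < t)
    (h : ∀ x ∈ Icc s t, HasDerivAt f (f' x) x) (h' : ∀ x ∈ Ioo s t, 0 < f' x) : f s < f t := by
  have hmono : StrictMonoOn f (Icc s t) := by
    refine strictMonoOn_of_hasDerivWithinAt_pos (f' := f') (convex_Icc s t)
      (fun x hx => (h x hx).continuousAt.continuousWithinAt) ?_ ?_
    · intro x hx
      exact (h x (interior_subset hx)).hasDerivWithinAt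
    · intro x hx
      rw [interior_Icc] at hx
      exact h' x hx
  exact hmono (left_mem_Icc.2 hst.le) (right_mem_Icc.2 hst.le) hst

lemma gt_of_hasDerivAt_neg {f f' : ℝ → ℝ} {s t : ℝ} (hst : s < t)
    (h : ∀ x ∈ Icc s t, HasDerivAt f (f' x) x) (h' : ∀ x ∈ Ioo s t, f' x < 0) : f t < f s := by
  have := lt_of_hasDerivAt_pos (f := fun x => -f x) (f' := fun x => -f' x) hst
    (fun x hx => (h x hx).neg) (fun x hx => neg_pos.2 (h' x hx))
  simpa using this

lemma hasDerivAt_statLog (hγ : 0 < γ) {s : ℝ} (hs : 0 < s) :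
    HasDerivAt (statLog γ) ((γ + 1) ^ 2 / ((2 * γ + 1) * s + γ)) s := by
  have h0 : (2 * γ + 1) * s + γ ≠ 0 := by positivity
  have h1 : HasDerivAt (fun s : ℝ => (2 * γ + 1) * s + γ) (2 * γ + 1) s := by
    simpa using ((hasDerivAt_id s).const_mul (2 * γ + 1)).add_const γ
  have h2 := (h1.log h0).const_mul ((γ + 1) ^ 2 / (2 * γ + 1))
  refine HasDerivAt.congr_deriv (f := statLog γ) h2 ?_
  have : 2 * γ + 1 ≠ 0 := by positivity
  field_simp

lemma hasDerivAt_widthFun (hγ : 0 < γ) {s : ℝ} (hs : 0 < s) :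
    HasDerivAt (widthFun γ) (γ * (γ * s - 1) / (s * ((2 * γ + 1) * s + γ))) s := by
  have h0 : (2 * γ + 1) * s + γ ≠ 0 := by positivity
  have h := (hasDerivAt_statLog hγ hs).sub (Real.hasDerivAt_log hs.ne')
  refine HasDerivAt.congr_deriv (f := widthFun γ) h ?_
  field_simp
  ring

lemma hasDerivAt_fluxFun {s : ℝ} (hs : 0 < s) :
    HasDerivAt (fluxFun γ) ((1 - γ * s) / (s * (1 + s))) s := by
  have h0 : 1 + s ≠ 0 := by positivity
  have h1 : HasDerivAt (fun s : ℝ => 1 + s) 1 s := by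
    simpa using (hasDerivAt_id s).const_add 1
  have h := (Real.hasDerivAt_log hs.ne').sub ((h1.log h0).const_mul (γ + 1))
  refine HasDerivAt.congr_deriv (f := fluxFun γ) h ?_
  field_simp
  ring

/-- Both summands have derivatives with the factor γs - 1. The weight γ/(γ+1) makes their remaining
factors cancel at γs = 1 too, which leaves a square and hence one sign on both sides. -/
lemma hasDerivAt_jumpFun (hγ : 0 < γ) {s : ℝ} (hs : 0 < s) :
    HasDerivAt (jumpFun γ)
      (-(γ * (1 - γ * s) ^ 2 / ((γ + 1) * s * (1 + s) * ((2 * γ + 1) * s + γ)))) s := by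
  have h0 : (2 * γ + 1) * s + γ ≠ 0 := by positivity
  have h1 : 1 + s ≠ 0 := by positivity
  have h2 : γ + 1 ≠ 0 := by positivity
  have h := (hasDerivAt_widthFun hγ hs).add ((hasDerivAt_fluxFun (γ := γ) hs).const_mul (γ / (γ + 1)))
  refine HasDerivAt.congr_deriv (f := jumpFun γ) h ?_
  field_simp
  ring

lemma widthFun_lt (hγ : 0 < γ) {s t : ℝ} (hs : 1 ≤ γ * s) (hst : s < t) :
    widthFun γ s < widthFun γ t := by
  have hs0 : 0 < s := pos_of_mul_pos_right (by linarith) hγ.le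
  refine lt_of_hasDerivAt_pos hst (fun x hx => hasDerivAt_widthFun hγ (hs0.trans_le hx.1)) ?_
  intro x hx
  have hx0 : 0 < x := hs0.trans hx.1
  have : γ * s < γ * x := by gcongr; exact hx.1
  have : 0 < γ * x - 1 := by linarith
  positivity

lemma widthFun_gt (hγ : 0 < γ) {s t : ℝ} (hs : 0 < s) (ht : γ * t ≤ 1) (hst : s < t) :
    widthFun γ t < widthFun γ s := by
  refine gt_of_hasDerivAt_neg hst (fun x hx => hasDerivAt_widthFun hγ (hs.trans_le hx.1)) ?_
  intro x hx
  have hx0 : 0 < x := hs.trans hx.1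
  have : γ * x < γ * t := by gcongr; exact hx.2
  apply div_neg_of_neg_of_pos
  · exact mul_neg_of_pos_of_neg hγ (by linarith)
  · positivity

lemma fluxFun_gt (hγ : 0 < γ) {s t : ℝ} (hs : 1 ≤ γ * s) (hst : s < t) :
    fluxFun γ t < fluxFun γ s := by
  have hs0 : 0 < s := pos_of_mul_pos_right (by linarith) hγ.le
  refine gt_of_hasDerivAt_neg hst (fun x hx => hasDerivAt_fluxFun (hs0.trans_le hx.1)) ?_
  intro x hx
  have hx0 : 0 < x := hs0.trans hx.1
  have : γ * s < γ * x := by gcongr; exact hx.1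
  exact div_neg_of_neg_of_pos (by linarith) (by positivity)

lemma fluxFun_lt (hγ : 0 < γ) {s t : ℝ} (hs : 0 < s) (ht : γ * t ≤ 1) (hst : s < t) :
    fluxFun γ s < fluxFun γ t := by
  refine lt_of_hasDerivAt_pos hst (fun x hx => hasDerivAt_fluxFun (hs.trans_le hx.1)) ?_
  intro x hx
  have hx0 : 0 < x := hs.trans hx.1
  have : γ * x < γ * t := by gcongr; exact hx.2
  exact div_pos (by linarith) (by positivity)

lemma jumpFun_gt (hγ : 0 < γ) {s t : ℝ} (hs : 0 < s) (hst : s < t) :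
    jumpFun γ t < jumpFun γ s := by
  -- The derivative vanishes only at γs = 1, so each side is treated alone and the two are joined at
  -- γ⁻¹.
  have key : ∀ s t : ℝ, 0 < s → s < t → (1 ≤ γ * s ∨ γ * t ≤ 1) →
      jumpFun γ t < jumpFun γ s := by
    intro s t hs hst hside
    refine gt_of_hasDerivAt_neg hst (fun x hx => hasDerivAt_jumpFun hγ (hs.trans_le hx.1)) ?_
    intro x hx
    have hx0 : 0 < x := hs.trans hx.1
    have h1 : γ * x < γ * t := by gcongr; exact hx.2
    have h2 : γ * s < γ * x := by gcongr; exact hx.1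
    have h3 : 1 - γ * x ≠ 0 := by rcases hside with h | h <;> intro h0 <;> linarith
    have h4 : 0 < (1 - γ * x) ^ 2 := by positivity
    rw [neg_lt_zero]
    positivity
  by_cases h1 : 1 ≤ γ * s
  · exact key s t hs hst (Or.inl h1)
  by_cases h2 : γ * t ≤ 1
  · exact key s t hs hst (Or.inr h2)
  push Not at h1 h2
  have hγ1 : γ * γ⁻¹ = 1 := mul_inv_cancel₀ hγ.ne'
  have h3 : s < γ⁻¹ := lt_of_mul_lt_mul_left (by linarith) hγ.le
  have h4 : γ⁻¹ < t := lt_of_mul_lt_mul_left (by linarith) hγ.le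
  exact (key _ _ (by positivity) h4 (Or.inl hγ1.ge)).trans (key _ _ hs h3 (Or.inr hγ1.le))

/-- `widthFun + fluxFun` decreases for `γ s ≥ 1`. -/
lemma widthFun_add_fluxFun_gt (hγ : 0 < γ) {s t : ℝ} (hs : 1 ≤ γ * s) (hst : s < t) :
    widthFun γ t + fluxFun γ t < widthFun γ s + fluxFun γ s := by
  have hs0 : 0 < s := pos_of_mul_pos_right (by linarith) hγ.le
  have h1 := jumpFun_gt hγ hs0 hst
  have h2 := fluxFun_gt hγ hs hst
  -- Both terms of this splitting decrease on the subsonic side, although `widthFun` increases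
  -- there.
  have h3 : ∀ x, widthFun γ x + fluxFun γ x = jumpFun γ x + 1 / (γ + 1) * fluxFun γ x := by
    intro x
    have : γ + 1 ≠ 0 := by positivity
    unfold jumpFun
    field_simp
    ring
  rw [h3, h3]
  have : 1 / (γ + 1) * fluxFun γ t < 1 / (γ + 1) * fluxFun γ s := by gcongr
  linarith

/-- Along a stationary curve the density increases with `s`. -/
lemma densityFun_lt (hγ : 0 < γ) {s t : ℝ} (hs : 0 < s) (hst : s < t) :
    (γ + 1) * Real.log s - statLog γ s < (γ + 1) * Real.log t - statLog γ t := by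
  refine lt_of_hasDerivAt_pos (f := fun s => (γ + 1) * Real.log s - statLog γ s) hst
    (fun x hx => ((Real.hasDerivAt_log (hs.trans_le hx.1).ne').const_mul (γ + 1)).sub
      (hasDerivAt_statLog hγ (hs.trans_le hx.1))) ?_
  intro x hx
  have hx0 : 0 < x := hs.trans hx.1
  have : (γ + 1) * x⁻¹ - (γ + 1) ^ 2 / ((2 * γ + 1) * x + γ)
      = (γ + 1) * γ * (x + 1) / (x * ((2 * γ + 1) * x + γ)) := by
    have h0 : (2 * γ + 1) * x + γ ≠ 0 := by positivity
    field_simp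
    ring
  rw [this]
  positivity

/-! ### Limits, and solving equations on either side of the sonic ratio. -/

lemma continuousOn_widthFun (hγ : 0 < γ) : ContinuousOn (widthFun γ) (Ioi 0) :=
  fun _ hx => (hasDerivAt_widthFun hγ hx).continuousAt.continuousWithinAt

lemma continuousOn_fluxFun : ContinuousOn (fluxFun γ) (Ioi 0) :=
  fun _ hx => (hasDerivAt_fluxFun hx).continuousAt.continuousWithinAt

lemma continuousOn_jumpFun (hγ : 0 < γ) : ContinuousOn (jumpFun γ) (Ioi 0) :=
  fun _ hx => (hasDerivAt_jumpFun hγ hx).continuousAt.continuousWithinAt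

/-- `widthFun` is unbounded at infinity. -/
lemma tendsto_widthFun_atTop (hγ : 0 < γ) : Tendsto (widthFun γ) atTop atTop := by
  have hc : 0 < (γ + 1) ^ 2 / (2 * γ + 1) - 1 := by
    have : (γ + 1) ^ 2 / (2 * γ + 1) - 1 = γ ^ 2 / (2 * γ + 1) := by field_simp; ring
    rw [this]; positivity
  refine tendsto_atTop_mono' _ ?_ (Real.tendsto_log_atTop.const_mul_atTop hc)
  filter_upwards [eventually_gt_atTop 0] with s hs
  have h1 : Real.log s ≤ Real.log ((2 * γ + 1) * s + γ) :=
    Real.log_le_log hs (by nlinarith)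
  have h2 : (γ + 1) ^ 2 / (2 * γ + 1) * Real.log s
      ≤ (γ + 1) ^ 2 / (2 * γ + 1) * Real.log ((2 * γ + 1) * s + γ) := by gcongr
  unfold widthFun statLog
  linarith

/-- `widthFun` is unbounded at the vacuum. -/
lemma tendsto_widthFun_zero (hγ : 0 < γ) : Tendsto (widthFun γ) (𝓝[>] 0) atTop := by
  have h0 : Tendsto (fun s => statLog γ 0 + -Real.log s) (𝓝[>] 0) atTop :=
    tendsto_atTop_add_const_left _ _ (tendsto_neg_atBot_atTop.comp Real.tendsto_log_nhdsGT_zero)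
  refine tendsto_atTop_mono' _ ?_ h0
  filter_upwards [self_mem_nhdsWithin] with s hs
  have hs : 0 < s := hs
  have h1 : Real.log ((2 * γ + 1) * 0 + γ) ≤ Real.log ((2 * γ + 1) * s + γ) :=
    Real.log_le_log (by simpa using hγ) (by nlinarith)
  have h2 : statLog γ 0 ≤ statLog γ s := by unfold statLog; gcongr
  unfold widthFun
  linarith

lemma tendsto_fluxFun_atTop (hγ : 0 < γ) : Tendsto (fluxFun γ) atTop atBot := by
  refine tendsto_atBot_mono' _ ?_
    (Real.tendsto_log_atTop.const_mul_atTop_of_neg (neg_lt_zero.2 hγ))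
  filter_upwards [eventually_gt_atTop 0] with s hs
  have h1 : Real.log s ≤ Real.log (1 + s) := Real.log_le_log hs (by linarith)
  have h2 : (γ + 1) * Real.log s ≤ (γ + 1) * Real.log (1 + s) := by gcongr
  unfold fluxFun
  linarith

lemma exists_widthFun_right (hγ : 0 < γ) {s y : ℝ} (hs : 0 < s) (hy : widthFun γ s ≤ y) :
    ∃ t, s ≤ t ∧ widthFun γ t = y := by
  obtain ⟨b, hb, hsb⟩ :=
    (((tendsto_widthFun_atTop hγ).eventually_ge_atTop y).and (eventually_ge_atTop s)).exists
  obtain ⟨t, ht, hty⟩ := intermediate_value_Icc hsb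
    ((continuousOn_widthFun hγ).mono fun x hx => hs.trans_le hx.1) ⟨hy, hb⟩
  exact ⟨t, ht.1, hty⟩

lemma exists_widthFun_left (hγ : 0 < γ) {s y : ℝ} (hs : 0 < s) (hy : widthFun γ s ≤ y) :
    ∃ t, 0 < t ∧ t ≤ s ∧ widthFun γ t = y := by
  obtain ⟨b, ⟨hb, hbs⟩, hb0⟩ :=
    ((((tendsto_widthFun_zero hγ).eventually_ge_atTop y).and
      (mem_nhdsWithin_of_mem_nhds (Iio_mem_nhds hs))).and self_mem_nhdsWithin).exists
  have hb0 : 0 < b := hb0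
  have hbs : b < s := hbs
  obtain ⟨t, ht, hty⟩ := intermediate_value_Icc' hbs.le
    ((continuousOn_widthFun hγ).mono fun x hx => hb0.trans_le hx.1) ⟨hy, hb⟩
  exact ⟨t, hb0.trans_le ht.1, ht.2, hty⟩

lemma exists_fluxFun_right (hγ : 0 < γ) {s y : ℝ} (hs : 0 < s) (hy : y ≤ fluxFun γ s) :
    ∃ t, s ≤ t ∧ fluxFun γ t = y := by
  obtain ⟨b, hb, hsb⟩ :=
    (((tendsto_fluxFun_atTop hγ).eventually_le_atBot y).and (eventually_ge_atTop s)).exists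
  obtain ⟨t, ht, hty⟩ := intermediate_value_Icc' hsb
    (continuousOn_fluxFun.mono fun x hx => hs.trans_le hx.1) ⟨hb, hy⟩
  exact ⟨t, ht.1, hty⟩

/-- Two values of the ratio with the same flux, on the two sides of `γ s = 1`. -/
lemma exists_conjugate (hγ : 0 < γ) {s : ℝ} (hs : 0 < s) (hs1 : γ * s ≤ 1) :
    ∃ t, 1 ≤ γ * t ∧ fluxFun γ t = fluxFun γ s := by
  have hγ1 : γ * γ⁻¹ = 1 := mul_inv_cancel₀ hγ.ne'
  have h3 : s ≤ γ⁻¹ := le_of_mul_le_mul_left (by linarith) hγ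
  have h4 : fluxFun γ s ≤ fluxFun γ γ⁻¹ := by
    rcases h3.eq_or_lt with h | h
    · rw [h]
    · exact (fluxFun_lt hγ hs hγ1.le h).le
  obtain ⟨t, ht, hty⟩ := exists_fluxFun_right hγ (by positivity) h4
  refine ⟨t, ?_, hty⟩
  rw [← hγ1]; gcongr

lemma widthFun_inj_right (hγ : 0 < γ) {s t : ℝ} (hs : 1 ≤ γ * s) (ht : 1 ≤ γ * t)
    (h : widthFun γ s = widthFun γ t) : s = t := by
  rcases lt_trichotomy s t with h' | h' | h'
  · exact absurd h (widthFun_lt hγ hs h').ne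
  · exact h'
  · exact absurd h (widthFun_lt hγ ht h').ne'

lemma widthFun_inj_left (hγ : 0 < γ) {s t : ℝ} (hs0 : 0 < s) (ht0 : 0 < t) (hs : γ * s ≤ 1)
    (ht : γ * t ≤ 1) (h : widthFun γ s = widthFun γ t) : s = t := by
  rcases lt_trichotomy s t with h' | h' | h'
  · exact absurd h (widthFun_gt hγ hs0 ht h').ne'
  · exact h'
  · exact absurd h (widthFun_gt hγ ht0 hs h').ne

lemma fluxFun_inj_right (hγ : 0 < γ) {s t : ℝ} (hs : 1 ≤ γ * s) (ht : 1 ≤ γ * t)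
    (h : fluxFun γ s = fluxFun γ t) : s = t := by
  rcases lt_trichotomy s t with h' | h' | h'
  · exact absurd h (fluxFun_gt hγ hs h').ne'
  · exact h'
  · exact absurd h (fluxFun_gt hγ ht h').ne

/-! ### Positive states and the stationary curves -/

noncomputable section

/-- All components are positive. -/
structure State.Positive (V : State) : Prop where
  u : 0 < V.u
  ρ : 0 < V.ρ
  a : 0 < V.a

/-- The ratio `ρ ^ γ / u`. -/
def ratio (γ : ℝ) (V : State) : ℝ := V.ρ ^ γ / V.u

/-- A function that is constant along stationary solutions. -/
def statInv (γ : ℝ) (V : State) : ℝ := (γ + 1) * Real.log V.u + statLog γ (ratio γ V)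

/-- The logarithm of the flux `a ρ u`, multiplied by `γ`. -/
def fluxInv (γ : ℝ) (V : State) : ℝ := γ * (Real.log V.a + Real.log V.ρ + Real.log V.u)

/-- The state with velocity `exp x`, ratio `s` and width `a`. -/
def ofRatio (γ x s a : ℝ) : State := ⟨Real.exp x, Real.exp ((Real.log s + x) / γ), a⟩

end

variable {V W : State}

lemma State.Positive.ratio_pos (hV : V.Positive) : 0 < ratio γ V :=
  div_pos (Real.rpow_pos_of_pos hV.ρ γ) hV.u

lemma State.Positive.log_ratio (hV : V.Positive) :
    Real.log (ratio γ V) = γ * Real.log V.ρ - Real.log V.u := by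
  rw [ratio, Real.log_div (Real.rpow_pos_of_pos hV.ρ γ).ne' hV.u.ne', Real.log_rpow hV.ρ]

lemma State.Positive.ratio_mul (hV : V.Positive) : ratio γ V * V.u = V.ρ ^ γ := by
  rw [ratio, div_mul_cancel₀ _ hV.u.ne']

lemma State.Positive.widthFun_ratio (hV : V.Positive) :
    widthFun γ (ratio γ V) = statInv γ V - fluxInv γ V + γ * Real.log V.a := by
  unfold widthFun statInv fluxInv
  rw [hV.log_ratio]
  ring

lemma State.Positive.fluxFun_ratio (hV : V.Positive) :
    fluxFun γ (ratio γ V)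
      = fluxInv γ V - γ * Real.log V.a - (γ + 1) * Real.log (V.u + V.ρ ^ γ) := by
  have h1 : V.u + V.ρ ^ γ = V.u * (1 + ratio γ V) := by rw [← hV.ratio_mul]; ring
  have h2 : 0 < 1 + ratio γ V := by have := hV.ratio_pos (γ := γ); positivity
  unfold fluxFun fluxInv
  rw [h1, hV.log_ratio, Real.log_mul hV.u.ne' h2.ne']
  ring

lemma ofRatio_positive {x s a : ℝ} (ha : 0 < a) : (ofRatio γ x s a).Positive :=
  ⟨Real.exp_pos _, Real.exp_pos _, ha⟩

lemma ratio_ofRatio (hγ : 0 < γ) {x s a : ℝ} (hs : 0 < s) : ratio γ (ofRatio γ x s a) = s := by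
  have h : Real.exp ((Real.log s + x) / γ) ^ γ = s * Real.exp x := by
    rw [← Real.exp_mul, div_mul_cancel₀ _ hγ.ne', Real.exp_add, Real.exp_log hs]
  simp only [ratio, ofRatio, h]
  field_simp

lemma State.Positive.eq_of_ratio (hγ : 0 < γ) (hV : V.Positive) (hW : W.Positive)
    (hu : V.u = W.u) (ha : V.a = W.a) (hs : ratio γ V = ratio γ W) : V = W := by
  have h : V.ρ ^ γ = W.ρ ^ γ := by rw [← hV.ratio_mul, ← hW.ratio_mul, hs, hu]
  exact State.ext hu ((Real.rpow_left_inj hV.ρ.le hW.ρ.le hγ.ne').1 h) ha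

lemma State.Positive.eq_of_statInv (hγ : 0 < γ) (hV : V.Positive) (hW : W.Positive)
    (hI : statInv γ V = statInv γ W) (ha : V.a = W.a) (hs : ratio γ V = ratio γ W) : V = W := by
  refine hV.eq_of_ratio hγ hW ?_ ha hs
  unfold statInv at hI
  rw [hs, add_left_inj] at hI
  exact Real.log_injOn_pos hV.u hW.u (mul_left_cancel₀ (by positivity) hI)

/-! ### Stationary contacts as level sets of the two invariants. -/

lemma StationaryContact.positive (h : StationaryContact γ V W) : V.Positive ∧ W.Positive := by
  obtain ⟨u, ρ, a, -, -, -, hpos, -, rfl, rfl⟩ := h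
  have h0 := hpos 0 (by simp)
  have h1 := hpos 1 (by simp)
  exact ⟨⟨h0.1, h0.2.1, h0.2.2⟩, ⟨h1.1, h1.2.1, h1.2.2⟩⟩

/-- The stationary equations make the logarithmic derivative of `statInv` vanish. -/
lemma statInv_deriv_eq_zero (hγ : 0 < γ) {u ρ a u' ρ' a' q : ℝ} (hu : 0 < u) (hρ : 0 < ρ)
    (ha : 0 < a) (hq : 0 < q) (h1 : (a' * ρ + a * ρ') * u + a * ρ * u' = 0)
    (h2 : a * ρ * u * (u' + γ * q * ρ' / ρ) = ρ * u * q * a') :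
    (γ + 1) * (u' / u) + (γ + 1) ^ 2 / ((2 * γ + 1) * (q / u) + γ)
      * ((γ * q * ρ' / ρ * u - q * u') / u ^ 2) = 0 := by
  -- Conservation of mass eliminates a'. What remains is a linear relation between u' and ρ', and
  -- the derivative of `statInv` is a multiple of it.
  have h3 : ρ * a' * u = -(a * ρ' * u + a * ρ * u') := by linarith
  have h4 : a * (u * ρ * u' + γ * q * ρ' * u + q * (ρ' * u + ρ * u')) = 0 := by
    have : a * ρ * u * (u' + γ * q * ρ' / ρ) = a * u * (ρ * u' + γ * q * ρ') := by
      field_simp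
    rw [this] at h2
    linear_combination h2 + q * h3
  have h5 : u * ρ * u' + γ * q * ρ' * u + q * (ρ' * u + ρ * u') = 0 :=
    (mul_eq_zero.1 h4).resolve_left ha.ne'
  have h6 : (2 * γ + 1) * q + γ * u ≠ 0 := by positivity
  have h7 : (γ + 1) * (u' / u) + (γ + 1) ^ 2 / ((2 * γ + 1) * (q / u) + γ)
      * ((γ * q * ρ' / ρ * u - q * u') / u ^ 2)
      = (γ + 1) * γ * (u * ρ * u' + γ * q * ρ' * u + q * (ρ' * u + ρ * u'))
        / (u * ρ * ((2 * γ + 1) * q + γ * u)) := by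
    have h8 : (2 * γ + 1) * (q / u) + γ = ((2 * γ + 1) * q + γ * u) / u := by field_simp
    rw [h8]
    field_simp
    ring
  rw [h7, h5]
  simp

lemma StationaryContact.invariants (hγ : 0 < γ) (h : StationaryContact γ V W) :
    statInv γ V = statInv γ W ∧ fluxInv γ V = fluxInv γ W := by
  obtain ⟨u, ρ, a, hu, hρ, ha, hpos, heq, rfl, rfl⟩ := h
  have hU : UniqueDiffOn ℝ (Icc (0 : ℝ) 1) := uniqueDiffOn_Icc one_pos
  have du : ∀ x ∈ Icc (0 : ℝ) 1, HasDerivWithinAt u (derivWithin u (Icc 0 1) x) (Icc 0 1) x :=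
    fun x hx => (hu.differentiableOn one_ne_zero x hx).hasDerivWithinAt
  have dρ : ∀ x ∈ Icc (0 : ℝ) 1, HasDerivWithinAt ρ (derivWithin ρ (Icc 0 1) x) (Icc 0 1) x :=
    fun x hx => (hρ.differentiableOn one_ne_zero x hx).hasDerivWithinAt
  have da : ∀ x ∈ Icc (0 : ℝ) 1, HasDerivWithinAt a (derivWithin a (Icc 0 1) x) (Icc 0 1) x :=
    fun x hx => (ha.differentiableOn one_ne_zero x hx).hasDerivWithinAt
  have dm := fun x hx => ((da x hx).mul (dρ x hx)).mul (du x hx)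
  have dp : ∀ x ∈ Icc (0 : ℝ) 1, HasDerivWithinAt (fun y => ρ y ^ γ)
      (γ * ρ x ^ γ * derivWithin ρ (Icc 0 1) x / ρ x) (Icc 0 1) x := by
    intro x hx
    have hx0 := (hpos x hx).2.1
    refine ((dρ x hx).rpow_const (Or.inl hx0.ne')).congr_deriv ?_
    rw [Real.rpow_sub_one hx0.ne']
    ring
  have hm0 : ∀ x ∈ Icc (0 : ℝ) 1, (derivWithin a (Icc 0 1) x * ρ x
      + a x * derivWithin ρ (Icc 0 1) x) * u x + a x * ρ x * derivWithin u (Icc 0 1) x = 0 :=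
    fun x hx => ((dm x hx).derivWithin (hU x hx)).symm.trans (heq x hx).1
  have hconst : a 1 * ρ 1 * u 1 = a 0 * ρ 0 * u 0 :=
    constant_of_derivWithin_zero (f := fun y => a y * ρ y * u y)
      (fun x hx => (dm x hx).differentiableWithinAt)
      (fun x hx => (heq x (Ico_subset_Icc_self hx)).1) 1 (by simp)
  have h0 := hpos 0 (by simp)
  have h1 := hpos 1 (by simp)
  constructor
  · have dF : ∀ x ∈ Icc (0 : ℝ) 1, HasDerivWithinAt
        (fun y => (γ + 1) * Real.log (u y) + statLog γ (ρ y ^ γ / u y)) 0 (Icc 0 1) x := by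
      intro x hx
      obtain ⟨hux, hρx, hax⟩ := hpos x hx
      have hq := Real.rpow_pos_of_pos hρx γ
      have e2 : a x * ρ x * u x * (derivWithin u (Icc 0 1) x
          + γ * ρ x ^ γ * derivWithin ρ (Icc 0 1) x / ρ x)
          = ρ x * u x * ρ x ^ γ * derivWithin a (Icc 0 1) x := by
        -- Since (aρu)' = 0, the momentum derivative reduces to aρu (u + ρ^γ)'.
        have h := (((dm x hx).mul ((du x hx).add (dp x hx))).derivWithin (hU x hx)).symm.trans
          (heq x hx).2
        dsimp at h
        rw [hm0 x hx, zero_mul, zero_add] at h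
        exact h
      have hd := (((du x hx).log hux.ne').const_mul (γ + 1)).add
        ((hasDerivAt_statLog hγ (div_pos hq hux)).comp_hasDerivWithinAt x
          ((dp x hx).div (du x hx) hux.ne'))
      exact hd.congr_deriv (statInv_deriv_eq_zero hγ hux hρx hax hq (hm0 x hx) e2)
    exact (constant_of_derivWithin_zero
      (f := fun y => (γ + 1) * Real.log (u y) + statLog γ (ρ y ^ γ / u y))
      (fun x hx => (dF x hx).differentiableWithinAt)
      (fun x hx => (dF x (Ico_subset_Icc_self hx)).derivWithin
        (hU x (Ico_subset_Icc_self hx))) 1 (by simp)).symm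
  · have := congrArg Real.log hconst
    rw [Real.log_mul (by have := h1.2.1; have := h1.2.2; positivity) h1.1.ne',
      Real.log_mul h1.2.2.ne' h1.2.1.ne',
      Real.log_mul (by have := h0.2.1; have := h0.2.2; positivity) h0.1.ne',
      Real.log_mul h0.2.2.ne' h0.2.1.ne'] at this
    simp only [fluxInv]
    rw [this]

/-- The ratio interpolates affinely along the connecting stationary solution. -/
lemma stationaryContact_of_invariants (hγ : 0 < γ) (hV : V.Positive) (hW : W.Positive)
    (hI : statInv γ V = statInv γ W) (hQ : fluxInv γ V = fluxInv γ W) :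
    StationaryContact γ V W := by
  set s₀ := ratio γ V with hs₀
  set s₁ := ratio γ W with hs₁
  set P := statInv γ V with hP
  set Q := fluxInv γ V with hQ'
  have hs₀p : 0 < s₀ := hV.ratio_pos
  have hs₁p : 0 < s₁ := hW.ratio_pos
  let s : ℝ → ℝ := fun t => s₀ + t * (s₁ - s₀)
  let x : ℝ → ℝ := fun t => (P - statLog γ (s t)) / (γ + 1)
  let r : ℝ → ℝ := fun t => (Real.log (s t) + x t) / γ
  let b : ℝ → ℝ := fun t => Q / γ - r t - x t
  have hspos : ∀ t ∈ Icc (0 : ℝ) 1, 0 < s t := by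
    intro t ht
    have : s t = (1 - t) * s₀ + t * s₁ := by simp only [s]; ring
    rw [this]
    rcases ht.1.eq_or_lt with h | h
    · rw [← h]; simpa using hs₀p
    · have : 0 ≤ 1 - t := by linarith [ht.2]
      positivity
  have cs : ContDiffOn ℝ 1 s (Icc 0 1) := by
    have : ContDiff ℝ 1 s := by fun_prop
    exact this.contDiffOn
  have clog : ContDiffOn ℝ 1 (fun t => Real.log (s t)) (Icc 0 1) :=
    cs.log fun t ht => (hspos t ht).ne'
  have cx : ContDiffOn ℝ 1 x (Icc 0 1) := by
    have h1 : ContDiffOn ℝ 1 (fun t => Real.log ((2 * γ + 1) * s t + γ)) (Icc 0 1) := by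
      refine ((contDiffOn_const.mul cs).add contDiffOn_const).log fun t ht => ?_
      have := hspos t ht
      positivity
    exact (contDiffOn_const.sub (contDiffOn_const.mul h1)).div_const _
  have cr : ContDiffOn ℝ 1 r (Icc 0 1) := (clog.add cx).div_const _
  have cb : ContDiffOn ℝ 1 b (Icc 0 1) := (contDiffOn_const.sub cr).sub cx
  have hU : UniqueDiffOn ℝ (Icc (0 : ℝ) 1) := uniqueDiffOn_Icc one_pos
  have hend : ∀ (X : State) (t : ℝ), X.Positive → statInv γ X = P → fluxInv γ X = Q →
      ratio γ X = s t → (⟨Real.exp (x t), Real.exp (r t), Real.exp (b t)⟩ : State) = X := by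
    intro X t hX hXP hXQ hXs
    have hx : x t = Real.log X.u := by
      simp only [x]
      rw [← hXP, ← hXs, statInv]
      field_simp
      ring
    have hr : r t = Real.log X.ρ := by
      simp only [r]
      rw [hx, ← hXs, hX.log_ratio]
      field_simp
      ring
    have hb : b t = Real.log X.a := by
      simp only [b]
      rw [hx, hr, ← hXQ, fluxInv]
      field_simp
      ring
    rw [hx, hr, hb, Real.exp_log hX.u, Real.exp_log hX.ρ, Real.exp_log hX.a]
  have hm : ∀ t, Real.exp (b t) * Real.exp (r t) * Real.exp (x t) = Real.exp (Q / γ) := by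
    intro t
    rw [← Real.exp_add, ← Real.exp_add]
    congr 1
    simp only [b]
    ring
  have hp : ∀ t ∈ Icc (0 : ℝ) 1, Real.exp (r t) ^ γ = s t * Real.exp (x t) := by
    intro t ht
    simp only [r]
    rw [← Real.exp_mul, div_mul_cancel₀ _ hγ.ne', Real.exp_add, Real.exp_log (hspos t ht)]
  refine ⟨fun t => Real.exp (x t), fun t => Real.exp (r t), fun t => Real.exp (b t),
    cx.exp, cr.exp, cb.exp, fun t _ => ⟨Real.exp_pos _, Real.exp_pos _, Real.exp_pos _⟩,
    fun t ht => ⟨?_, ?_⟩, hend V 0 hV rfl rfl (by simp [s, hs₀]),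
    hend W 1 hW hI.symm hQ.symm (by simp [s, hs₁])⟩
  · simp only [hm]
    simp
  · have hst := hspos t ht
    have ds : HasDerivAt s (s₁ - s₀) t := by
      refine HasDerivAt.congr_deriv (f := s)
        (((hasDerivAt_id t).mul_const (s₁ - s₀)).const_add s₀) (one_mul _)
    have dx : HasDerivAt x (-((γ + 1) / ((2 * γ + 1) * s t + γ) * (s₁ - s₀))) t := by
      have h := (((hasDerivAt_statLog hγ hst).comp t ds).const_sub P).div_const (γ + 1)
      refine HasDerivAt.congr_deriv (f := x) h ?_
      field_simp
    set x' := -((γ + 1) / ((2 * γ + 1) * s t + γ) * (s₁ - s₀)) with hx'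
    have dr : HasDerivAt r (((s₁ - s₀) / s t + x') / γ) t :=
      ((ds.log hst.ne').add dx).div_const γ
    have db : HasDerivAt b (-(((s₁ - s₀) / s t + x') / γ) - x') t := by
      exact (dr.const_sub (Q / γ)).sub dx
    have dl : HasDerivWithinAt (fun y => Real.exp (b y) * Real.exp (r y) * Real.exp (x y)
        * (Real.exp (x y) + Real.exp (r y) ^ γ))
        (Real.exp (Q / γ) * (Real.exp (x t) * x'
          + ((s₁ - s₀) * Real.exp (x t) + s t * (Real.exp (x t) * x')))) (Icc 0 1) t := by
      have h := ((dx.exp.add (ds.mul dx.exp)).const_mul (Real.exp (Q / γ))).hasDerivWithinAt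
        (s := Icc 0 1)
      refine h.congr (fun y hy => ?_) ?_
      · rw [hm, hp y hy]; rfl
      · rw [hm, hp t ht]; rfl
    rw [dl.derivWithin (hU t ht), db.exp.hasDerivWithinAt.derivWithin (hU t ht), hp t ht, ← hm t,
      hx']
    have h6 : (2 * γ + 1) * s t + γ ≠ 0 := by positivity
    field_simp
    ring

lemma stationaryContact_iff (hγ : 0 < γ) : StationaryContact γ V W ↔
    V.Positive ∧ W.Positive ∧ statInv γ V = statInv γ W ∧ fluxInv γ V = fluxInv γ W :=
  ⟨fun h => ⟨h.positive.1, h.positive.2, h.invariants hγ⟩,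
    fun h => stationaryContact_of_invariants hγ h.1 h.2.1 h.2.2.1 h.2.2.2⟩

/-- On a stationary curve the density is an increasing function of the ratio. -/
lemma ratio_le_of_density_le (hγ : 0 < γ) (hV : V.Positive) (hW : W.Positive)
    (hI : statInv γ V = statInv γ W) (h : V.ρ ≤ W.ρ) : ratio γ V ≤ ratio γ W := by
  by_contra! hlt
  have h1 := densityFun_lt hγ hW.ratio_pos hlt
  have h2 : Real.log V.ρ ≤ Real.log W.ρ := Real.log_le_log hV.ρ h
  -- Eliminating u between the ratio and `statInv` leaves log ρ as a function of the ratio alone.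
  have h3 : ∀ X : State, X.Positive → (γ + 1) * Real.log (ratio γ X) - statLog γ (ratio γ X)
      = (γ + 1) * (γ * Real.log X.ρ) - statInv γ X := by
    intro X hX
    rw [hX.log_ratio, statInv]
    ring
  rw [h3 V hV, h3 W hW, hI] at h1
  have : (γ + 1) * (γ * Real.log V.ρ) ≤ (γ + 1) * (γ * Real.log W.ρ) := by gcongr
  linarith

lemma density_lt_of_ratio_lt (hγ : 0 < γ) (hV : V.Positive) (hW : W.Positive)
    (hI : statInv γ V = statInv γ W) (h : ratio γ V < ratio γ W) : V.ρ < W.ρ := by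
  by_contra! hle
  exact h.not_ge (ratio_le_of_density_le hγ hW hV hI.symm hle)

/-! ### Global entropy and the sonic curve. -/

lemma width_le_of_widthFun_le (hγ : 0 < γ) (hV : V.Positive) (hW : W.Positive)
    (hI : statInv γ V = statInv γ W) (hQ : fluxInv γ V = fluxInv γ W)
    (h : widthFun γ (ratio γ V) ≤ widthFun γ (ratio γ W)) : V.a ≤ W.a := by
  rw [hV.widthFun_ratio, hW.widthFun_ratio, hI, hQ] at h
  have : γ * Real.log V.a ≤ γ * Real.log W.a := by linarith
  exact (Real.log_le_log_iff hV.a hW.a).1 (le_of_mul_le_mul_left this hγ)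

lemma widthFun_le (hγ : 0 < γ) {s t : ℝ} (hs : 1 ≤ γ * s) (hst : s ≤ t) :
    widthFun γ s ≤ widthFun γ t := by
  rcases hst.eq_or_lt with rfl | h
  · exact le_rfl
  · exact (widthFun_lt hγ hs h).le

lemma widthFun_ge (hγ : 0 < γ) {s t : ℝ} (hs : 0 < s) (ht : γ * t ≤ 1) (hst : s ≤ t) :
    widthFun γ t ≤ widthFun γ s := by
  rcases hst.eq_or_lt with rfl | h
  · exact le_rfl
  · exact (widthFun_gt hγ hs ht h).le

/-- The density orders the curve in the same way as the ratio. States between V and W thus stay on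
one side of the sonic point, where `widthFun`, and with it the width, is monotone. -/
lemma stationaryWave_of_invariants (hγ : 0 < γ) (hV : V.Positive) (hW : W.Positive)
    (ha : V.a ≠ W.a) (hI : statInv γ V = statInv γ W) (hQ : fluxInv γ V = fluxInv γ W)
    (hside : (γ * ratio γ V ≤ 1 ∧ γ * ratio γ W ≤ 1) ∨ (1 ≤ γ * ratio γ V ∧ 1 ≤ γ * ratio γ W)) :
    StationaryWave γ V W := by
  refine ⟨ha, stationaryContact_of_invariants hγ hV hW hI hQ, ?_⟩
  rcases hside with ⟨h1, h2⟩ | ⟨h1, h2⟩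
  · refine Or.inr fun X Y hX hY hXm hYm hXY => ?_
    obtain ⟨-, hXp, hXI, hXQ⟩ := (stationaryContact_iff hγ).1 hX
    obtain ⟨-, hYp, hYI, hYQ⟩ := (stationaryContact_iff hγ).1 hY
    refine width_le_of_widthFun_le hγ hYp hXp (hYI.symm.trans hXI) (hYQ.symm.trans hXQ) ?_
    refine widthFun_ge hγ hXp.ratio_pos ?_
      (ratio_le_of_density_le hγ hXp hYp (hXI.symm.trans hYI) hXY)
    rcases le_max_iff.1 hYm.2 with h | h
    · have := ratio_le_of_density_le hγ hYp hV hYI.symm h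
      exact (mul_le_mul_of_nonneg_left this hγ.le).trans h1
    · have := ratio_le_of_density_le hγ hYp hW (hYI.symm.trans hI) h
      exact (mul_le_mul_of_nonneg_left this hγ.le).trans h2
  · refine Or.inl fun X Y hX hY hXm hYm hXY => ?_
    obtain ⟨-, hXp, hXI, hXQ⟩ := (stationaryContact_iff hγ).1 hX
    obtain ⟨-, hYp, hYI, hYQ⟩ := (stationaryContact_iff hγ).1 hY
    refine width_le_of_widthFun_le hγ hXp hYp (hXI.symm.trans hYI) (hXQ.symm.trans hYQ) ?_
    refine widthFun_le hγ ?_ (ratio_le_of_density_le hγ hXp hYp (hXI.symm.trans hYI) hXY)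
    rcases min_le_iff.1 hXm.1 with h | h
    · have := ratio_le_of_density_le hγ hV hXp hXI h
      exact h1.trans (mul_le_mul_of_nonneg_left this hγ.le)
    · have := ratio_le_of_density_le hγ hW hXp (hI.symm.trans hXI) h
      exact h2.trans (mul_le_mul_of_nonneg_left this hγ.le)

/-- The sonic state on the stationary curve of `V`. -/
lemma exists_sonic_stationary (hγ : 0 < γ) (hV : V.Positive) :
    ∃ X : State, StationaryContact γ V X ∧ γ * ratio γ X = 1 := by
  have hs : 0 < γ⁻¹ := by positivity
  let x := (statInv γ V - statLog γ γ⁻¹) / (γ + 1)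
  let X := ofRatio γ x γ⁻¹ (Real.exp ((fluxInv γ V - γ * x) / γ - (Real.log γ⁻¹ + x) / γ))
  have hXp : X.Positive := ofRatio_positive (Real.exp_pos _)
  have hr : ratio γ X = γ⁻¹ := ratio_ofRatio hγ hs
  refine ⟨X, stationaryContact_of_invariants hγ hV hXp ?_ ?_, ?_⟩
  · rw [statInv, statInv, hr]
    simp only [X, ofRatio, Real.log_exp, x, statInv]
    field_simp
    ring
  · simp only [fluxInv, X, ofRatio, Real.log_exp]
    field_simp
    ring
  · rw [hr]; exact mul_inv_cancel₀ hγ.ne'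

/-- Because `widthFun` is minimal at the sonic ratio, a curve crossing it narrows first and widens
afterwards. This refutes both alternatives of `GlobalEntropy`. -/
lemma sonic_state_between (hγ : 0 < γ) (hV : V.Positive) (hW : W.Positive)
    (hI : statInv γ V = statInv γ W) (hQ : fluxInv γ V = fluxInv γ W) {X : State}
    (hX : StationaryContact γ V X) (hXs : γ * ratio γ X = 1)
    (h1 : γ * ratio γ V < 1) (h2 : 1 < γ * ratio γ W) :
    V.ρ < X.ρ ∧ X.ρ < W.ρ ∧ X.a < V.a ∧ X.a < W.a := by
  obtain ⟨-, hXp, hXI, hXQ⟩ := (stationaryContact_iff hγ).1 hX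
  have h3 : ratio γ V < ratio γ X := lt_of_mul_lt_mul_left (by linarith) hγ.le
  have h4 : ratio γ X < ratio γ W := lt_of_mul_lt_mul_left (by linarith) hγ.le
  refine ⟨density_lt_of_ratio_lt hγ hV hXp hXI h3,
    density_lt_of_ratio_lt hγ hXp hW (hXI.symm.trans hI) h4, ?_, ?_⟩
  · by_contra! h
    have := widthFun_gt hγ hV.ratio_pos hXs.le h3
    rw [hXp.widthFun_ratio, hV.widthFun_ratio, hXI, hXQ] at this
    have h5 : γ * Real.log V.a ≤ γ * Real.log X.a := by
      have := Real.log_le_log hV.a h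
      gcongr
    linarith
  · by_contra! h
    have := widthFun_lt hγ hXs.ge h4
    rw [hXp.widthFun_ratio, hW.widthFun_ratio, ← hI, ← hQ, hXI, hXQ] at this
    have h5 : γ * Real.log W.a ≤ γ * Real.log X.a := by
      have := Real.log_le_log hW.a h
      gcongr
    linarith

/-- Stationary waves do not cross the sonic curve. -/
lemma StationaryWave.sameSide (hγ : 0 < γ) (h : StationaryWave γ V W) :
    (γ * ratio γ V ≤ 1 ∧ γ * ratio γ W ≤ 1) ∨ (1 ≤ γ * ratio γ V ∧ 1 ≤ γ * ratio γ W) := by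
  obtain ⟨-, hc, hE⟩ := h
  obtain ⟨hV, hW, hI, hQ⟩ := (stationaryContact_iff hγ).1 hc
  obtain ⟨X, hX, hXs⟩ := exists_sonic_stationary hγ hV
  have hVV : StationaryContact γ V V := stationaryContact_of_invariants hγ hV hV rfl rfl
  by_contra! hcon
  rcases le_or_gt (γ * ratio γ V) 1 with h1 | h1
  · have h2 := hcon.1 h1
    have h1' : γ * ratio γ V < 1 := by
      by_contra! h
      exact absurd (hcon.2 h) (not_lt.2 h2.le)
    obtain ⟨k1, k2, k3, k4⟩ := sonic_state_between hγ hV hW hI hQ hX hXs h1' h2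
    -- The pair (V, X) contradicts a nondecreasing width, the pair (X, W) a nonincreasing one.
    rw [GlobalEntropy, uIcc_of_le (k1.trans k2).le] at hE
    rcases hE with hE | hE
    · exact absurd (hE V X hVV hX ⟨le_rfl, (k1.trans k2).le⟩ ⟨k1.le, k2.le⟩ k1.le) (not_le.2 k3)
    · exact absurd (hE X W hX hc ⟨k1.le, k2.le⟩ ⟨(k1.trans k2).le, le_rfl⟩ k2.le) (not_le.2 k4)
  · have h2 := hcon.2 h1.le
    have hX' : StationaryContact γ W X := by
      obtain ⟨-, hXp, hXI, hXQ⟩ := (stationaryContact_iff hγ).1 hX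
      exact stationaryContact_of_invariants hγ hW hXp (hI.symm.trans hXI) (hQ.symm.trans hXQ)
    obtain ⟨k1, k2, k3, k4⟩ := sonic_state_between hγ hW hV hI.symm hQ.symm hX' hXs h2 h1
    rw [GlobalEntropy, uIcc_of_ge (k1.trans k2).le] at hE
    rcases hE with hE | hE
    · exact absurd (hE W X hc hX ⟨le_rfl, (k1.trans k2).le⟩ ⟨k1.le, k2.le⟩ k1.le) (not_le.2 k3)
    · exact absurd (hE X V hX hVV ⟨k1.le, k2.le⟩ ⟨(k1.trans k2).le, le_rfl⟩ k2.le) (not_le.2 k4)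

lemma stationaryWave_iff (hγ : 0 < γ) : StationaryWave γ V W ↔
    V.Positive ∧ W.Positive ∧ V.a ≠ W.a ∧ statInv γ V = statInv γ W ∧
      fluxInv γ V = fluxInv γ W ∧
      ((γ * ratio γ V ≤ 1 ∧ γ * ratio γ W ≤ 1) ∨
        (1 ≤ γ * ratio γ V ∧ 1 ≤ γ * ratio γ W)) := by
  constructor
  · intro h
    obtain ⟨hV, hW, hI, hQ⟩ := (stationaryContact_iff hγ).1 h.2.1
    exact ⟨hV, hW, h.1, hI, hQ, h.sameSide hγ⟩
  · rintro ⟨hV, hW, ha, hI, hQ, hside⟩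
    exact stationaryWave_of_invariants hγ hV hW ha hI hQ hside

/-! ### Shocks -/

/-- The momentum relation minus (u + ρ^γ) at V times the mass relation is the mass flux ρ(u - σ)
times the jump of u + ρ^γ. The inequality σ < u at W makes this flux nonzero, so u + ρ^γ does not
jump; the Lax inequalities then order the densities. -/
lemma LaxShock.curve (hγ : 0 < γ) {σ : ℝ} (h : LaxShock γ σ V W) :
    W.a = V.a ∧ W.u + W.ρ ^ γ = V.u + V.ρ ^ γ ∧ V.ρ < W.ρ ∧ σ = shockSpeed V W := by
  obtain ⟨hV, hW, ⟨ha, hm, hp⟩, h1, h2, h3⟩ := h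
  have hj : W.ρ * (W.u - σ) = V.ρ * (V.u - σ) := by linarith
  have hjp : 0 < W.ρ * (W.u - σ) := mul_pos hW (by linarith)
  have hw : W.u + W.ρ ^ γ = V.u + V.ρ ^ γ := by
    refine mul_left_cancel₀ hjp.ne' ?_
    linear_combination hp - (V.u + V.ρ ^ γ) * hm
  have hq : V.ρ ^ γ < W.ρ ^ γ := by
    unfold lam at h1 h2
    nlinarith
  have hρ : V.ρ < W.ρ := (Real.rpow_lt_rpow_iff hV.le hW.le hγ).1 hq
  refine ⟨ha, hw, hρ, ?_⟩
  rw [shockSpeed, eq_div_iff (by linarith)]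
  linarith

/-- The speed is a difference quotient of cρ - ρ^(γ+1), whose derivative is λ₁. By the mean value
theorem it equals λ₁ at an intermediate density, and λ₁ decreases with ρ. -/
lemma laxShock_of_curve (hγ : 0 < γ) (hV : 0 < V.ρ) (ha : W.a = V.a)
    (hw : W.u + W.ρ ^ γ = V.u + V.ρ ^ γ) (hρ : V.ρ < W.ρ) :
    LaxShock γ (shockSpeed V W) V W := by
  have hW : 0 < W.ρ := hV.trans hρ
  have hd : 0 < W.ρ - V.ρ := by linarith
  set σ := shockSpeed V W with hσ
  have hm : σ * (W.ρ - V.ρ) = W.ρ * W.u - V.ρ * V.u := by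
    rw [hσ, shockSpeed, div_mul_cancel₀ _ hd.ne']
  obtain ⟨c, hc, hcd⟩ := exists_hasDerivAt_eq_slope (fun x : ℝ => x ^ (γ + 1))
    (fun x => (γ + 1) * x ^ γ) hρ
    (Real.continuous_rpow_const (by positivity)).continuousOn
    (fun x _ => by simpa using Real.hasDerivAt_rpow_const (x := x) (p := γ + 1) (Or.inr (by linarith)))
  rw [eq_div_iff hd.ne'] at hcd
  rw [Real.rpow_add_one hW.ne', Real.rpow_add_one hV.ne'] at hcd
  have hc0 : 0 < c := hV.trans hc.1
  have hqV : V.ρ ^ γ < c ^ γ := Real.rpow_lt_rpow hV.le hc.1 hγ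
  have hqW : c ^ γ < W.ρ ^ γ := Real.rpow_lt_rpow hc0.le hc.2 hγ
  have hσc : σ = V.u + V.ρ ^ γ - (γ + 1) * c ^ γ := by
    refine mul_right_cancel₀ hd.ne' ?_
    have hWu : W.u = V.u + V.ρ ^ γ - W.ρ ^ γ := by linarith
    rw [hm, sub_mul, hcd, hWu]
    ring
  refine ⟨hV, hW, ⟨ha, by linarith, ?_⟩, ?_, ?_, ?_⟩
  · rw [hw]
    linear_combination (-(V.u + V.ρ ^ γ)) * hm
  · rw [lam, hσc]
    nlinarith
  · rw [lam, hσc]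
    nlinarith
  · refine lt_of_mul_lt_mul_right ?_ hd.le
    rw [hm]
    have : W.u < V.u := by linarith
    nlinarith

lemma LaxShock.congr_speed (hγ : 0 < γ) {σ : ℝ} (h : LaxShock γ σ V W) :
    LaxShock γ (shockSpeed V W) V W := (h.curve hγ).2.2.2 ▸ h

/-! ### Gluing waves -/

lemma TendsToState.congr' {U U' : ℝ → State} {l : Filter ℝ} (h : TendsToState U l V)
    (hU : U' =ᶠ[l] U) : TendsToState U' l V :=
  ⟨h.1.congr' (hU.mono fun _ hx => by dsimp only; rw [hx]),
    h.2.1.congr' (hU.mono fun _ hx => by dsimp only; rw [hx]),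
    h.2.2.congr' (hU.mono fun _ hx => by dsimp only; rw [hx])⟩

lemma tendsToState_const {l : Filter ℝ} : TendsToState (fun _ => V) l V :=
  ⟨tendsto_const_nhds, tendsto_const_nhds, tendsto_const_nhds⟩

lemma SolvesAt.congr {U U' : ℝ → State} {ξ : ℝ} (h : SolvesAt γ U ξ) (hU : U' =ᶠ[𝓝 ξ] U) :
    SolvesAt γ U' ξ := by
  have hc : ∀ g : State → ℝ, (fun s => g (U' s)) =ᶠ[𝓝 ξ] fun s => g (U s) :=
    fun g => hU.mono fun _ hx => by dsimp only; rw [hx]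
  obtain ⟨h1, h2, m, f, n, g, b, hm, hf, hn, hg, hb, e1, e2, e3⟩ := h
  refine ⟨h1.congr_of_eventuallyEq (hc _), h2.congr_of_eventuallyEq (hc _), m, f, n, g, b,
    hm.congr_of_eventuallyEq (hc fun X => X.a * X.ρ),
    hf.congr_of_eventuallyEq (hc fun X => X.a * X.ρ * X.u),
    hn.congr_of_eventuallyEq (hc fun X => X.a * X.ρ * (X.u + X.ρ ^ γ)),
    hg.congr_of_eventuallyEq (hc fun X => X.a * X.ρ * X.u * (X.u + X.ρ ^ γ)),
    hb.congr_of_eventuallyEq (hc _), e1, ?_, e3⟩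
  rw [hU.eq_of_nhds]
  exact e2

lemma solvesAt_const {ξ : ℝ} : SolvesAt γ (fun _ => V) ξ :=
  ⟨differentiableAt_const _, differentiableAt_const _, 0, 0, 0, 0, 0, hasDerivAt_const _ _,
    hasDerivAt_const _ _, hasDerivAt_const _ _, hasDerivAt_const _ _, hasDerivAt_const _ _,
    by simp, by simp, by simp⟩

/-- Admissible jumps, where at speed zero the width must not decrease. -/
def FanJump (γ σ : ℝ) (V W : State) : Prop :=
  (σ ≠ 0 ∧ (V = W ∨ LaxShock γ σ V W ∨ Contact σ V W)) ∨
  (σ = 0 ∧ Relation.ReflTransGen (fun X Y => ZeroSpeedWave γ X Y ∧ X.a ≤ Y.a) V W)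

lemma FanJump.refl (σ : ℝ) (V : State) : FanJump γ σ V V := by
  by_cases h : σ = 0
  · exact Or.inr ⟨h, .refl⟩
  · exact Or.inl ⟨h, Or.inl rfl⟩

lemma FanJump.admissible {σ : ℝ} (h : FanJump γ σ V W) : AdmissibleJump γ σ V W := by
  rcases h with ⟨-, h | h | h⟩ | ⟨h0, h⟩
  · exact Or.inl h
  · exact Or.inr (Or.inl h)
  · exact Or.inr (Or.inr (Or.inl h))
  · exact Or.inr (Or.inr (Or.inr ⟨h0, Or.inl h⟩))

/-- The fan `F` starting at `V` describes a solution whose waves have speed at least `s`. -/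
structure FanSol (γ : ℝ) (Ur V : State) (F : List Wave) (s : ℝ) : Prop where
  fan : IsFan γ Ur V F
  head : ∀ w ∈ F.head?, s ≤ w.lo γ
  left : ∀ ξ < s, profile γ V F ξ = V
  nonneg : ∀ ξ, 0 ≤ (profile γ V F ξ).u ∧ 0 ≤ (profile γ V F ξ).ρ ∧ 0 < (profile γ V F ξ).a
  top : TendsToState (profile γ V F) atTop Ur
  jumps : ∃ D : Finset ℝ, (∀ ξ ∈ D, s < ξ) ∧
    (∀ ξ, ξ ≠ s → ξ ∉ D → SolvesAt γ (profile γ V F) ξ) ∧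
    (∃ Y, TendsToState (profile γ V F) (𝓝[>] s) Y ∧ FanJump γ s V Y) ∧
    ∀ ξ ∈ D, ∃ X Y, TendsToState (profile γ V F) (𝓝[<] ξ) X ∧
      TendsToState (profile γ V F) (𝓝[>] ξ) Y ∧ FanJump γ ξ X Y

variable {Ur : State} {F : List Wave} {s : ℝ}

lemma FanSol.tendsto_left (h : FanSol γ Ur V F s) {ξ : ℝ} (hξ : ξ ≤ s) :
    TendsToState (profile γ V F) (𝓝[<] ξ) V :=
  tendsToState_const.congr' <| by
    filter_upwards [self_mem_nhdsWithin] with x hx using h.left x (lt_of_lt_of_le hx hξ)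

lemma FanSol.state_nonneg (h : FanSol γ Ur V F s) : 0 ≤ V.u ∧ 0 ≤ V.ρ ∧ 0 < V.a := by
  have := h.nonneg (s - 1)
  rwa [h.left _ (by linarith)] at this

lemma FanSol.solvedBy (h : FanSol γ Ur V F s) : SolvedBy γ V Ur F := by
  obtain ⟨D, hD, hsol, ⟨Y, hY, hj⟩, hjump⟩ := h.jumps
  refine ⟨h.fan, h.nonneg, ⟨insert s D, ?_, ?_⟩, ?_, h.top⟩
  · intro ξ hξ
    rw [Finset.mem_insert, not_or] at hξ
    exact hsol ξ hξ.1 hξ.2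
  · intro ξ hξ
    rcases Finset.mem_insert.1 hξ with rfl | hξ
    · exact ⟨V, Y, h.tendsto_left le_rfl, hY, hj.admissible⟩
    · obtain ⟨X, Y, hX, hY, hj⟩ := hjump ξ hξ
      exact ⟨X, Y, hX, hY, hj.admissible⟩
  · refine tendsToState_const.congr' ?_
    filter_upwards [eventually_lt_atBot s] with x hx using h.left x hx

/-- A smaller bound leaves the profile unchanged: s turns into an ordinary exceptional point, and
the jump recorded at s' is trivial. Slower waves can then be prefixed. -/
lemma FanSol.mono (h : FanSol γ Ur V F s) {s' : ℝ} (hs : s' ≤ s) : FanSol γ Ur V F s' := by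
  rcases hs.eq_or_lt with rfl | hs
  · exact h
  obtain ⟨D, hD, hsol, ⟨Y, hY, hj⟩, hjump⟩ := h.jumps
  refine ⟨h.fan, fun w hw => hs.le.trans (h.head w hw), fun ξ hξ => h.left ξ (hξ.trans hs),
    h.nonneg, h.top, insert s D, ?_, ?_, ⟨V, ?_, .refl _ _⟩, ?_⟩
  · intro ξ hξ
    rcases Finset.mem_insert.1 hξ with rfl | hξ
    · exact hs
    · exact hs.trans (hD ξ hξ)
  · intro ξ _ hξ
    rw [Finset.mem_insert, not_or] at hξ
    exact hsol ξ hξ.1 hξ.2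
  · refine tendsToState_const.congr' ?_
    filter_upwards [mem_nhdsWithin_of_mem_nhds (Iio_mem_nhds hs)] with x hx using h.left x hx
  · intro ξ hξ
    rcases Finset.mem_insert.1 hξ with rfl | hξ
    · exact ⟨V, Y, h.tendsto_left le_rfl, hY, hj⟩
    · exact hjump ξ hξ

lemma fanSol_nil (hu : 0 ≤ Ur.u) (hρ : 0 ≤ Ur.ρ) (ha : 0 < Ur.a) (s : ℝ) :
    FanSol γ Ur Ur [] s :=
  ⟨rfl, by simp, fun _ _ => rfl, fun _ => ⟨hu, hρ, ha⟩, tendsToState_const, ∅, by simp,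
    fun _ _ _ => solvesAt_const, ⟨Ur, tendsToState_const, .refl _ _⟩, by simp⟩

/-- Prefixing a discontinuity: the common part of the two cases below. -/
lemma FanSol.cons_discontinuity {w : Wave} {Y : State} {D : Finset ℝ} (h : FanSol γ Ur V F s)
    (hw : w.Admissible γ) (hV : w.right = V) (hlo : w.lo γ = s) (hhi : w.hi γ = s)
    (hn : 0 ≤ w.left.u ∧ 0 ≤ w.left.ρ ∧ 0 < w.left.a)
    (hD : ∀ ξ ∈ D, s < ξ) (hsol : ∀ ξ, ξ ≠ s → ξ ∉ D → SolvesAt γ (profile γ V F) ξ)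
    (hjump : ∀ ξ ∈ D, ∃ X Y, TendsToState (profile γ V F) (𝓝[<] ξ) X ∧
      TendsToState (profile γ V F) (𝓝[>] ξ) Y ∧ FanJump γ ξ X Y)
    (hY : TendsToState (profile γ V F) (𝓝[>] s) Y) (hj : FanJump γ s w.left Y) :
    FanSol γ Ur w.left (w :: F) s := by
  subst hV
  have hlt : ∀ ξ < s, profile γ w.left (w :: F) ξ = w.left := fun ξ hξ => by
    rw [profile, hlo, if_pos hξ]
  have hge : ∀ ξ, s ≤ ξ → profile γ w.left (w :: F) ξ = profile γ w.right F ξ := fun ξ hξ => by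
    rw [profile, hlo, hhi, if_neg hξ.not_gt, if_neg hξ.not_gt]
  have hnear : ∀ ξ, s < ξ → profile γ w.left (w :: F) =ᶠ[𝓝 ξ] profile γ w.right F := fun ξ hξ => by
    filter_upwards [Ioi_mem_nhds hξ] with x hx using hge x (le_of_lt hx)
  refine ⟨⟨rfl, hw, fun w' hw' => hhi.trans_le (h.head w' hw'), h.fan⟩, ?_, hlt, ?_, ?_, D, hD, ?_,
    ⟨Y, ?_, hj⟩, ?_⟩
  · rintro w' hw'
    simp only [List.head?_cons, Option.mem_def, Option.some.injEq] at hw'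
    rw [← hw', hlo]
  · intro ξ
    rcases lt_or_ge ξ s with hξ | hξ
    · rw [hlt ξ hξ]; exact hn
    · rw [hge ξ hξ]; exact h.nonneg ξ
  · refine h.top.congr' ?_
    filter_upwards [eventually_ge_atTop s] with x hx using hge x hx
  · intro ξ hξ hξD
    rcases hξ.lt_or_gt with hξ' | hξ'
    · refine (solvesAt_const (V := w.left)).congr ?_
      filter_upwards [Iio_mem_nhds hξ'] with x hx using hlt x hx
    · exact (hsol ξ hξ hξD).congr (hnear ξ hξ')
  · refine hY.congr' ?_
    filter_upwards [self_mem_nhdsWithin] with x hx using hge x (le_of_lt hx)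
  · intro ξ hξ
    obtain ⟨X, Y, hX, hY, hj⟩ := hjump ξ hξ
    have := hnear ξ (hD ξ hξ)
    exact ⟨X, Y, hX.congr' (this.filter_mono nhdsWithin_le_nhds),
      hY.congr' (this.filter_mono nhdsWithin_le_nhds), hj⟩

/-- As σ < s, the profile is constantly V just to the right of σ, so the new jump stands alone. -/
lemma FanSol.cons_jump {w : Wave} {σ : ℝ} (h : FanSol γ Ur V F s)
    (hw : w.Admissible γ) (hV : w.right = V) (hlo : w.lo γ = σ) (hhi : w.hi γ = σ)
    (hn : 0 ≤ w.left.u ∧ 0 ≤ w.left.ρ ∧ 0 < w.left.a) (hσ : σ < s) (hj : FanJump γ σ w.left V) :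
    FanSol γ Ur w.left (w :: F) σ := by
  have h' := h.mono hσ.le
  obtain ⟨D, hD, hsol, -, hjump⟩ := h'.jumps
  refine h'.cons_discontinuity hw hV hlo hhi hn hD hsol hjump ?_ hj
  refine tendsToState_const.congr' ?_
  filter_upwards [mem_nhdsWithin_of_mem_nhds (Iio_mem_nhds hσ)] with x hx using h.left x hx

/-- The tail may itself jump at ξ = 0. Its jump there is a chain of zero-speed waves with
nondecreasing width, and the new wave becomes the head of that chain. -/
lemma FanSol.cons_zero {w : Wave} (h : FanSol γ Ur V F 0)
    (hw : w.Admissible γ) (hV : w.right = V) (hlo : w.lo γ = 0) (hhi : w.hi γ = 0)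
    (hn : 0 ≤ w.left.u ∧ 0 ≤ w.left.ρ ∧ 0 < w.left.a) (hz : ZeroSpeedWave γ w.left V)
    (ha : w.left.a ≤ V.a) : FanSol γ Ur w.left (w :: F) 0 := by
  obtain ⟨D, hD, hsol, ⟨Y, hY, hj⟩, hjump⟩ := h.jumps
  refine h.cons_discontinuity hw hV hlo hhi hn hD hsol hjump hY (Or.inr ⟨rfl, ?_⟩)
  rcases hj with ⟨h0, -⟩ | ⟨-, hj⟩
  · exact absurd rfl h0
  · exact .head ⟨hz, ha⟩ hj

/-- Prefixing a wave of positive width in `ξ`. -/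
lemma FanSol.cons_spread {w : Wave} (h : FanSol γ Ur V F s)
    (hw : w.Admissible γ) (hV : w.right = V) (hhi : w.hi γ = s) (hlo : w.lo γ < s)
    (hn : 0 ≤ w.left.u ∧ 0 ≤ w.left.ρ ∧ 0 < w.left.a)
    (hin : ∀ ξ ∈ Ico (w.lo γ) s,
      0 ≤ (w.inside γ ξ).u ∧ 0 ≤ (w.inside γ ξ).ρ ∧ 0 < (w.inside γ ξ).a)
    (hsol' : ∀ ξ ∈ Ioo (w.lo γ) s, SolvesAt γ (w.inside γ) ξ)
    (hl : TendsToState (w.inside γ) (𝓝[>] (w.lo γ)) w.left)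
    (hr : TendsToState (w.inside γ) (𝓝[<] s) V) :
    FanSol γ Ur w.left (w :: F) (w.lo γ) := by
  obtain ⟨D, hD, hsol, ⟨Y, hY, hj⟩, hjump⟩ := h.jumps
  subst hV
  have hlt : ∀ ξ < w.lo γ, profile γ w.left (w :: F) ξ = w.left := fun ξ hξ => by
    rw [profile, if_pos hξ]
  have hmid : ∀ ξ, w.lo γ ≤ ξ → ξ < s → profile γ w.left (w :: F) ξ = w.inside γ ξ :=
    fun ξ h1 h2 => by rw [profile, if_neg h1.not_gt, hhi, if_pos h2]
  have hge : ∀ ξ, s ≤ ξ → profile γ w.left (w :: F) ξ = profile γ w.right F ξ := fun ξ hξ => by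
    rw [profile, hhi, if_neg (hlo.le.trans hξ).not_gt, if_neg hξ.not_gt]
  have hnear : ∀ ξ, s < ξ → profile γ w.left (w :: F) =ᶠ[𝓝 ξ] profile γ w.right F := fun ξ hξ => by
    filter_upwards [Ioi_mem_nhds hξ] with x hx using hge x (le_of_lt hx)
  refine ⟨⟨rfl, hw, fun w' hw' => hhi.trans_le (h.head w' hw'), h.fan⟩, ?_, hlt, ?_, ?_,
    insert s D, ?_, ?_, ⟨w.left, ?_, .refl _ _⟩, ?_⟩
  · rintro w' hw'
    simp only [List.head?_cons, Option.mem_def, Option.some.injEq] at hw'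
    rw [← hw']
  · intro ξ
    rcases lt_or_ge ξ (w.lo γ) with hξ | hξ
    · rw [hlt ξ hξ]; exact hn
    rcases lt_or_ge ξ s with hξ' | hξ'
    · rw [hmid ξ hξ hξ']; exact hin ξ ⟨hξ, hξ'⟩
    · rw [hge ξ hξ']; exact h.nonneg ξ
  · refine h.top.congr' ?_
    filter_upwards [eventually_ge_atTop s] with x hx using hge x hx
  · intro ξ hξ
    rcases Finset.mem_insert.1 hξ with rfl | hξ
    · exact hlo
    · exact hlo.trans (hD ξ hξ)
  · intro ξ hξ hξD
    rw [Finset.mem_insert, not_or] at hξD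
    rcases hξ.lt_or_gt with h1 | h1
    · refine (solvesAt_const (V := w.left)).congr ?_
      filter_upwards [Iio_mem_nhds h1] with x hx using hlt x hx
    rcases Ne.lt_or_gt hξD.1 with h2 | h2
    · refine (hsol' ξ ⟨h1, h2⟩).congr ?_
      filter_upwards [Ioo_mem_nhds h1 h2] with x hx using hmid x hx.1.le hx.2
    · exact (hsol ξ hξD.1 hξD.2).congr (hnear ξ h2)
  · refine hl.congr' ?_
    filter_upwards [Ioo_mem_nhdsGT hlo] with x hx using hmid x hx.1.le hx.2
  · intro ξ hξ
    rcases Finset.mem_insert.1 hξ with rfl | hξ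
    · refine ⟨w.right, Y, hr.congr' ?_, hY.congr' ?_, hj⟩
      · filter_upwards [Ioo_mem_nhdsLT hlo] with x hx using hmid x hx.1.le hx.2
      · filter_upwards [self_mem_nhdsWithin] with x hx using hge x (le_of_lt hx)
    · obtain ⟨X, Y, hX, hY, hj⟩ := hjump ξ hξ
      have := hnear ξ (hD ξ hξ)
      exact ⟨X, Y, hX.congr' (this.filter_mono nhdsWithin_le_nhds),
        hY.congr' (this.filter_mono nhdsWithin_le_nhds), hj⟩

/-- A self-similar function with `u + ρ ^ γ` and `a` locally constant solves the system as soon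
as it conserves mass. -/
lemma solvesAt_of_mass {U : ℝ → State} {ξ w a u' ρ' : ℝ}
    (hu : HasDerivAt (fun x => (U x).u) u' ξ) (hρ : HasDerivAt (fun x => (U x).ρ) ρ' ξ)
    (ha : ∀ x, (U x).a = a) (hw : ∀ᶠ x in 𝓝 ξ, (U x).u + (U x).ρ ^ γ = w)
    (hm : -ξ * ρ' + (ρ' * (U ξ).u + (U ξ).ρ * u') = 0) : SolvesAt γ U ξ := by
  have da : HasDerivAt (fun x => (U x).a) 0 ξ := by
    simp only [ha]; exact hasDerivAt_const _ _
  have dw : HasDerivAt (fun x => (U x).u + (U x).ρ ^ γ) 0 ξ :=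
    (hasDerivAt_const ξ w).congr_of_eventuallyEq hw
  have d1 := da.mul hρ
  have d2 := d1.mul hu
  refine ⟨hu.differentiableAt, hρ.differentiableAt, _, _, _, _, _, d1, d2, d1.mul dw, d2.mul dw,
    da, ?_, ?_, by simp⟩
  · simp only [Pi.mul_apply]
    linear_combination (U ξ).a * hm
  · simp only [Pi.mul_apply]
    linear_combination (U ξ).a * ((U ξ).u + (U ξ).ρ ^ γ) * hm

/-! ### Prefixing each kind of wave. -/

lemma FanSol.cons_rarefaction {V₀ : State} (hγ : 0 < γ) (h : FanSol γ Ur V F (lam γ V))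
    (hw : Rarefaction γ V₀ V) (hu : 0 ≤ V₀.u) :
    FanSol γ Ur V₀ (.rarefaction V₀ V :: F) (lam γ V₀) := by
  have hw' := hw
  obtain ⟨ha, hW, hρ, hρ0, huV⟩ := hw'
  have hρ₀ : 0 < V₀.ρ := hρ.trans_lt hρ0
  set c := V₀.u + V₀.ρ ^ γ with hc
  have hcV : V.u + V.ρ ^ γ = c := by rw [hc]; linarith
  have hγ1 : 0 < 1 + γ := by linarith
  have hq : V.ρ ^ γ < V₀.ρ ^ γ := Real.rpow_lt_rpow hρ hρ0 hγ
  have hlo : lam γ V₀ = c - (1 + γ) * V₀.ρ ^ γ := by rw [lam, hc]; ring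
  have hhi : lam γ V = c - (1 + γ) * V.ρ ^ γ := by rw [lam, ← hcV]; ring
  have hqV : 0 ≤ V.ρ ^ γ := Real.rpow_nonneg hρ γ
  have ha0 : 0 < V₀.a := ha ▸ h.state_nonneg.2.2
  -- The explicit formula is continuous and gives X at ξ = λ₁(X), which serves both edges. The
  -- exponent 1/γ is positive, so the vacuum edge is covered.
  have hcont : ∀ ξ₀ : ℝ, ∀ X : State, 0 ≤ X.ρ → X.a = V₀.a → X.u + X.ρ ^ γ = c → lam γ X = ξ₀ →
      ∀ l ≤ 𝓝 ξ₀, TendsToState ((Wave.rarefaction V₀ V).inside γ) l X := by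
    intro ξ₀ X hX hXa hXc hXl l hl
    have hξ₀ : ξ₀ = c - (1 + γ) * X.ρ ^ γ := by rw [← hXl, lam, ← hXc]; ring
    have h1 : X.u = (γ * c + ξ₀) / (1 + γ) := by
      rw [hξ₀, eq_div_iff hγ1.ne']; linear_combination (1 + γ) * hXc
    have h2 : X.ρ = ((c - ξ₀) / (1 + γ)) ^ (1 / γ) := by
      rw [hξ₀, sub_sub_cancel, mul_div_cancel_left₀ _ hγ1.ne', one_div,
        Real.rpow_rpow_inv hX hγ.ne']
    refine ⟨?_, ?_, ?_⟩
    · rw [h1]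
      have : Continuous fun ξ : ℝ => (γ * c + ξ) / (1 + γ) := by fun_prop
      exact (this.tendsto ξ₀).mono_left hl
    · rw [h2]
      have : Continuous fun ξ : ℝ => ((c - ξ) / (1 + γ)) ^ (1 / γ) :=
        (Real.continuous_rpow_const (by positivity)).comp (by fun_prop)
      exact (this.tendsto ξ₀).mono_left hl
    · rw [hXa]; exact tendsto_const_nhds
  refine FanSol.cons_spread (w := .rarefaction V₀ V) h hw rfl rfl ?_ ⟨hu, hρ₀.le, ha0⟩ ?_ ?_ ?_ ?_
  · change lam γ V₀ < lam γ V
    rw [hlo, hhi]; gcongr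
  · rintro ξ ⟨h1, h2⟩
    have h1 : lam γ V₀ ≤ ξ := h1
    refine ⟨?_, ?_, ha0⟩
    · change 0 ≤ (γ * c + ξ) / (1 + γ)
      refine div_nonneg ?_ hγ1.le
      rw [lam] at h1
      nlinarith
    · change 0 ≤ ((c - ξ) / (1 + γ)) ^ (1 / γ)
      refine Real.rpow_nonneg (div_nonneg ?_ hγ1.le) _
      rw [hhi] at h2
      nlinarith
  · rintro ξ ⟨-, h2⟩
    have hpos : 0 < (c - ξ) / (1 + γ) := by
      rw [hhi] at h2
      refine div_pos ?_ hγ1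
      nlinarith
    have du : HasDerivAt (fun ξ : ℝ => (γ * c + ξ) / (1 + γ)) (1 / (1 + γ)) ξ :=
      ((hasDerivAt_id ξ).const_add (γ * c)).div_const (1 + γ)
    have dq : HasDerivAt (fun ξ : ℝ => (c - ξ) / (1 + γ)) (-1 / (1 + γ)) ξ :=
      ((hasDerivAt_id ξ).const_sub c).div_const (1 + γ)
    refine solvesAt_of_mass (w := c) (a := V₀.a) du (dq.rpow_const (p := 1 / γ) (Or.inl hpos.ne'))
      (fun _ => rfl) ?_ ?_
    · have : ∀ᶠ x in 𝓝 ξ, 0 < (c - x) / (1 + γ) := dq.continuousAt.eventually_const_lt hpos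
      filter_upwards [this] with x hx
      change (γ * c + x) / (1 + γ) + (((c - x) / (1 + γ)) ^ (1 / γ)) ^ γ = c
      rw [one_div, Real.rpow_inv_rpow hx.le hγ.ne', ← add_div, div_eq_iff hγ1.ne']
      ring
    · change -ξ * (-1 / (1 + γ) * (1 / γ) * ((c - ξ) / (1 + γ)) ^ (1 / γ - 1))
        + (-1 / (1 + γ) * (1 / γ) * ((c - ξ) / (1 + γ)) ^ (1 / γ - 1) * ((γ * c + ξ) / (1 + γ))
        + ((c - ξ) / (1 + γ)) ^ (1 / γ) * (1 / (1 + γ))) = 0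
      -- With the power 1/γ - 1 factored out, conservation of mass is an identity linear in that
      -- power.
      have hsplit : ((c - ξ) / (1 + γ)) ^ (1 / γ)
          = ((c - ξ) / (1 + γ)) ^ (1 / γ - 1) * ((c - ξ) / (1 + γ)) := by
        rw [← Real.rpow_add_one hpos.ne', sub_add_cancel]
      rw [hsplit]
      generalize ((c - ξ) / (1 + γ)) ^ (1 / γ - 1) = z
      field_simp
      ring
  · exact hcont _ V₀ hρ₀.le rfl rfl rfl _ nhdsWithin_le_nhds
  · exact hcont _ V hρ ha hcV rfl _ nhdsWithin_le_nhds

lemma FanSol.cons_vacuum {V₀ : State} (h : FanSol γ Ur V F V.u)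
    (h₀ : V₀.ρ = 0) (h₁ : V.ρ = 0) (ha : V.a = V₀.a) (hu : 0 ≤ V₀.u) (huV : V₀.u < V.u) :
    FanSol γ Ur V₀ (.vacuum V₀ V :: F) V₀.u := by
  have ha0 : 0 < V₀.a := ha ▸ h.state_nonneg.2.2
  refine FanSol.cons_spread (w := .vacuum V₀ V) h ⟨h₀, h₁, ha, huV⟩ rfl rfl huV
    ⟨hu, h₀.ge, ha0⟩ ?_ ?_ ?_ ?_
  · rintro ξ ⟨h1, -⟩
    exact ⟨hu.trans h1, le_rfl, ha0⟩
  · rintro ξ -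
    refine ⟨differentiableAt_id, differentiableAt_const _, 0, 0, 0, 0, 0, ?_⟩
    have hz : ∀ f : ℝ → ℝ, (∀ x, f x = 0) → HasDerivAt f 0 ξ := fun f hf => by
      rw [show f = fun _ => 0 from funext hf]; exact hasDerivAt_const _ _
    refine ⟨hz _ fun x => ?_, hz _ fun x => ?_, hz _ fun x => ?_, hz _ fun x => ?_,
      hasDerivAt_const _ _, by simp, by simp, by simp⟩ <;> simp [Wave.inside]
  · refine ⟨tendsto_nhdsWithin_of_tendsto_nhds tendsto_id, ?_, tendsto_const_nhds⟩
    change Tendsto (fun _ => (0 : ℝ)) _ (𝓝 V₀.ρ)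
    rw [h₀]; exact tendsto_const_nhds
  · refine ⟨tendsto_nhdsWithin_of_tendsto_nhds tendsto_id, ?_, ?_⟩
    · change Tendsto (fun _ => (0 : ℝ)) _ (𝓝 V.ρ)
      rw [h₁]; exact tendsto_const_nhds
    · change Tendsto (fun _ => V₀.a) _ (𝓝 V.a)
      rw [ha]; exact tendsto_const_nhds

lemma fanSol_contact (hu : V.u = Ur.u) (ha : V.a = Ur.a) (hρ : 0 ≤ V.ρ) (hr : Ur.Positive)
    (hne : V.ρ ≠ Ur.ρ) : FanSol γ Ur V [.contact V Ur] Ur.u := by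
  have hj : Contact Ur.u V Ur := ⟨ha.symm, hu, rfl, hne⟩
  -- The empty fan admits every bound; any number above the contact speed will do.
  refine FanSol.cons_jump (w := .contact V Ur) (fanSol_nil hr.u.le hr.ρ.le hr.a (Ur.u + 1))
    ?_ rfl hu rfl ⟨hu ▸ hr.u.le, hρ, ha ▸ hr.a⟩ (by linarith)
    (Or.inl ⟨hr.u.ne', Or.inr (Or.inr hj)⟩)
  change Contact V.u V Ur
  rwa [hu]

lemma fanSol_contactTail (hu : V.u = Ur.u) (ha : V.a = Ur.a) (hρ : 0 ≤ V.ρ) (hr : Ur.Positive) :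
    FanSol γ Ur V (contactTail V Ur) Ur.u := by
  unfold contactTail
  split_ifs with h
  · rw [h]; exact fanSol_nil hr.u.le hr.ρ.le hr.a _
  · refine fanSol_contact hu ha hρ hr fun hne => h (State.ext hu hne ha)

lemma FanSol.cons_stationary {V₀ : State} (h : FanSol γ Ur V F 0)
    (hw : StationaryWave γ V₀ V) (ha : V₀.a ≤ V.a) :
    FanSol γ Ur V₀ (.stationary V₀ V :: F) 0 :=
  have hp := hw.2.1.positive.1
  FanSol.cons_zero (w := .stationary V₀ V) h hw rfl rfl rfl ⟨hp.u.le, hp.ρ.le, hp.a⟩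
    (Or.inl hw) ha

lemma FanSol.cons_zeroShock {V₀ : State} (hγ : 0 < γ) (h : FanSol γ Ur V F 0)
    (hw : LaxShock γ 0 V₀ V) (hu : 0 ≤ V₀.u) :
    FanSol γ Ur V₀ (.shock V₀ V :: F) 0 := by
  obtain ⟨ha, -, -, hσ⟩ := hw.curve hγ
  exact FanSol.cons_zero (w := .shock V₀ V) h (hw.congr_speed hγ) rfl hσ.symm hσ.symm
    ⟨hu, hw.1.le, ha ▸ h.state_nonneg.2.2⟩ (Or.inr hw) ha.ge

lemma FanSol.cons_shock {V₀ : State} (h : FanSol γ Ur V F s)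
    (hw : LaxShock γ (shockSpeed V₀ V) V₀ V) (hσ : shockSpeed V₀ V < s)
    (hσ0 : shockSpeed V₀ V ≠ 0) (hu : 0 ≤ V₀.u) :
    FanSol γ Ur V₀ (.shock V₀ V :: F) (shockSpeed V₀ V) :=
  FanSol.cons_jump (w := .shock V₀ V) h hw rfl rfl rfl
    ⟨hu, hw.1.le, hw.2.2.1.1 ▸ h.state_nonneg.2.2⟩ hσ (Or.inl ⟨hσ0, Or.inr (Or.inl hw)⟩)

/-! ### States on a curve `u + ρ ^ γ = const` -/

lemma State.Positive.mem_D₁_iff (hV : V.Positive) : V ∈ D₁ γ ↔ 1 < γ * ratio γ V := by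
  have h : 1 < γ * ratio γ V ↔ V.u < γ * V.ρ ^ γ := by
    rw [ratio, ← mul_div_assoc, one_lt_div hV.u]
  rw [h]
  exact ⟨fun h => h.2.2, fun h => ⟨hV.ρ, hV.u, h⟩⟩

lemma State.Positive.mem_D₂_iff (hV : V.Positive) : V ∈ D₂ γ ↔ γ * ratio γ V < 1 := by
  have h : γ * ratio γ V < 1 ↔ γ * V.ρ ^ γ < V.u := by
    rw [ratio, ← mul_div_assoc, div_lt_one hV.u]
  rw [h]
  exact ⟨fun h => h.2.2, fun h => ⟨hV.ρ, hV.u, h⟩⟩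

lemma State.Positive.mem_GammaPlus_iff (hV : V.Positive) :
    V ∈ GammaPlus γ ↔ γ * ratio γ V = 1 := by
  have h : γ * ratio γ V = 1 ↔ V.u = γ * V.ρ ^ γ := by
    rw [ratio, ← mul_div_assoc, div_eq_one_iff_eq hV.u.ne', eq_comm]
  rw [h]
  exact ⟨fun h => h.2, fun h => ⟨hV.ρ, h⟩⟩

lemma State.Positive.lam_eq (hV : V.Positive) : lam γ V = V.u * (1 - γ * ratio γ V) := by
  rw [lam, ← hV.ratio_mul]; ring

lemma State.Positive.sum_eq (hV : V.Positive) : V.u + V.ρ ^ γ = V.u * (1 + ratio γ V) := by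
  rw [← hV.ratio_mul]; ring

lemma density_lt_iff (hγ : 0 < γ) (hV : 0 ≤ V.ρ) (hW : 0 ≤ W.ρ)
    (hw : W.u + W.ρ ^ γ = V.u + V.ρ ^ γ) : V.ρ < W.ρ ↔ W.u < V.u := by
  rw [← Real.rpow_lt_rpow_iff hV hW hγ]
  constructor <;> intro h <;> linarith

lemma ratio_lt_iff (hV : V.Positive) (hW : W.Positive)
    (hw : W.u + W.ρ ^ γ = V.u + V.ρ ^ γ) : ratio γ V < ratio γ W ↔ W.u < V.u := by
  have hs := hV.ratio_pos (γ := γ)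
  have ht := hW.ratio_pos (γ := γ)
  have hu := hV.u
  have hu' := hW.u
  rw [hV.sum_eq, hW.sum_eq] at hw
  constructor
  · intro h
    by_contra! hle
    nlinarith
  · intro h
    by_contra! hle
    nlinarith

lemma ratio_lt_iff_density_lt (hγ : 0 < γ) (hV : V.Positive) (hW : W.Positive)
    (hw : W.u + W.ρ ^ γ = V.u + V.ρ ^ γ) : ratio γ V < ratio γ W ↔ V.ρ < W.ρ := by
  rw [ratio_lt_iff hV hW hw, density_lt_iff hγ hV.ρ.le hW.ρ.le hw]

/-- The state of given ratio on the curve `u + ρ ^ γ = c`. -/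
lemma exists_state_of_ratio (hγ : 0 < γ) {c s a : ℝ} (hc : 0 < c) (hs : 0 < s) (ha : 0 < a) :
    ∃ X : State, X.Positive ∧ X.a = a ∧ ratio γ X = s ∧ X.u + X.ρ ^ γ = c := by
  have hp : (ofRatio γ (Real.log c - Real.log (1 + s)) s a).Positive := ofRatio_positive ha
  refine ⟨_, hp, rfl, ratio_ofRatio hγ hs, ?_⟩
  have h1 : 0 < 1 + s := by positivity
  rw [hp.sum_eq, ratio_ofRatio hγ hs]
  simp only [ofRatio]
  rw [Real.exp_sub, Real.exp_log hc, Real.exp_log h1, div_mul_cancel₀ _ h1.ne']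

/-- The state of given velocity on the curve `u + ρ ^ γ = c`. -/
lemma exists_state_of_velocity (hγ : 0 < γ) {c u a : ℝ} (hu : 0 < u) (hc : u < c) (ha : 0 < a) :
    ∃ X : State, X.Positive ∧ X.a = a ∧ X.u = u ∧ X.u + X.ρ ^ γ = c := by
  have h : 0 < c - u := by linarith
  refine ⟨⟨u, (c - u) ^ γ⁻¹, a⟩, ⟨hu, Real.rpow_pos_of_pos h _, ha⟩, rfl, rfl, ?_⟩
  dsimp only
  rw [Real.rpow_inv_rpow h.le hγ.ne']
  ring

lemma eq_of_curve (hγ : 0 < γ) (hV : 0 ≤ V.ρ) (hW : 0 ≤ W.ρ)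
    (hw : W.u + W.ρ ^ γ = V.u + V.ρ ^ γ) (hu : W.u = V.u) (ha : W.a = V.a) : W = V := by
  refine State.ext hu ((Real.rpow_left_inj hW hV hγ.ne').1 ?_) ha
  linarith

lemma eq_of_curve_ratio (hγ : 0 < γ) (hV : V.Positive) (hW : W.Positive)
    (hw : W.u + W.ρ ^ γ = V.u + V.ρ ^ γ) (hs : ratio γ W = ratio γ V) (ha : W.a = V.a) :
    W = V := by
  refine hW.eq_of_ratio hγ hV ?_ ha hs
  rcases lt_trichotomy W.u V.u with h | h | h
  · exact absurd hs ((ratio_lt_iff hV hW hw).2 h).ne'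
  · exact h
  · exact absurd hs ((ratio_lt_iff hW hV hw.symm).2 h).ne

/-- The common value of u + ρ^γ cancels, so `fluxFun` alone compares fluxes on one curve and decides
the sign of a shock speed. -/
lemma fluxFun_sub (hV : V.Positive) (hW : W.Positive)
    (hw : W.u + W.ρ ^ γ = V.u + V.ρ ^ γ) :
    fluxFun γ (ratio γ W) - fluxFun γ (ratio γ V)
      = γ * (Real.log (W.ρ * W.u) - Real.log (V.ρ * V.u)) := by
  rw [hV.fluxFun_ratio, hW.fluxFun_ratio, hw, fluxInv, fluxInv, Real.log_mul hV.ρ.ne' hV.u.ne',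
    Real.log_mul hW.ρ.ne' hW.u.ne']
  ring

lemma shockSpeed_pos (hγ : 0 < γ) (hV : V.Positive) (hW : W.Positive)
    (hw : W.u + W.ρ ^ γ = V.u + V.ρ ^ γ) (hρ : V.ρ < W.ρ)
    (hf : fluxFun γ (ratio γ V) < fluxFun γ (ratio γ W)) : 0 < shockSpeed V W := by
  have h := fluxFun_sub hV hW hw
  have h1 : 0 < Real.log (W.ρ * W.u) - Real.log (V.ρ * V.u) :=
    pos_of_mul_pos_right (by rw [← h]; linarith) hγ.le
  have h2 := (Real.log_lt_log_iff (mul_pos hV.ρ hV.u) (mul_pos hW.ρ hW.u)).1 (by linarith)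
  exact div_pos (by linarith) (by linarith)

lemma shockSpeed_neg (hγ : 0 < γ) (hV : V.Positive) (hW : W.Positive)
    (hw : W.u + W.ρ ^ γ = V.u + V.ρ ^ γ) (hρ : V.ρ < W.ρ)
    (hf : fluxFun γ (ratio γ W) < fluxFun γ (ratio γ V)) : shockSpeed V W < 0 := by
  have h := fluxFun_sub hV hW hw
  have h1 : 0 < -(Real.log (W.ρ * W.u) - Real.log (V.ρ * V.u)) :=
    pos_of_mul_pos_right (by rw [mul_neg, ← h]; linarith) hγ.le
  have h2 := (Real.log_lt_log_iff (mul_pos hW.ρ hW.u) (mul_pos hV.ρ hV.u)).1 (by linarith)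
  exact div_neg_of_neg_of_pos (by linarith) (by linarith)

/-! ### Conjugate states: equal flux and equal `u + ρ ^ γ` on the two sides of the sonic curve -/

/-- `W` is joined to `V` by a zero-speed shock, or both are the same sonic state. -/
structure Conjugate (γ : ℝ) (V W : State) : Prop where
  left : V.Positive
  right : W.Positive
  width : W.a = V.a
  sum : W.u + W.ρ ^ γ = V.u + V.ρ ^ γ
  flux : fluxFun γ (ratio γ W) = fluxFun γ (ratio γ V)
  left_le : γ * ratio γ V ≤ 1
  right_ge : 1 ≤ γ * ratio γ W

lemma exists_conjugate_state (hγ : 0 < γ) (hV : V.Positive) (h : γ * ratio γ V ≤ 1) :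
    ∃ W, Conjugate γ V W := by
  obtain ⟨t, ht, hflux⟩ := exists_conjugate hγ hV.ratio_pos h
  have ht0 : 0 < t := pos_of_mul_pos_right (by linarith) hγ.le
  have hc : 0 < V.u + V.ρ ^ γ := add_pos hV.u (Real.rpow_pos_of_pos hV.ρ γ)
  obtain ⟨W, hW, ha, hr, hs⟩ := exists_state_of_ratio hγ hc ht0 hV.a
  exact ⟨W, hV, hW, ha, hs, by rw [hr, hflux], h, by rwa [hr]⟩

lemma conjugate_self (hV : V.Positive) (h : γ * ratio γ V = 1) : Conjugate γ V V :=
  ⟨hV, hV, rfl, rfl, rfl, h.le, h.ge⟩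

lemma Conjugate.fluxInv_eq (h : Conjugate γ V W) : fluxInv γ W = fluxInv γ V := by
  have := h.flux
  rw [h.left.fluxFun_ratio, h.right.fluxFun_ratio, h.sum, h.width] at this
  linarith

/-- With equal flux and width the change of `statInv` is that of `widthFun`. Any multiple of
`fluxFun` can be added for free, in particular the one that yields `jumpFun`. -/
lemma Conjugate.statInv_sub (h : Conjugate γ V W) :
    statInv γ W - statInv γ V = jumpFun γ (ratio γ W) - jumpFun γ (ratio γ V) := by
  rw [jumpFun, jumpFun, h.flux, h.left.widthFun_ratio, h.right.widthFun_ratio, h.fluxInv_eq,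
    h.width]
  ring

lemma Conjugate.right_gt (hγ : 0 < γ) (h : Conjugate γ V W) (hV : γ * ratio γ V < 1) :
    1 < γ * ratio γ W := by
  refine h.right_ge.lt_of_ne fun h1 => ?_
  have h2 : ratio γ V < ratio γ W := lt_of_mul_lt_mul_left (by linarith) hγ.le
  exact (fluxFun_lt hγ h.left.ratio_pos h1.ge h2).ne' h.flux

lemma Conjugate.laxShock (hγ : 0 < γ) (h : Conjugate γ V W) (hV : γ * ratio γ V < 1) :
    LaxShock γ 0 V W := by
  have h1 := h.right_gt hγ hV
  have h2 : ratio γ V < ratio γ W := lt_of_mul_lt_mul_left (by linarith) hγ.le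
  have h3 := (ratio_lt_iff_density_lt hγ h.left h.right h.sum).1 h2
  have hl := laxShock_of_curve hγ h.left.ρ h.width h.sum h3
  have h4 := fluxFun_sub h.left h.right h.sum
  rw [h.flux, sub_self, eq_comm, mul_eq_zero, or_iff_right hγ.ne', sub_eq_zero] at h4
  have h5 := Real.log_injOn_pos (mul_pos h.right.ρ h.right.u) (mul_pos h.left.ρ h.left.u) h4
  have h6 : shockSpeed V W = 0 := by rw [shockSpeed, h5, sub_self, zero_div]
  rwa [h6] at hl

lemma Conjugate.eq_of_sonic (hγ : 0 < γ) (h : Conjugate γ V W) (hV : γ * ratio γ V = 1) :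
    W = V :=
  eq_of_curve_ratio hγ h.left h.right h.sum
    (fluxFun_inj_right hγ h.right_ge hV.ge h.flux) h.width

/-- At speed zero the Lax inequalities read λ₁(W) < 0 < λ₁(V). They put the states on opposite sides
of the sonic curve and also give V a positive velocity. -/
lemma LaxShock.conjugate (hγ : 0 < γ) (h : LaxShock γ 0 V W) (ha : 0 < V.a) :
    Conjugate γ V W ∧ γ * ratio γ V < 1 := by
  obtain ⟨hwa, hw, hρ, h0⟩ := h.curve hγ
  obtain ⟨hV, hW, ⟨-, hm, -⟩, h1, h2, h3⟩ := h
  have hVq := Real.rpow_pos_of_pos hV γ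
  have hVu : 0 < V.u := by rw [lam] at h2; nlinarith
  have pV : V.Positive := ⟨hVu, hV, ha⟩
  have pW : W.Positive := ⟨h3, hW, hwa ▸ ha⟩
  have hf : W.ρ * W.u = V.ρ * V.u := by linarith
  have h4 : γ * ratio γ V < 1 := by
    rw [pV.lam_eq] at h2
    have := pos_of_mul_pos_right h2 hVu.le
    linarith
  refine ⟨⟨pV, pW, hwa, hw, ?_, h4.le, ?_⟩, h4⟩
  · have := fluxFun_sub pV pW hw
    rw [hf, sub_self, mul_zero, sub_eq_zero] at this
    exact this
  · rw [pW.lam_eq] at h1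
    by_contra! hlt
    nlinarith [mul_pos h3 (sub_pos.2 hlt)]

lemma Conjugate.unique (hγ : 0 < γ) {X : State} (h : Conjugate γ V W) (h' : Conjugate γ V X) :
    X = W :=
  eq_of_curve_ratio hγ h.right h'.right (h'.sum.trans h.sum.symm)
    (fluxFun_inj_right hγ h'.right_ge h.right_ge (h'.flux.trans h.flux.symm))
    (h'.width.trans h.width.symm)

lemma Conjugate.uniquely (hγ : 0 < γ) (h : Conjugate γ V W) (hV : γ * ratio γ V < 1) :
    Uniquely (LaxShock γ 0 V) W :=
  ⟨h.laxShock hγ hV, fun _ hX => h.unique hγ (hX.conjugate hγ h.left.a).1⟩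

/-! ### Existence and uniqueness of stationary waves -/

/-- The velocity is solved from `statInv`; the hypothesis on `widthFun` then forces the flux to
agree. -/
lemma exists_stationary_state (hγ : 0 < γ) {a s : ℝ} (ha : 0 < a) (hs : 0 < s)
    (h : widthFun γ s = statInv γ V - fluxInv γ V + γ * Real.log a) :
    ∃ W : State, W.Positive ∧ W.a = a ∧ ratio γ W = s ∧ statInv γ V = statInv γ W ∧
      fluxInv γ V = fluxInv γ W := by
  let W := ofRatio γ ((statInv γ V - statLog γ s) / (γ + 1)) s a
  have hW : W.Positive := ofRatio_positive ha
  have hr : ratio γ W = s := ratio_ofRatio hγ hs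
  have hI : statInv γ V = statInv γ W := by
    rw [statInv.eq_def γ W, hr]
    simp only [W, ofRatio, Real.log_exp]
    field_simp
    ring
  refine ⟨W, hW, rfl, hr, hI, ?_⟩
  have h1 := hW.widthFun_ratio (γ := γ)
  rw [hr, h, ← hI] at h1
  have h2 : W.a = a := rfl
  rw [h2] at h1
  linarith

lemma widthFun_ratio_lt (hγ : 0 < γ) {a : ℝ} (hV : V.Positive) (ha : V.a < a) :
    widthFun γ (ratio γ V) < statInv γ V - fluxInv γ V + γ * Real.log a := by
  rw [hV.widthFun_ratio]
  have := Real.log_lt_log hV.a ha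
  have : γ * Real.log V.a < γ * Real.log a := by gcongr
  linarith

lemma exists_stationary_left (hγ : 0 < γ) {a : ℝ} (hV : V.Positive) (hside : γ * ratio γ V ≤ 1)
    (ha : V.a < a) : ∃ W, W.Positive ∧ W.a = a ∧ γ * ratio γ W < 1 ∧ ratio γ W < ratio γ V ∧
      StationaryWave γ V W := by
  have hlt := widthFun_ratio_lt hγ hV ha
  obtain ⟨t, ht0, htV, ht⟩ := exists_widthFun_left hγ hV.ratio_pos hlt.le
  have htV' : t < ratio γ V := htV.lt_of_ne fun h => by rw [← h, ht] at hlt; exact lt_irrefl _ hlt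
  have hside' : γ * t < 1 := lt_of_lt_of_le (by gcongr) hside
  obtain ⟨W, hW, hWa, hr, hI, hQ⟩ := exists_stationary_state hγ (hV.a.trans ha) ht0 ht
  refine ⟨W, hW, hWa, by rwa [hr], by rwa [hr], ?_⟩
  exact stationaryWave_of_invariants hγ hV hW (hWa ▸ ha.ne) hI hQ
    (Or.inl ⟨hside, by rw [hr]; exact hside'.le⟩)

lemma exists_stationary_right (hγ : 0 < γ) {a : ℝ} (hV : V.Positive) (hside : 1 ≤ γ * ratio γ V)
    (ha : V.a < a) : ∃ W, W.Positive ∧ W.a = a ∧ 1 < γ * ratio γ W ∧ StationaryWave γ V W := by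
  have hlt := widthFun_ratio_lt hγ hV ha
  obtain ⟨t, htV, ht⟩ := exists_widthFun_right hγ hV.ratio_pos hlt.le
  have htV' : ratio γ V < t := htV.lt_of_ne fun h => by rw [h, ht] at hlt; exact lt_irrefl _ hlt
  have hside' : 1 < γ * t := lt_of_le_of_lt hside (by gcongr)
  obtain ⟨W, hW, hWa, hr, hI, hQ⟩ :=
    exists_stationary_state hγ (hV.a.trans ha) (hV.ratio_pos.trans htV') ht
  refine ⟨W, hW, hWa, by rwa [hr], ?_⟩
  exact stationaryWave_of_invariants hγ hV hW (hWa ▸ ha.ne) hI hQ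
    (Or.inr ⟨hside, by rw [hr]; exact hside'.le⟩)

lemma StationaryWave.widthFun_eq (hγ : 0 < γ) (h : StationaryWave γ V W) :
    widthFun γ (ratio γ W) = widthFun γ (ratio γ V) + γ * (Real.log W.a - Real.log V.a) := by
  obtain ⟨hV, hW, -, hI, hQ, -⟩ := (stationaryWave_iff hγ).1 h
  rw [hV.widthFun_ratio, hW.widthFun_ratio, hI, hQ]
  ring

/-- The width fixes `widthFun` of the ratio, which is injective on each side. The side has to be
given because a sonic V reaches both. -/
lemma StationaryWave.unique (hγ : 0 < γ) {X : State} (h : StationaryWave γ V W)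
    (h' : StationaryWave γ V X) (ha : X.a = W.a)
    (hside : (γ * ratio γ W ≤ 1 ∧ γ * ratio γ X ≤ 1) ∨ (1 ≤ γ * ratio γ W ∧ 1 ≤ γ * ratio γ X)) :
    X = W := by
  have e1 := h.widthFun_eq hγ
  have e2 := h'.widthFun_eq hγ
  obtain ⟨hV, hW, -, hI, hQ, -⟩ := (stationaryWave_iff hγ).1 h
  obtain ⟨-, hX, -, hI', hQ', -⟩ := (stationaryWave_iff hγ).1 h'
  rw [ha, ← e1] at e2
  refine hX.eq_of_statInv hγ hW (hI'.symm.trans hI) ha ?_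
  rcases hside with ⟨h1, h2⟩ | ⟨h1, h2⟩
  · exact widthFun_inj_left hγ hX.ratio_pos hW.ratio_pos h2 h1 e2
  · exact widthFun_inj_right hγ h2 h1 e2

lemma StationaryWave.side_left (hγ : 0 < γ) (h : StationaryWave γ V W) (hV : γ * ratio γ V < 1) :
    γ * ratio γ W ≤ 1 := by
  rcases h.sameSide hγ with h1 | h1
  · exact h1.2
  · exact absurd h1.1 hV.not_ge

lemma StationaryWave.side_right (hγ : 0 < γ) (h : StationaryWave γ V W)
    (hV : 1 < γ * ratio γ V) : 1 ≤ γ * ratio γ W := by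
  rcases h.sameSide hγ with h1 | h1
  · exact absurd h1.1 hV.not_ge
  · exact h1.2

lemma StationaryWave.uniquely_left (hγ : 0 < γ) (h : StationaryWave γ V W)
    (hV : γ * ratio γ V < 1) {a : ℝ} (ha : W.a = a) :
    Uniquely (fun X => X.a = a ∧ StationaryWave γ V X) W :=
  ⟨⟨ha, h⟩, fun _ hX => h.unique hγ hX.2 (hX.1.trans ha.symm)
    (Or.inl ⟨h.side_left hγ hV, hX.2.side_left hγ hV⟩)⟩

lemma StationaryWave.uniquely_right (hγ : 0 < γ) (h : StationaryWave γ V W)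
    (hV : 1 < γ * ratio γ V) {a : ℝ} (ha : W.a = a) :
    Uniquely (fun X => X.a = a ∧ StationaryWave γ V X) W :=
  ⟨⟨ha, h⟩, fun _ hX => h.unique hγ hX.2 (hX.1.trans ha.symm)
    (Or.inr ⟨h.side_right hγ hV, hX.2.side_right hγ hV⟩)⟩

/-! ### Comparison of velocities -/

lemma log_ratio_add (hV : V.Positive) (hW : W.Positive) (ha : V.a = W.a)
    (hQ : fluxInv γ V = fluxInv γ W) :
    Real.log (ratio γ V) + (γ + 1) * Real.log V.u
      = Real.log (ratio γ W) + (γ + 1) * Real.log W.u := by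
  rw [fluxInv, fluxInv, ha] at hQ
  rw [hV.log_ratio, hW.log_ratio]
  linarith

/-- Along a curve of constant flux and width, the ratio decreases with the velocity. -/
lemma ratio_lt_of_velocity_lt (hγ : 0 < γ) (hV : V.Positive) (hW : W.Positive) (ha : V.a = W.a)
    (hQ : fluxInv γ V = fluxInv γ W) (hu : V.u < W.u) : ratio γ W < ratio γ V := by
  have h := log_ratio_add hV hW ha hQ
  have h1 := Real.log_lt_log hV.u hu
  have h2 : (γ + 1) * Real.log V.u < (γ + 1) * Real.log W.u := by gcongr
  exact (Real.log_lt_log_iff hW.ratio_pos hV.ratio_pos).1 (by linarith)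

/-- For fixed width and flux, `statInv` is `widthFun` of the ratio up to a constant. The ratio falls
as the velocity grows, and `widthFun` increases on the subsonic side. -/
lemma statInv_lt_iff (hγ : 0 < γ) (hV : V.Positive) (hW : W.Positive) (ha : V.a = W.a)
    (hQ : fluxInv γ V = fluxInv γ W) (hsV : 1 ≤ γ * ratio γ V) (hsW : 1 ≤ γ * ratio γ W) :
    statInv γ W < statInv γ V ↔ V.u < W.u := by
  have key : ∀ X Y : State, X.Positive → Y.Positive → X.a = Y.a → fluxInv γ X = fluxInv γ Y →
      1 ≤ γ * ratio γ Y → X.u < Y.u → statInv γ Y < statInv γ X := by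
    intro X Y hX hY ha hQ hs hu
    have h := widthFun_lt hγ hs (ratio_lt_of_velocity_lt hγ hX hY ha hQ hu)
    rw [hX.widthFun_ratio, hY.widthFun_ratio, ha, hQ] at h
    linarith
  refine ⟨fun h => ?_, key V W hV hW ha hQ hsW⟩
  by_contra! hle
  rcases hle.eq_or_lt with he | hlt
  · have h1 := log_ratio_add hV hW ha hQ
    rw [he, add_left_inj] at h1
    have h2 := Real.log_injOn_pos hV.ratio_pos hW.ratio_pos h1
    rw [statInv, statInv, he, h2] at h
    exact lt_irrefl _ h
  · exact absurd (key W V hW hV ha.symm hQ.symm hsV hlt) h.not_gt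

/-- Widening first and then jumping to the subsonic side gives a larger velocity than jumping
first. -/
lemma velocity_lt_of_conjugate (hγ : 0 < γ) {B Bt Bs Bst Bts : State} (h₀ : Conjugate γ B Bt)
    (hs : StationaryWave γ B Bs) (h₁ : Conjugate γ Bs Bst) (hlt : ratio γ Bs < ratio γ B)
    (hts : StationaryWave γ Bt Bts) (hside : 1 ≤ γ * ratio γ Bts) (ha : Bts.a = Bs.a) :
    Bts.u < Bst.u := by
  obtain ⟨-, -, -, hI, hQ, -⟩ := (stationaryWave_iff hγ).1 hs
  obtain ⟨-, hp, -, hI', hQ', -⟩ := (stationaryWave_iff hγ).1 hts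
  -- Both orders of the waves end at the same width and flux, so `statInv` decides.
  rw [← statInv_lt_iff hγ hp h₁.right (ha.trans h₁.width.symm)
    (by rw [← hQ', h₀.fluxInv_eq, hQ, h₁.fluxInv_eq]) hside h₁.right_ge]
  have h2 := h₀.statInv_sub
  have h3 := h₁.statInv_sub
  have h4 := jumpFun_gt hγ h₁.left.ratio_pos hlt
  -- `Bs` is further below the sonic ratio than B and has the smaller `fluxFun`; its conjugate is
  -- therefore further above, and the shock lowers `statInv` more.
  have h5 : ratio γ Bt < ratio γ Bst := by
    by_contra! hle
    have h6 := fluxFun_lt hγ h₁.left.ratio_pos h₀.left_le hlt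
    rw [← h₀.flux, ← h₁.flux] at h6
    rcases hle.eq_or_lt with he | hlt'
    · rw [he] at h6; exact lt_irrefl _ h6
    · exact absurd h6 (fluxFun_gt hγ h₁.right_ge hlt').not_gt
  have h6 := jumpFun_gt hγ h₀.right.ratio_pos h5
  linarith

/-- The velocity behind a subsonic stationary wave decreases along `u + ρ ^ γ = const`. -/
lemma stationary_velocity_lt (hγ : 0 < γ) {K Ks K' Ks' : State}
    (hsum : K'.u + K'.ρ ^ γ = K.u + K.ρ ^ γ) (ha : K'.a = K.a) (has : Ks'.a = Ks.a)
    (h : StationaryWave γ K Ks) (h' : StationaryWave γ K' Ks')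
    (hK : 1 ≤ γ * ratio γ K) (hKs' : 1 ≤ γ * ratio γ Ks')
    (hlt : ratio γ K < ratio γ K') : Ks'.u < Ks.u := by
  have e1 := h.widthFun_eq hγ
  have e2 := h'.widthFun_eq hγ
  obtain ⟨pK, pKs, -, hI, -, -⟩ := (stationaryWave_iff hγ).1 h
  obtain ⟨pK', pKs', -, hI', -, -⟩ := (stationaryWave_iff hγ).1 h'
  have h1 := widthFun_lt hγ hK hlt
  rw [ha, has] at e2
  have h2 : ratio γ Ks < ratio γ Ks' := by
    by_contra! hle
    have := widthFun_le hγ hKs' hle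
    linarith
  have h3 := widthFun_add_fluxFun_gt hγ hK hlt
  have h4 : statInv γ K' < statInv γ K := by
    rw [pK.widthFun_ratio, pK'.widthFun_ratio, pK.fluxFun_ratio, pK'.fluxFun_ratio, hsum, ha] at h3
    linarith
  have h5 : statLog γ (ratio γ Ks) < statLog γ (ratio γ Ks') := by
    have h0 := pKs.ratio_pos (γ := γ)
    refine lt_of_hasDerivAt_pos h2 (fun x hx => hasDerivAt_statLog hγ (h0.trans_le hx.1)) ?_
    intro x hx
    have : 0 < x := h0.trans hx.1
    positivity
  -- `statInv` is smaller for the primed pair while its `statLog` part at the right state is larger,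
  -- so the velocity part must be smaller.
  rw [hI, hI', statInv, statInv] at h4
  have h6 : (γ + 1) * Real.log Ks'.u < (γ + 1) * Real.log Ks.u := by linarith
  exact (Real.log_lt_log_iff pKs'.u pKs.u).1 (lt_of_mul_lt_mul_left h6 (by positivity))

/-! ### Existence of the intermediate states -/

/-- The map to the conjugate ratio is antitone and onto an interval. Its negative is a monotone
surjection between intervals, hence continuous, even up to the sonic end. -/
lemma exists_continuousOn_conjugate (hγ : 0 < γ) {s₁ s₀ : ℝ} (h1 : 0 < s₁) (h10 : s₁ ≤ s₀)
    (h0 : γ * s₀ ≤ 1) : ∃ T : ℝ → ℝ, ContinuousOn T (Icc s₁ s₀) ∧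
      ∀ s ∈ Icc s₁ s₀, 1 ≤ γ * T s ∧ fluxFun γ (T s) = fluxFun γ s := by
  have hle : ∀ s ∈ Icc s₁ s₀, γ * s ≤ 1 := fun s hs =>
    (mul_le_mul_of_nonneg_left hs.2 hγ.le).trans h0
  have hex : ∀ s : ℝ, ∃ t, s ∈ Icc s₁ s₀ → 1 ≤ γ * t ∧ fluxFun γ t = fluxFun γ s := by
    intro s
    by_cases hs : s ∈ Icc s₁ s₀
    · obtain ⟨t, ht⟩ := exists_conjugate hγ (h1.trans_le hs.1) (hle s hs)
      exact ⟨t, fun _ => ht⟩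
    · exact ⟨0, fun h => absurd h hs⟩
  choose T hT using hex
  refine ⟨T, ?_, hT⟩
  have hanti : ∀ s ∈ Icc s₁ s₀, ∀ t ∈ Icc s₁ s₀, s ≤ t → T t ≤ T s := by
    intro s hs t ht hst
    by_contra! hlt
    have h2 := fluxFun_gt hγ (hT s hs).1 hlt
    rw [(hT s hs).2, (hT t ht).2] at h2
    rcases hst.eq_or_lt with rfl | hst
    · exact lt_irrefl _ h2
    · exact absurd h2 (fluxFun_lt hγ (h1.trans_le hs.1) (hle t ht) hst).not_gt
  have m₁ : s₁ ∈ Icc s₁ s₀ := left_mem_Icc.2 h10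
  have m₀ : s₀ ∈ Icc s₁ s₀ := right_mem_Icc.2 h10
  let f : Icc s₁ s₀ → Icc (-T s₁) (-T s₀) := fun s =>
    ⟨-T s, neg_le_neg (hanti s₁ m₁ s s.2 s.2.1), neg_le_neg (hanti s s.2 s₀ m₀ s.2.2)⟩
  have hmono : Monotone f := fun s t hst => neg_le_neg (hanti s s.2 t t.2 hst)
  have hsurj : Function.Surjective f := by
    rintro ⟨y, hy1, hy2⟩
    have hy0 : T s₀ ≤ -y := by linarith
    have hy3 : -y ≤ T s₁ := by linarith
    have hγy : 1 ≤ γ * -y := (hT s₀ m₀).1.trans (mul_le_mul_of_nonneg_left hy0 hγ.le)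
    have e1 : fluxFun γ (-y) ≤ fluxFun γ s₀ := by
      rw [← (hT s₀ m₀).2]
      rcases hy0.eq_or_lt with h | h
      · rw [h]
      · exact (fluxFun_gt hγ (hT s₀ m₀).1 h).le
    have e2 : fluxFun γ s₁ ≤ fluxFun γ (-y) := by
      rw [← (hT s₁ m₁).2]
      rcases hy3.eq_or_lt with h | h
      · rw [h]
      · exact (fluxFun_gt hγ hγy h).le
    obtain ⟨s, hs, hsy⟩ := intermediate_value_Icc h10
      (continuousOn_fluxFun.mono fun x hx => h1.trans_le hx.1) ⟨e2, e1⟩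
    refine ⟨⟨s, hs⟩, Subtype.ext ?_⟩
    have := fluxFun_inj_right hγ (hT s hs).1 hγy ((hT s hs).2.trans hsy)
    simp [f, this]
  have hcont := hmono.continuous_of_surjective hsurj
  rw [continuousOn_iff_continuous_domRestrict]
  have h2 : (Icc s₁ s₀).domRestrict T = fun s => -((f s : Icc (-T s₁) (-T s₀)) : ℝ) := by
    funext s
    simp [f, Set.domRestrict]
  rw [h2]
  exact (continuous_subtype_val.comp hcont).neg

/-- Three coincident waves of speed zero. -/
lemma exists_zero_speed_triple (hγ : 0 < γ) {B Bt Bs Bst Bts : State} {u : ℝ}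
    (h₀ : Conjugate γ B Bt) (hs : StationaryWave γ B Bs) (h₁ : Conjugate γ Bs Bst)
    (hlt : ratio γ Bs < ratio γ B) (hts : StationaryWave γ Bt Bts)
    (hside : 1 ≤ γ * ratio γ Bts) (ha : Bts.a = Bs.a) (hu1 : Bts.u < u) (hu2 : u < Bst.u) :
    ∃ X Xt Y : State, X.Positive ∧ Xt.Positive ∧ Y.Positive ∧ X.a ∈ Ioo B.a Bs.a ∧
      γ * ratio γ X < 1 ∧ Conjugate γ X Xt ∧
      1 < γ * ratio γ Y ∧ StationaryWave γ B X ∧ StationaryWave γ Xt Y ∧ Y.a = Bs.a ∧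
      Y.u = u := by
  obtain ⟨pB, pBs, -, hI, hQ, -⟩ := (stationaryWave_iff hγ).1 hs
  obtain ⟨pBt, pBts, -, hI', hQ', -⟩ := (stationaryWave_iff hγ).1 hts
  have hu : 0 < u := pBts.u.trans hu1
  -- Velocity, width and flux prescribe Y completely; only `statInv` remains to be matched by the
  -- position of the shock.
  let Y : State := ⟨u, Bst.ρ * Bst.u / u, Bs.a⟩
  have pY : Y.Positive := ⟨hu, div_pos (mul_pos h₁.right.ρ h₁.right.u) hu, pBs.a⟩
  have hYQ : fluxInv γ Y = fluxInv γ Bst := by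
    simp only [fluxInv, Y]
    rw [Real.log_div (mul_pos h₁.right.ρ h₁.right.u).ne' hu.ne',
      Real.log_mul h₁.right.ρ.ne' h₁.right.u.ne', h₁.width]
    ring
  have hYr : ratio γ Bst < ratio γ Y :=
    ratio_lt_of_velocity_lt hγ pY h₁.right h₁.width.symm hYQ hu2
  have hYs : 1 < γ * ratio γ Y := lt_of_le_of_lt h₁.right_ge (by gcongr)
  have hQY : fluxInv γ Y = fluxInv γ B := by rw [hYQ, h₁.fluxInv_eq, ← hQ]
  have k1 : statInv γ Bst < statInv γ Y :=
    (statInv_lt_iff hγ pY h₁.right h₁.width.symm hYQ hYs.le h₁.right_ge).2 hu2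
  have k2 : statInv γ Y < statInv γ Bts :=
    (statInv_lt_iff hγ pBts pY ha (by rw [hQY, ← hQ', h₀.fluxInv_eq]) hside hYs.le).2 hu1
  obtain ⟨T, hTc, hT⟩ := exists_continuousOn_conjugate hγ pBs.ratio_pos hlt.le h₀.left_le
  have m₁ := left_mem_Icc.2 hlt.le
  have m₀ := right_mem_Icc.2 hlt.le
  have hT1 : T (ratio γ Bs) = ratio γ Bst :=
    fluxFun_inj_right hγ (hT _ m₁).1 h₁.right_ge ((hT _ m₁).2.trans h₁.flux.symm)
  have hT0 : T (ratio γ B) = ratio γ Bt :=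
    fluxFun_inj_right hγ (hT _ m₀).1 h₀.right_ge ((hT _ m₀).2.trans h₀.flux.symm)
  have hcont : ContinuousOn (fun s => jumpFun γ (T s) - jumpFun γ s)
      (Icc (ratio γ Bs) (ratio γ B)) := by
    refine ((continuousOn_jumpFun hγ).comp hTc fun s hs => ?_).sub
      ((continuousOn_jumpFun hγ).mono fun s hs => pBs.ratio_pos.trans_le hs.1)
    exact pos_of_mul_pos_right (lt_of_lt_of_le one_pos (hT s hs).1) hγ.le
  have e0 := h₀.statInv_sub
  have e1 := h₁.statInv_sub
  -- The function is the change of `statInv` across a zero-speed shock starting at ratio s. At the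
  -- ends it leads to `Bst` and to `Bts`, which bracket Y.
  obtain ⟨s, hsm, hsv⟩ := intermediate_value_Ioo hlt.le hcont
    (show statInv γ Y - statInv γ B ∈ _ from
      ⟨by rw [hT1]; linarith, by rw [hT0]; linarith⟩)
  have hs0 : 0 < s := pBs.ratio_pos.trans hsm.1
  have hs1 : γ * s < 1 := lt_of_lt_of_le (by gcongr; exact hsm.2) h₀.left_le
  -- The width at which the stationary curve of B has ratio s.
  set b := Real.exp ((widthFun γ s - statInv γ B + fluxInv γ B) / γ) with hb
  have hb0 : 0 < b := Real.exp_pos _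
  have hbw : widthFun γ s = statInv γ B - fluxInv γ B + γ * Real.log b := by
    rw [hb, Real.log_exp]
    field_simp
    ring
  obtain ⟨X, pX, hXa, hXr, hXI, hXQ⟩ := exists_stationary_state hγ hb0 hs0 hbw
  have hXw : widthFun γ (ratio γ X) = widthFun γ s := by rw [hXr]
  have hXB : B.a < X.a := by
    have := widthFun_gt hγ hs0 h₀.left_le hsm.2
    rw [hbw, pB.widthFun_ratio, ← hXa] at this
    exact (Real.log_lt_log_iff pB.a pX.a).1
      (lt_of_mul_lt_mul_left (by linarith : γ * Real.log B.a < γ * Real.log X.a) hγ.le)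
  have hXBs : X.a < Bs.a := by
    have := widthFun_gt hγ pBs.ratio_pos hs1.le hsm.1
    rw [hbw, pBs.widthFun_ratio, ← hXa, hI, hQ] at this
    exact (Real.log_lt_log_iff pX.a pBs.a).1
      (lt_of_mul_lt_mul_left (by linarith : γ * Real.log X.a < γ * Real.log Bs.a) hγ.le)
  obtain ⟨Xt, hc⟩ := exists_conjugate_state hγ pX (by rw [hXr]; exact hs1.le)
  have hTs : ratio γ Xt = T s :=
    fluxFun_inj_right hγ hc.right_ge (hT s (Ioo_subset_Icc_self hsm)).1
      (by rw [hc.flux, hXr, (hT s (Ioo_subset_Icc_self hsm)).2])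
  have e2 := hc.statInv_sub
  rw [hTs, hXr] at e2
  refine ⟨X, Xt, Y, pX, hc.right, pY, ⟨hXB, hXBs⟩, by rwa [hXr], hc, hYs, ?_, ?_, rfl, rfl⟩
  · exact stationaryWave_of_invariants hγ pB pX hXB.ne hXI hXQ
      (Or.inl ⟨h₀.left_le, by rw [hXr]; exact hs1.le⟩)
  · refine stationaryWave_of_invariants hγ hc.right pY ?_ ?_ ?_ (Or.inr ⟨hc.right_ge, hYs.le⟩)
    · rw [hc.width]; exact hXBs.ne
    · have : jumpFun γ (T s) - jumpFun γ s = statInv γ Y - statInv γ B := hsv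
      linarith
    · rw [hc.fluxInv_eq, ← hXQ, hQY]

lemma tendsto_widthFun_add_fluxFun (hγ : 0 < γ) :
    Tendsto (fun s => widthFun γ s + fluxFun γ s) atTop atBot := by
  have h1 : Tendsto (fun s => jumpFun γ 1 + 1 / (γ + 1) * fluxFun γ s) atTop atBot :=
    tendsto_atBot_add_const_left _ _
      ((tendsto_fluxFun_atTop hγ).const_mul_atBot (by positivity))
  refine tendsto_atBot_mono' _ ?_ h1
  filter_upwards [eventually_gt_atTop 1] with s hs
  have h2 := jumpFun_gt hγ one_pos hs
  have h3 : widthFun γ s + fluxFun γ s = jumpFun γ s + 1 / (γ + 1) * fluxFun γ s := by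
    unfold jumpFun
    field_simp
    ring
  rw [h3]
  linarith

/-- The inverse of `statLog`. -/
lemma statLog_inverse (hγ : 0 < γ) (y : ℝ) :
    statLog γ ((Real.exp (y / ((γ + 1) ^ 2 / (2 * γ + 1))) - γ) / (2 * γ + 1)) = y := by
  have h : (2 * γ + 1) * ((Real.exp (y / ((γ + 1) ^ 2 / (2 * γ + 1))) - γ) / (2 * γ + 1)) + γ
      = Real.exp (y / ((γ + 1) ^ 2 / (2 * γ + 1))) := by
    field_simp
    ring
  rw [statLog, h, Real.log_exp]
  field_simp

/-- The right argument is only required to have a positive logarithm argument, since a value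
produced by `statLog_inverse` need not be known to be positive. -/
lemma statLog_lt_iff (hγ : 0 < γ) {s t : ℝ} (hs : 0 < s)
    (ht : 0 < (2 * γ + 1) * t + γ) : statLog γ s < statLog γ t ↔ s < t := by
  unfold statLog
  rw [mul_lt_mul_iff_right₀ (by positivity), Real.log_lt_log_iff (by positivity) ht,
    add_lt_add_iff_right, mul_lt_mul_iff_right₀ (by positivity)]

/-- From the subsonic part of a curve `u + ρ ^ γ = const`, stationary waves reach all smaller
velocities. -/
lemma exists_subsonic_pair (hγ : 0 < γ) {X Xs : State} {u : ℝ} (hX : 1 ≤ γ * ratio γ X)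
    (h : StationaryWave γ X Xs) (hs : 1 ≤ γ * ratio γ Xs) (ha : X.a < Xs.a) (hu : 0 < u)
    (hlt : u < Xs.u) :
    ∃ K Ks : State, K.Positive ∧ Ks.Positive ∧ K.a = X.a ∧ K.u + K.ρ ^ γ = X.u + X.ρ ^ γ ∧
      ratio γ X < ratio γ K ∧ StationaryWave γ K Ks ∧ Ks.a = Xs.a ∧ Ks.u = u ∧
      1 < γ * ratio γ Ks := by
  obtain ⟨pX, pXs, -, hI, hQ, -⟩ := (stationaryWave_iff hγ).1 h
  set s₀ := ratio γ X with hs₀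
  have hs₀p : 0 < s₀ := pX.ratio_pos
  set c := X.u + X.ρ ^ γ with hc
  have hc0 : 0 < c := add_pos pX.u (Real.rpow_pos_of_pos pX.ρ γ)
  -- A state of ratio s on the curve has `statInv` equal to (γ+1) log c + H(s). After a stationary
  -- wave to velocity u, the value of `statLog` must be C + H(s), which defines the new ratio `s₂
  -- s`.
  set C := (γ + 1) * (Real.log c - Real.log u) with hC
  let H : ℝ → ℝ := fun s => widthFun γ s + fluxFun γ s
  have hHanti : ∀ s t, 1 ≤ γ * s → s ≤ t → H t ≤ H s := by
    intro s t hs hst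
    rcases hst.eq_or_lt with rfl | hst
    · exact le_rfl
    · exact (widthFun_add_fluxFun_gt hγ hs hst).le
  have hHc : ContinuousOn H (Ioi 0) := (continuousOn_widthFun hγ).add continuousOn_fluxFun
  let s₂ : ℝ → ℝ := fun s =>
    (Real.exp ((C + H s) / ((γ + 1) ^ 2 / (2 * γ + 1))) - γ) / (2 * γ + 1)
  have hs₂ : ∀ s, statLog γ (s₂ s) = C + H s := fun s => statLog_inverse hγ _
  have hs₂p : ∀ s, 0 < (2 * γ + 1) * s₂ s + γ := by
    intro s
    have : (2 * γ + 1) * s₂ s + γ = Real.exp ((C + H s) / ((γ + 1) ^ 2 / (2 * γ + 1))) := by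
      simp only [s₂]
      field_simp
      ring
    rw [this]; exact Real.exp_pos _
  have hs₂c : ContinuousOn s₂ (Ioi 0) :=
    (((hHc.const_add C).div_const _).rexp.sub continuousOn_const).div_const _
  have hstat : ∀ Y : State, Y.Positive → statInv γ Y = (γ + 1) * Real.log (Y.u + Y.ρ ^ γ)
      + H (ratio γ Y) := by
    intro Y hY
    simp only [H]
    rw [hY.widthFun_ratio, hY.fluxFun_ratio]
    ring
  have hbase : statLog γ (ratio γ Xs) < statLog γ (s₂ s₀) := by
    have h1 := hstat X pX
    rw [hI, statInv] at h1
    have h2 := Real.log_lt_log hu hlt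
    have h3 : (γ + 1) * Real.log u < (γ + 1) * Real.log Xs.u := by gcongr
    rw [hs₂]
    linarith
  have hbase' := (statLog_lt_iff hγ pXs.ratio_pos (hs₂p s₀)).1 hbase
  have hγ1 : γ * γ⁻¹ = 1 := mul_inv_cancel₀ hγ.ne'
  have hθ : 0 < γ⁻¹ := by positivity
  have hθXs : γ⁻¹ ≤ ratio γ Xs := le_of_mul_le_mul_left (by linarith) hγ
  obtain ⟨b, hb, hsb⟩ := (((tendsto_widthFun_add_fluxFun hγ).eventually_le_atBot
    (statLog γ γ⁻¹ - C)).and (eventually_ge_atTop s₀)).exists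
  -- At e the right state becomes sonic; up to e it stays on the subsonic side.
  obtain ⟨e, he, hHe⟩ := intermediate_value_Icc' hsb
    (hHc.mono fun x hx => hs₀p.trans_le hx.1)
    (show statLog γ γ⁻¹ - C ∈ Icc (H b) (H s₀) from ⟨hb, by
      have h1 := (statLog_lt_iff hγ hθ (hs₂p s₀)).2 (hθXs.trans_lt hbase')
      rw [hs₂] at h1
      linarith⟩)
  have hse : s₀ ≤ e := he.1
  have hge : ∀ s ∈ Icc s₀ e, γ⁻¹ ≤ s₂ s := by
    intro s hs
    by_contra! hlt
    have h1 : H e ≤ H s := hHanti s e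
      (hX.trans (mul_le_mul_of_nonneg_left hs.1 hγ.le)) hs.2
    have h2 : statLog γ (s₂ s) < statLog γ γ⁻¹ := by
      unfold statLog
      have : Real.log ((2 * γ + 1) * s₂ s + γ) < Real.log ((2 * γ + 1) * γ⁻¹ + γ) :=
        Real.log_lt_log (hs₂p s) (by gcongr)
      gcongr
    rw [hs₂] at h2
    linarith
  -- The increase of `widthFun` that the two widths demand. At `s₀` the increase is larger, because
  -- u < `Xs.u` makes the ratio exceed that of `Xs`; at e it is at most zero, because `widthFun` is
  -- minimal at the sonic ratio.
  set Δ := γ * (Real.log Xs.a - Real.log X.a) with hΔ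
  have hΔ0 : 0 < Δ := mul_pos hγ (sub_pos.2 (Real.log_lt_log pX.a ha))
  have hcont : ContinuousOn (fun s => widthFun γ (s₂ s) - widthFun γ s) (Icc s₀ e) := by
    refine ((continuousOn_widthFun hγ).comp
      (hs₂c.mono fun x hx => hs₀p.trans_le hx.1) fun s hs => hθ.trans_le (hge s hs)).sub
      ((continuousOn_widthFun hγ).mono fun x hx => hs₀p.trans_le hx.1)
  have hstart : Δ < widthFun γ (s₂ s₀) - widthFun γ s₀ := by
    have h1 := widthFun_lt hγ hs hbase'
    have h2 := h.widthFun_eq hγ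
    rw [← hs₀] at h2
    linarith
  have hs₂e : s₂ e = γ⁻¹ := by
    have h1 : statLog γ (s₂ e) = statLog γ γ⁻¹ := by
      rw [hs₂]
      linarith
    refine le_antisymm ?_ (hge e ⟨hse, le_rfl⟩)
    by_contra! hlt
    exact ((statLog_lt_iff hγ hθ (hs₂p e)).2 hlt).ne' h1
  have hθle : ∀ s, 1 ≤ γ * s → widthFun γ γ⁻¹ ≤ widthFun γ s := fun s hs =>
    widthFun_le hγ hγ1.ge (le_of_mul_le_mul_left (by linarith) hγ)
  have hend : widthFun γ (s₂ e) - widthFun γ e < Δ := by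
    have := hθle e (hX.trans (mul_le_mul_of_nonneg_left hse hγ.le))
    rw [hs₂e]
    linarith
  obtain ⟨s, hsm, hsv⟩ := intermediate_value_Ioo' hse hcont ⟨hend, hstart⟩
  have hsv : widthFun γ (s₂ s) - widthFun γ s = Δ := hsv
  have hs0 : 0 < s := hs₀p.trans hsm.1
  have hγs : 1 ≤ γ * s := hX.trans (mul_le_mul_of_nonneg_left hsm.1.le hγ.le)
  obtain ⟨K, pK, hKa, hKr, hKs⟩ := exists_state_of_ratio hγ hc0 hs0 pX.a
  have hs₂0 : 0 < s₂ s := hθ.trans_le (hge s (Ioo_subset_Icc_self hsm))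
  have hKw : widthFun γ (s₂ s) = statInv γ K - fluxInv γ K + γ * Real.log Xs.a := by
    have h1 := pK.widthFun_ratio (γ := γ)
    rw [hKr, hKa] at h1
    linarith
  obtain ⟨Ks, pKs, hKsa, hKsr, hKI, hKQ⟩ := exists_stationary_state hγ pXs.a hs₂0 hKw
  have hside : 1 < γ * ratio γ Ks := by
    have h1 : γ⁻¹ ≠ s₂ s := by
      intro h1
      have h2 := hθle s hγs
      rw [h1] at h2
      linarith
    have h2 := (hge s (Ioo_subset_Icc_self hsm)).lt_of_ne h1
    rw [hKsr, ← hγ1]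
    gcongr
  refine ⟨K, Ks, pK, pKs, hKa, hKs, by rw [hKr]; exact hsm.1, ?_, hKsa, ?_, hside⟩
  · exact stationaryWave_of_invariants hγ pK pKs (by rw [hKa, hKsa]; exact ha.ne) hKI hKQ
      (Or.inr ⟨by rwa [hKr], hside.le⟩)
  · have h1 := hstat K pK
    rw [hKI, statInv, hKsr, hs₂, hKs, hKr] at h1
    have h2 : (γ + 1) * Real.log Ks.u = (γ + 1) * Real.log u := by linarith
    exact Real.log_injOn_pos pKs.u hu (mul_left_cancel₀ (by positivity) h2)

/-! ### Wave fans -/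

lemma rarefaction_of_curve (hγ : 0 < γ) (ha : W.a = V.a) (hw : W.u + W.ρ ^ γ = V.u + V.ρ ^ γ)
    (hW : 0 ≤ W.ρ) (hρ : W.ρ < V.ρ) : Rarefaction γ V W :=
  ⟨ha, by linarith, hW, hρ, (density_lt_iff hγ hW (hW.trans hρ.le) hw.symm).1 hρ⟩

lemma Rarefaction.sum (h : Rarefaction γ V W) : W.u + W.ρ ^ γ = V.u + V.ρ ^ γ := by
  have := h.2.1
  linarith

lemma OneWaveCurve.curve (hγ : 0 < γ) (h : W ∈ OneWaveCurve γ V) :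
    W.a = V.a ∧ W.u + W.ρ ^ γ = V.u + V.ρ ^ γ := by
  rcases h with ⟨σ, h⟩ | h | rfl
  · exact ⟨(h.curve hγ).1, (h.curve hγ).2.1⟩
  · exact ⟨h.1, h.sum⟩
  · exact ⟨rfl, rfl⟩

lemma lam_le_velocity (hγ : 0 < γ) (hρ : 0 ≤ V.ρ) : lam γ V ≤ V.u := by
  have := mul_nonneg hγ.le (Real.rpow_nonneg hρ γ)
  rw [lam]
  linarith

lemma State.Positive.lam_nonneg (hV : V.Positive) (h : γ * ratio γ V ≤ 1) : 0 ≤ lam γ V := by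
  rw [hV.lam_eq]
  exact mul_nonneg hV.u.le (by linarith)

lemma State.Positive.lam_nonpos (hV : V.Positive) (h : 1 ≤ γ * ratio γ V) : lam γ V ≤ 0 := by
  rw [hV.lam_eq]
  exact mul_nonpos_of_nonneg_of_nonpos hV.u.le (by linarith)

lemma State.Positive.lt_sum (hV : V.Positive) : V.u < V.u + V.ρ ^ γ :=
  lt_add_of_pos_right _ (Real.rpow_pos_of_pos hV.ρ γ)

/-- The bounds on the velocity put M strictly between S and its conjugate, where the flux exceeds
that of S. The shock speed is therefore positive and the shock may follow a stationary wave. -/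
lemma exists_shock_contact (hγ : 0 < γ) (hr : Ur.Positive) {S St : State} (hc : Conjugate γ S St)
    (ha : S.a = Ur.a) (h1 : St.u < Ur.u) (h2 : Ur.u < S.u) :
    ∃ M : State, Uniquely (fun V => V.u = Ur.u ∧ ∃ σ, LaxShock γ σ S V) M ∧
      FanSol γ Ur S (.shock S M :: contactTail M Ur) 0 := by
  have pS := hc.left
  obtain ⟨M, pM, hMa, hMu, hMs⟩ := exists_state_of_velocity hγ hr.u (h2.trans pS.lt_sum) pS.a
  have hρ : S.ρ < M.ρ := (density_lt_iff hγ pS.ρ.le pM.ρ.le hMs).2 (hMu ▸ h2)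
  have hlax := laxShock_of_curve hγ pS.ρ hMa hMs hρ
  have k1 : ratio γ S < ratio γ M := (ratio_lt_iff pS pM hMs).2 (hMu ▸ h2)
  have k2 : ratio γ M < ratio γ St :=
    (ratio_lt_iff pM hc.right (hc.sum.trans hMs.symm)).2 (hMu ▸ h1)
  have hf : fluxFun γ (ratio γ S) < fluxFun γ (ratio γ M) := by
    rcases le_total (γ * ratio γ M) 1 with h | h
    · exact fluxFun_lt hγ pS.ratio_pos h k1
    · rw [← hc.flux]; exact fluxFun_gt hγ h k2
  have hσ := shockSpeed_pos hγ pS pM hMs hρ hf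
  refine ⟨M, ⟨⟨hMu, _, hlax⟩, ?_⟩, ?_⟩
  · rintro X ⟨hXu, σ, hX⟩
    obtain ⟨hXa, hXs, hXρ, -⟩ := hX.curve hγ
    exact eq_of_curve hγ pM.ρ.le (pS.ρ.trans hXρ).le (hXs.trans hMs.symm) (hXu.trans hMu.symm)
      (hXa.trans hMa.symm)
  · have ht : FanSol γ Ur M (contactTail M Ur) Ur.u :=
      fanSol_contactTail hMu (hMa.trans ha) pM.ρ.le hr
    exact (ht.cons_shock hlax (hMu ▸ hlax.2.2.2.2.2) hσ.ne' pS.u.le).mono hσ.le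

lemma exists_rarefaction_contact (hγ : 0 < γ) (hr : Ur.Positive) {S : State} (pS : S.Positive)
    (hS : γ * ratio γ S ≤ 1) (ha : S.a = Ur.a) (h1 : S.u < Ur.u) (h2 : Ur.u < S.u + S.ρ ^ γ) :
    ∃ N : State, Uniquely (fun V => V.u = Ur.u ∧ Rarefaction γ S V) N ∧
      FanSol γ Ur S (.rarefaction S N :: contactTail N Ur) 0 := by
  obtain ⟨N, pN, hNa, hNu, hNs⟩ := exists_state_of_velocity hγ hr.u h2 pS.a
  have hρ : N.ρ < S.ρ := (density_lt_iff hγ pN.ρ.le pS.ρ.le hNs.symm).2 (hNu ▸ h1)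
  have hrar := rarefaction_of_curve hγ hNa hNs pN.ρ.le hρ
  refine ⟨N, ⟨⟨hNu, hrar⟩, ?_⟩, ?_⟩
  · rintro X ⟨hXu, hX⟩
    exact eq_of_curve hγ pN.ρ.le hX.2.2.1 (hX.sum.trans hNs.symm) (hXu.trans hNu.symm)
      (hX.1.trans hNa.symm)
  · have ht : FanSol γ Ur N (contactTail N Ur) Ur.u :=
      fanSol_contactTail hNu (hNa.trans ha) pN.ρ.le hr
    exact ((ht.mono (hNu ▸ lam_le_velocity hγ pN.ρ.le)).cons_rarefaction hγ hrar pS.u.le).mono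
      (pS.lam_nonneg hS)

lemma rarefaction_to_vacuum (hγ : 0 < γ) {S : State} (pS : S.Positive) (ha : S.a = Ur.a) :
    Rarefaction γ S ⟨S.u + S.ρ ^ γ, 0, Ur.a⟩ :=
  rarefaction_of_curve hγ ha.symm (by simp [Real.zero_rpow hγ.ne']) le_rfl pS.ρ

lemma lam_vacuum (hγ : 0 < γ) (u a : ℝ) : lam γ ⟨u, 0, a⟩ = u := by
  simp [lam, Real.zero_rpow hγ.ne']

lemma fanSol_vacuum (hγ : 0 < γ) (hr : Ur.Positive) {S : State} (pS : S.Positive)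
    (hS : γ * ratio γ S ≤ 1) (ha : S.a = Ur.a) (h : S.u + S.ρ ^ γ < Ur.u) :
    FanSol γ Ur S [.rarefaction S ⟨S.u + S.ρ ^ γ, 0, Ur.a⟩,
      .vacuum ⟨S.u + S.ρ ^ γ, 0, Ur.a⟩ ⟨Ur.u, 0, Ur.a⟩, .contact ⟨Ur.u, 0, Ur.a⟩ Ur] 0 := by
  have h1 : FanSol γ Ur ⟨Ur.u, 0, Ur.a⟩ [.contact ⟨Ur.u, 0, Ur.a⟩ Ur] Ur.u :=
    fanSol_contact rfl rfl le_rfl hr hr.ρ.ne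
  have h2 := FanSol.cons_vacuum (V := ⟨Ur.u, 0, Ur.a⟩) (V₀ := ⟨S.u + S.ρ ^ γ, 0, Ur.a⟩) h1 rfl rfl
    rfl (pS.u.trans pS.lt_sum).le h
  exact ((h2.mono (lam_vacuum hγ _ _).le).cons_rarefaction hγ
    (rarefaction_to_vacuum hγ pS ha) pS.u.le).mono (pS.lam_nonneg hS)

lemma fanSol_zero_speed_triple (hγ : 0 < γ) (hr : Ur.Positive) {B X Xt Y : State}
    (hBX : B.a ≤ X.a) (hXr : X.a ≤ Ur.a) (h1 : StationaryWave γ B X) (h2 : LaxShock γ 0 X Xt)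
    (h3 : StationaryWave γ Xt Y) (ha : Y.a = Ur.a) (hu : Y.u = Ur.u) :
    FanSol γ Ur B ([.stationary B X, .shock X Xt, .stationary Xt Y] ++ contactTail Y Ur) 0 := by
  have pY := h3.2.1.positive.2
  have pX := h1.2.1.positive.2
  have ht : FanSol γ Ur Y (contactTail Y Ur) Ur.u := fanSol_contactTail hu ha pY.ρ.le hr
  have hXt : Xt.a ≤ Y.a := by rw [ha, (h2.curve hγ).1]; exact hXr
  exact (((ht.mono hr.u.le).cons_stationary h3 hXt).cons_zeroShock hγ h2 pX.u.le).cons_stationary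
    h1 hBX

lemma fanSol_stationary_contact (hr : Ur.Positive) {K Ks : State}
    (h : StationaryWave γ K Ks) (haK : K.a ≤ Ur.a) (ha : Ks.a = Ur.a) (hu : Ks.u = Ur.u) :
    FanSol γ Ur K (.stationary K Ks :: contactTail Ks Ur) 0 :=
  have ht : FanSol γ Ur Ks (contactTail Ks Ur) Ur.u :=
    fanSol_contactTail hu ha h.2.1.positive.2.ρ.le hr
  (ht.mono hr.u.le).cons_stationary h (haK.trans ha.ge)

/-- K is denser than B with less flux, so the shock speed is negative and the shock precedes the
stationary wave. -/
lemma fanSol_subsonic_shock (hγ : 0 < γ) (hr : Ur.Positive) {B K Ks : State} (pB : B.Positive)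
    (pK : K.Positive) (hKa : K.a = B.a) (hKs : K.u + K.ρ ^ γ = B.u + B.ρ ^ γ) (hρ : B.ρ < K.ρ)
    (hf : fluxFun γ (ratio γ K) < fluxFun γ (ratio γ B)) (haB : B.a ≤ Ur.a)
    (h : StationaryWave γ K Ks) (ha : Ks.a = Ur.a) (hu : Ks.u = Ur.u) :
    SolvedBy γ B Ur ([.shock B K, .stationary K Ks] ++ contactTail Ks Ur) := by
  have hσ := shockSpeed_neg hγ pB pK hKs hρ hf
  exact ((fanSol_stationary_contact hr h (hKa ▸ haB) ha hu).cons_shock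
    (laxShock_of_curve hγ pB.ρ hKa hKs hρ) hσ hσ.ne pB.u.le).solvedBy

/-- The final velocity is strictly monotone in the ratio of the first state
(`stationary_velocity_lt`), so it determines the pair. -/
lemma subsonic_pair_unique (hγ : 0 < γ) {K Ks K' Ks' : State}
    (hsum : K'.u + K'.ρ ^ γ = K.u + K.ρ ^ γ) (ha : K'.a = K.a) (has : Ks'.a = Ks.a)
    (hus : Ks'.u = Ks.u) (h : StationaryWave γ K Ks) (h' : StationaryWave γ K' Ks')
    (hK : 1 < γ * ratio γ K) (hK' : 1 < γ * ratio γ K') : (K', Ks') = (K, Ks) := by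
  have s1 := h.side_right hγ hK
  have s2 := h'.side_right hγ hK'
  have hr : ratio γ K' = ratio γ K := by
    rcases lt_trichotomy (ratio γ K') (ratio γ K) with hlt | he | hlt
    · exact absurd hus
        (stationary_velocity_lt hγ hsum.symm ha.symm has.symm h' h hK'.le s1 hlt).ne'
    · exact he
    · exact absurd hus (stationary_velocity_lt hγ hsum ha has h h' hK.le s2 hlt).ne
  have e : K' = K := eq_of_curve_ratio hγ h.2.1.positive.1 h'.2.1.positive.1 hsum hr ha
  subst e
  rw [h.unique hγ h' has (Or.inr ⟨s1, s2⟩)]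

/-- For velocities on the right that are not too small, the waves to the right of a sonic or
supersonic state have nonnegative speeds. -/
lemma exists_fanSol_of_ge (hγ : 0 < γ) (hr : Ur.Positive) {B Bt Bts : State}
    (h₀ : Conjugate γ B Bt) (haB : B.a < Ur.a) (hts : StationaryWave γ Bt Bts)
    (hside : 1 ≤ γ * ratio γ Bts) (ha : Bts.a = Ur.a) (hu : Bts.u ≤ Ur.u) :
    ∃ F, FanSol γ Ur B F 0 := by
  have pB := h₀.left
  rcases hu.eq_or_lt with hu | hu
  -- Limiting velocity with the zero-speed shock at the narrow end; the shock disappears when B is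
  -- sonic.
  · have h1 := fanSol_stationary_contact hr hts (h₀.width.le.trans haB.le) ha hu
    rcases h₀.left_le.eq_or_lt with hB | hB
    · rw [h₀.eq_of_sonic hγ hB] at h1
      exact ⟨_, h1⟩
    · exact ⟨_, h1.cons_zeroShock hγ (h₀.laxShock hγ hB) pB.u.le⟩
  obtain ⟨S, pS, hSa, hS, hSB, hBS⟩ := exists_stationary_left hγ pB h₀.left_le haB
  obtain ⟨St, hc⟩ := exists_conjugate_state hγ pS hS.le
  have key : ∀ F, FanSol γ Ur S F 0 → ∃ F, FanSol γ Ur B F 0 := fun F hF =>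
    ⟨_, hF.cons_stationary hBS (haB.le.trans hSa.ge)⟩
  rcases lt_trichotomy Ur.u St.u with h1 | h1 | h1
  · obtain ⟨X, Xt, Y, pX, -, -, hXa, hXs, hXc, -, hBX, hXY, hYa, hYu⟩ :=
      exists_zero_speed_triple hγ h₀ hBS hc hSB hts hside (ha.trans hSa.symm) hu h1
    exact ⟨_, fanSol_zero_speed_triple hγ hr hXa.1.le (hSa ▸ hXa.2.le) hBX (hXc.laxShock hγ hXs) hXY
      (hYa.trans hSa) hYu⟩
  -- Limiting velocity with the zero-speed shock at the wide end.
  · have ht : FanSol γ Ur St (contactTail St Ur) Ur.u :=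
      fanSol_contactTail h1.symm (hc.width.trans hSa) hc.right.ρ.le hr
    exact key _ ((ht.mono hr.u.le).cons_zeroShock hγ (hc.laxShock hγ hS) pS.u.le)
  rcases lt_trichotomy Ur.u S.u with h2 | h2 | h2
  · obtain ⟨M, -, hM⟩ := exists_shock_contact hγ hr hc hSa h1 h2
    exact key _ hM
  · have ht : FanSol γ Ur S (contactTail S Ur) Ur.u := fanSol_contactTail h2.symm hSa pS.ρ.le hr
    exact key _ (ht.mono hr.u.le)
  rcases lt_trichotomy Ur.u (S.u + S.ρ ^ γ) with h3 | h3 | h3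
  · obtain ⟨N, -, hN⟩ := exists_rarefaction_contact hγ hr pS hS.le hSa h2 h3
    exact key _ hN
  -- The rarefaction reaches the vacuum exactly at the contact speed, so no vacuum interval opens.
  · have ht : FanSol γ Ur ⟨S.u + S.ρ ^ γ, 0, Ur.a⟩ [.contact ⟨S.u + S.ρ ^ γ, 0, Ur.a⟩ Ur] Ur.u :=
      fanSol_contact h3.symm rfl le_rfl hr hr.ρ.ne
    exact key _ (((ht.mono ((lam_vacuum hγ _ _).trans h3.symm).le).cons_rarefaction hγ
      (rarefaction_to_vacuum hγ pS hSa) pS.u.le).mono (pS.lam_nonneg hS.le))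
  · exact key _ (fanSol_vacuum hγ hr pS hS.le hSa h3)

/-- The solution for small velocities on the right. -/
lemma exists_subsonic_shock (hγ : 0 < γ) (hr : Ur.Positive) {B Bt Bts : State}
    (pB : B.Positive) (pt : Bt.Positive) (hta : Bt.a = B.a)
    (htsum : Bt.u + Bt.ρ ^ γ = B.u + B.ρ ^ γ) (htρ : B.ρ ≤ Bt.ρ) (ht : 1 ≤ γ * ratio γ Bt)
    (htf : fluxFun γ (ratio γ Bt) = fluxFun γ (ratio γ B)) (haB : B.a < Ur.a)
    (hts : StationaryWave γ Bt Bts) (hside : 1 ≤ γ * ratio γ Bts) (ha : Bts.a = Ur.a)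
    (hu : Ur.u < Bts.u) :
    ∃ K Ks : State, K.Positive ∧ K.a = B.a ∧ K.u + K.ρ ^ γ = B.u + B.ρ ^ γ ∧ Bt.ρ < K.ρ ∧
      1 < γ * ratio γ K ∧ LaxShock γ (shockSpeed B K) B K ∧ StationaryWave γ K Ks ∧
      Ks.a = Ur.a ∧ Ks.u = Ur.u ∧ Ks ∈ D₁ γ ∧
      SolvedBy γ B Ur ([.shock B K, .stationary K Ks] ++ contactTail Ks Ur) := by
  obtain ⟨K, Ks, pK, pKs, hKa, hKsum, hKr, hw, hKsa, hKsu, hKss⟩ :=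
    exists_subsonic_pair hγ ht hts hside (by rw [hta, ha]; exact haB) hr.u hu
  have hρ := (ratio_lt_iff_density_lt hγ pt pK hKsum).1 hKr
  have hsum := hKsum.trans htsum
  refine ⟨K, Ks, pK, hKa.trans hta, hsum, hρ, ?_, ?_, hw, hKsa.trans ha, hKsu,
    pKs.mem_D₁_iff.2 hKss, ?_⟩
  · exact lt_of_le_of_lt ht (by gcongr)
  · exact laxShock_of_curve hγ pB.ρ (hKa.trans hta) hsum (htρ.trans_lt hρ)
  · exact fanSol_subsonic_shock hγ hr pB pK (hKa.trans hta) hsum (htρ.trans_lt hρ)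
      (by rw [← htf]; exact fluxFun_gt hγ ht hKr) haB.le hw (hKsa.trans ha) hKsu

lemma Conjugate.density_le (hγ : 0 < γ) (h : Conjugate γ V W) : V.ρ ≤ W.ρ := by
  by_contra! hlt
  have h1 := (ratio_lt_iff_density_lt hγ h.right h.left h.sum.symm).2 hlt
  have h2 : γ * ratio γ W < γ * ratio γ V := by gcongr
  linarith [h.left_le, h.right_ge]

/-! ### The main constructions -/

lemma caseOne (hγ : 0 < γ) {Ul : State} (hl : Ul.Positive) (hr : Ur.Positive)
    (ha : Ul.a < Ur.a) (hD : Ul ∈ D₂ γ) : CaseOne γ Ul Ur := by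
  have hs : γ * ratio γ Ul < 1 := hl.mem_D₂_iff.1 hD
  obtain ⟨S, pS, hSa, hS, hSl, hlS⟩ := exists_stationary_left hγ hl hs.le ha
  obtain ⟨T, hT⟩ := exists_conjugate_state hγ hl hs.le
  obtain ⟨St, hSt⟩ := exists_conjugate_state hγ pS hS.le
  have hT1 := hT.right_gt hγ hs
  obtain ⟨Ts, pTs, hTsa, hTs, hTTs⟩ := exists_stationary_right hγ hT.right hT1.le
    (hT.width.trans_lt ha)
  have hSt1 := hSt.right_gt hγ hS
  have hord : Ts.u < St.u :=
    velocity_lt_of_conjugate hγ hT hlS hSt hSl hTTs hTs.le (hTsa.trans hSa.symm)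
  have hord' : St.u < S.u := (ratio_lt_iff pS hSt.right hSt.sum).1
    (lt_of_mul_lt_mul_left (hS.trans hSt1) hγ.le)
  have hle : Ul.a ≤ S.a := by rw [hSa]; exact ha.le
  refine ⟨S, T, St, Ts, hlS.uniquely_left hγ hs hSa, pS.mem_D₂_iff.2 hS, hT.uniquely hγ hs,
    hT.right.mem_D₁_iff.2 hT1, hSt.uniquely hγ hS, hSt.right.mem_D₁_iff.2 hSt1,
    hTTs.uniquely_right hγ hT1 hTsa, pTs.mem_D₁_iff.2 hTs, hord, hord', ?_, ?_, ?_, ?_, ?_, ?_⟩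
  · intro h1 h2
    obtain ⟨M, hM, hF⟩ := exists_shock_contact hγ hr hSt hSa h1 h2
    exact ⟨M, hM, (hF.cons_stationary hlS hle).solvedBy⟩
  · intro h1 h2
    obtain ⟨M, hM, hF⟩ := exists_rarefaction_contact hγ hr pS hS.le hSa h1 h2
    exact ⟨M, hM, (hF.cons_stationary hlS hle).solvedBy⟩
  · intro h
    exact ((fanSol_vacuum hγ hr pS hS.le hSa h).cons_stationary hlS hle).solvedBy
  · intro h
    obtain ⟨K, Ks, pK, hKa, hKsum, hKρ, hK1, hlax, hw, hKsa, hKsu, hKs, hsol⟩ :=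
      exists_subsonic_shock hγ hr hl hT.right hT.width hT.sum (hT.density_le hγ) hT1.le hT.flux ha
        hTTs hTs.le hTsa h
    refine ⟨K, Ks, ⟨⟨⟨_, hlax⟩, hKρ, hw, hKsa, hKsu⟩, ?_⟩, hKs, hsol⟩
    rintro ⟨K', Ks'⟩ ⟨⟨σ, hσ⟩, hρ', hw', ha', hu'⟩
    obtain ⟨e1, e2, -, -⟩ := hσ.curve hγ
    have pK' := hw'.2.1.positive.1
    have hK' : 1 < γ * ratio γ K' := hT1.trans (by
      gcongr
      exact (ratio_lt_iff_density_lt hγ hT.right pK' (e2.trans hT.sum.symm)).2 hρ')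
    exact subsonic_pair_unique hγ (e2.trans hKsum.symm) (e1.trans hKa.symm) (ha'.trans hKsa.symm)
      (hu'.trans hKsu.symm) hw hw' hK1 hK'
  · intro h1 h2
    obtain ⟨X, Xt, Y, pX, pXt, pY, hXa, hXs, hXc, hY, hBX, hXY, hYa, hYu⟩ :=
      exists_zero_speed_triple hγ hT hlS hSt hSl hTTs hTs.le (hTsa.trans hSa.symm) h1 h2
    rw [hSa] at hXa
    have hX0 := hXc.laxShock hγ hXs
    exact ⟨X, Xt, Y, hXa, pX.mem_D₂_iff.2 hXs, hX0, pXt.mem_D₁_iff.2 (hXc.right_gt hγ hXs),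
      pY.mem_D₁_iff.2 hY, (fanSol_zero_speed_triple hγ hr hXa.1.le hXa.2.le hBX hX0 hXY
        (hYa.trans hSa) hYu).solvedBy⟩
  · intro X Xt Y hXa h1 h2 h3 hYa hYu
    exact (fanSol_zero_speed_triple hγ hr hXa.1.le hXa.2.le h1 h2 h3 hYa hYu).solvedBy

/-- The sonic state on the rarefaction curve of a subsonic state. -/
lemma exists_sonic_rarefaction (hγ : 0 < γ) {Ul : State} (hl : Ul.Positive)
    (hs : 1 < γ * ratio γ Ul) : ∃ C : State, C.Positive ∧ γ * ratio γ C = 1 ∧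
      Rarefaction γ Ul C := by
  have hγ1 : γ * γ⁻¹ = 1 := mul_inv_cancel₀ hγ.ne'
  obtain ⟨C, pC, hCa, hCr, hCs⟩ := exists_state_of_ratio hγ (hl.u.trans (hl.lt_sum (γ := γ)))
    (inv_pos.2 hγ) hl.a
  have hC1 : γ * ratio γ C = 1 := by rw [hCr, hγ1]
  refine ⟨C, pC, hC1, rarefaction_of_curve hγ hCa hCs pC.ρ.le ?_⟩
  rw [← ratio_lt_iff_density_lt hγ pC hl hCs.symm]
  exact lt_of_mul_lt_mul_left (hC1.trans_lt hs) hγ.le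

/-- The pair is produced by `exists_subsonic_pair` from the sonic state C. As the final velocity
exceeds that of `Uu`, monotonicity places K between C and `Ul`, so it is reached by a rarefaction.
-/
lemma exists_subsonic_rarefaction (hγ : 0 < γ) (hr : Ur.Positive) {Ul C Cu Uu : State}
    (hl : Ul.Positive) (hs : 1 < γ * ratio γ Ul) (ha : Ul.a < Ur.a) (hC : γ * ratio γ C = 1)
    (hrar : Rarefaction γ Ul C) (hCu : StationaryWave γ C Cu) (hCu1 : 1 < γ * ratio γ Cu)
    (hCua : Cu.a = Ur.a) (hUu : StationaryWave γ Ul Uu) (hUua : Uu.a = Ur.a)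
    (h1 : Uu.u < Ur.u) (h2 : Ur.u < Cu.u) :
    ∃ K Ks : State, K.Positive ∧ 1 < γ * ratio γ K ∧ Rarefaction γ Ul K ∧ C.ρ < K.ρ ∧
      StationaryWave γ K Ks ∧ Ks.a = Ur.a ∧ Ks.u = Ur.u ∧ Ks ∈ D₁ γ ∧
      SolvedBy γ Ul Ur ([.rarefaction Ul K, .stationary K Ks] ++ contactTail Ks Ur) := by
  have pC := hCu.2.1.positive.1
  obtain ⟨K, Ks, pK, pKs, hKa, hKsum, hKr, hw, hKsa, hKsu, hKss⟩ :=
    exists_subsonic_pair hγ hC.ge hCu hCu1.le (by rw [hrar.1, hCua]; exact ha) hr.u h2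
  have hK1 : 1 < γ * ratio γ K := hC.symm.trans_lt (by gcongr)
  have hsum := hKsum.trans hrar.sum
  have hKl : ratio γ K < ratio γ Ul := by
    by_contra! hle
    rcases hle.eq_or_lt with he | hlt
    · have e : K = Ul := eq_of_curve_ratio hγ hl pK hsum he.symm (hKa.trans hrar.1)
      subst e
      have := hw.unique hγ hUu (hUua.trans (hKsa.trans hCua).symm)
        (Or.inr ⟨hKss.le, hUu.side_right hγ hK1⟩)
      rw [this, hKsu] at h1
      exact lt_irrefl _ h1
    · have := stationary_velocity_lt hγ hsum (hKa.trans hrar.1)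
        ((hKsa.trans hCua).trans hUua.symm) hUu hw hs.le hKss.le hlt
      rw [hKsu] at this
      exact lt_irrefl _ (this.trans h1)
  have hrK : Rarefaction γ Ul K := rarefaction_of_curve hγ (hKa.trans hrar.1) hsum pK.ρ.le
    ((ratio_lt_iff_density_lt hγ pK hl hsum.symm).1 hKl)
  refine ⟨K, Ks, pK, hK1, hrK, (ratio_lt_iff_density_lt hγ pC pK hKsum).1 hKr, hw,
    hKsa.trans hCua, hKsu, pKs.mem_D₁_iff.2 hKss, ?_⟩
  -- K is subsonic, so the rarefaction ends at a speed λ₁(K) ≤ 0, before the stationary wave.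
  exact (((fanSol_stationary_contact hr hw (by rw [hrK.1]; exact ha.le) (hKsa.trans hCua)
    hKsu).mono (pK.lam_nonpos hK1.le)).cons_rarefaction hγ hrK hl.u.le).solvedBy

/-- Apart from case 2.4, the waves behind C are those for a left state C that is conjugate to
itself; `hsolve` prefixes the rarefaction, which ends at speed zero. -/
lemma caseTwo (hγ : 0 < γ) {Ul : State} (hl : Ul.Positive) (hr : Ur.Positive)
    (ha : Ul.a < Ur.a) (hD : Ul ∈ D₁ γ) : CaseTwo γ Ul Ur := by
  have hs : 1 < γ * ratio γ Ul := hl.mem_D₁_iff.1 hD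
  obtain ⟨C, pC, hC, hrar⟩ := exists_sonic_rarefaction hγ hl hs
  have haC : C.a < Ur.a := hrar.1.trans_lt ha
  obtain ⟨S, pS, hSa, hS, hSC, hCS⟩ := exists_stationary_left hγ pC hC.le haC
  obtain ⟨Cu, pCu, hCua, hCu1, hCCu⟩ := exists_stationary_right hγ pC hC.ge haC
  obtain ⟨St, hSt⟩ := exists_conjugate_state hγ pS hS.le
  obtain ⟨Uu, pUu, hUua, hUu1, hUUu⟩ := exists_stationary_right hγ hl hs.le ha
  have hCC := conjugate_self pC hC
  have hSt1 := hSt.right_gt hγ hS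
  have hCl : ratio γ C < ratio γ Ul := lt_of_mul_lt_mul_left (hC.trans_lt hs) hγ.le
  have hord0 : Uu.u < Cu.u := stationary_velocity_lt hγ hrar.sum.symm hrar.1.symm
    (hUua.trans hCua.symm) hCCu hUUu hC.ge hUu1.le hCl
  have hord : Cu.u < St.u :=
    velocity_lt_of_conjugate hγ hCC hCS hSt hSC hCCu hCu1.le (hCua.trans hSa.symm)
  have hord' : St.u < S.u := (ratio_lt_iff pS hSt.right hSt.sum).1
    (lt_of_mul_lt_mul_left (hS.trans hSt1) hγ.le)
  have hle : C.a ≤ S.a := by rw [hSa]; exact haC.le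
  have hlam : lam γ C ≤ 0 := pC.lam_nonpos hC.ge
  have hsolve : ∀ {F}, FanSol γ Ur C F 0 → SolvedBy γ Ul Ur (.rarefaction Ul C :: F) := fun hF =>
    ((hF.mono hlam).cons_rarefaction hγ hrar hl.u.le).solvedBy
  have huniq : ∀ {K Ks : State}, K.a = Ul.a → K.u + K.ρ ^ γ = Ul.u + Ul.ρ ^ γ →
      1 < γ * ratio γ K → StationaryWave γ K Ks → Ks.a = Ur.a → Ks.u = Ur.u →
      ∀ q : State × State, (q.1 ∈ OneWaveCurve γ Ul ∧ C.ρ < q.1.ρ ∧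
        StationaryWave γ q.1 q.2 ∧ q.2.a = Ur.a ∧ q.2.u = Ur.u) → q = (K, Ks) := by
    rintro K Ks hKa hKsum hK1 hw hKsa hKsu ⟨K', Ks'⟩ ⟨hcur, hρ', hw', ha', hu'⟩
    obtain ⟨e1, e2⟩ := OneWaveCurve.curve hγ hcur
    have pK' := hw'.2.1.positive.1
    have hK' : 1 < γ * ratio γ K' := hC.symm.trans_lt (by
      gcongr
      exact (ratio_lt_iff_density_lt hγ pC pK' (e2.trans hrar.sum.symm)).2 hρ')
    exact subsonic_pair_unique hγ (e2.trans hKsum.symm) (e1.trans hKa.symm) (ha'.trans hKsa.symm)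
      (hu'.trans hKsu.symm) hw hw' hK1 hK'
  refine ⟨C, S, Cu, St, Uu, ⟨⟨hrar, pC.mem_GammaPlus_iff.2 hC⟩, ?_⟩,
    ⟨⟨hSa, hCS, pS.mem_D₂_iff.2 hS⟩, ?_⟩, ⟨⟨hCua, hCCu, pCu.mem_D₁_iff.2 hCu1⟩, ?_⟩,
    hSt.uniquely hγ hS, hSt.right.mem_D₁_iff.2 hSt1, hUUu.uniquely_right hγ hs hUua,
    pUu.mem_D₁_iff.2 hUu1, hord0, hord, hord', ?_, ?_, ?_, ?_, ?_, ?_, ?_⟩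
  · rintro X ⟨hX, hXG⟩
    have pX : X.Positive := ⟨hl.u.trans hX.2.2.2.2, hXG.1, hX.1 ▸ hl.a⟩
    exact eq_of_curve_ratio hγ pC pX (hX.sum.trans hrar.sum.symm)
      (mul_left_cancel₀ hγ.ne' ((pX.mem_GammaPlus_iff.1 hXG).trans hC.symm))
      (hX.1.trans hrar.1.symm)
  · rintro X ⟨hXa, hX, hXD⟩
    exact hCS.unique hγ hX (hXa.trans hSa.symm)
      (Or.inl ⟨hS.le, (hX.2.1.positive.2.mem_D₂_iff.1 hXD).le⟩)
  · rintro X ⟨hXa, hX, hXD⟩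
    exact hCCu.unique hγ hX (hXa.trans hCua.symm)
      (Or.inr ⟨hCu1.le, (hX.2.1.positive.2.mem_D₁_iff.1 hXD).le⟩)
  · intro h1 h2
    obtain ⟨M, hM, hF⟩ := exists_rarefaction_contact hγ hr pS hS.le hSa h1 h2
    exact ⟨M, hM, hsolve (hF.cons_stationary hCS hle)⟩
  · intro h1 h2
    obtain ⟨M, hM, hF⟩ := exists_shock_contact hγ hr hSt hSa h1 h2
    exact ⟨M, hM, hsolve (hF.cons_stationary hCS hle)⟩
  · intro h
    exact hsolve ((fanSol_vacuum hγ hr pS hS.le hSa h).cons_stationary hCS hle)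
  · intro h
    -- A subsonic `Ul` takes the role of its own conjugate here; any denser state on its curve has
    -- less flux.
    obtain ⟨K, Ks, pK, hKa, hKsum, hKρ, hK1, hlax, hw, hKsa, hKsu, hKs, hsol⟩ :=
      exists_subsonic_shock hγ hr hl hl rfl rfl le_rfl hs.le rfl ha hUUu hUu1.le hUua h
    exact ⟨K, Ks, ⟨⟨Or.inl ⟨_, hlax⟩, hrar.2.2.2.1.trans hKρ, hw, hKsa, hKsu⟩,
      huniq hKa hKsum hK1 hw hKsa hKsu⟩, hKs, hsol⟩
  · intro h1 h2
    obtain ⟨K, Ks, pK, hK1, hrK, hKρ, hw, hKsa, hKsu, hKs, hsol⟩ :=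
      exists_subsonic_rarefaction hγ hr hl hs ha hC hrar hCCu hCu1 hCua hUUu hUua h1 h2
    exact ⟨K, Ks, ⟨⟨Or.inr (Or.inl hrK), hKρ, hw, hKsa, hKsu⟩,
      huniq hrK.1 hrK.sum hK1 hw hKsa hKsu⟩, hKs, hsol⟩
  · intro h1 h2
    obtain ⟨X, Xt, Y, pX, pXt, pY, hXa, hXs, hXc, hY, hBX, hXY, hYa, hYu⟩ :=
      exists_zero_speed_triple hγ hCC hCS hSt hSC hCCu hCu1.le (hCua.trans hSa.symm) h1 h2
    rw [hSa] at hXa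
    have hX0 := hXc.laxShock hγ hXs
    exact ⟨X, Xt, Y, hrar.1 ▸ hXa, pX.mem_D₂_iff.2 hXs, hX0,
      pXt.mem_D₁_iff.2 (hXc.right_gt hγ hXs), pY.mem_D₁_iff.2 hY,
      hsolve (fanSol_zero_speed_triple hγ hr hXa.1.le hXa.2.le hBX hX0 hXY (hYa.trans hSa) hYu)⟩
  · intro X Xt Y hXa h1 h2 h3 hYa hYu
    exact hsolve (fanSol_zero_speed_triple hγ hr (hrar.1 ▸ hXa.1.le) hXa.2.le h1 h2 h3 hYa hYu)

/-- Sonic left states are treated with the supersonic ones, since `Conjugate` allows a sonic state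
to be paired with itself. The limiting velocities are the equality branches of the case distinctions
here and in `exists_fanSol_of_ge`. -/
lemma exists_solution (hγ : 0 < γ) {Ul : State} (hl : Ul.Positive) (hr : Ur.Positive)
    (ha : Ul.a < Ur.a) : ∃ F : List Wave, SolvedBy γ Ul Ur F := by
  rcases le_or_gt (γ * ratio γ Ul) 1 with hs | hs
  · obtain ⟨T, hT⟩ := exists_conjugate_state hγ hl hs
    obtain ⟨Ts, -, hTsa, hTs, hTTs⟩ := exists_stationary_right hγ hT.right hT.right_ge
      (hT.width.trans_lt ha)
    rcases le_or_gt Ts.u Ur.u with hu | hu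
    · obtain ⟨F, hF⟩ := exists_fanSol_of_ge hγ hr hT ha hTTs hTs.le hTsa hu
      exact ⟨F, hF.solvedBy⟩
    · obtain ⟨K, Ks, -, -, -, -, -, -, -, -, -, -, hsol⟩ :=
        exists_subsonic_shock hγ hr hl hT.right hT.width hT.sum (hT.density_le hγ) hT.right_ge
          hT.flux ha hTTs hTs.le hTsa hu
      exact ⟨_, hsol⟩
  · obtain ⟨C, pC, hC, hrar⟩ := exists_sonic_rarefaction hγ hl hs
    have haC : C.a < Ur.a := hrar.1.trans_lt ha
    obtain ⟨Cu, pCu, hCua, hCu1, hCCu⟩ := exists_stationary_right hγ pC hC.ge haC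
    obtain ⟨Uu, pUu, hUua, hUu1, hUUu⟩ := exists_stationary_right hγ hl hs.le ha
    rcases le_or_gt Cu.u Ur.u with hu | hu
    · obtain ⟨F, hF⟩ := exists_fanSol_of_ge hγ hr (conjugate_self pC hC) haC hCCu hCu1.le hCua hu
      exact ⟨_, ((hF.mono (pC.lam_nonpos hC.ge)).cons_rarefaction hγ hrar hl.u.le).solvedBy⟩
    rcases lt_trichotomy Ur.u Uu.u with h1 | h1 | h1
    · obtain ⟨K, Ks, -, -, -, -, -, -, -, -, -, -, hsol⟩ :=
        exists_subsonic_shock hγ hr hl hl rfl rfl le_rfl hs.le rfl ha hUUu hUu1.le hUua h1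
      exact ⟨_, hsol⟩
    · exact ⟨_, (fanSol_stationary_contact hr hUUu ha.le hUua h1.symm).solvedBy⟩
    · obtain ⟨K, Ks, -, -, -, -, -, -, -, -, hsol⟩ :=
        exists_subsonic_rarefaction hγ hr hl hs ha hC hrar hCCu hCu1 hCua hUUu hUua h1 hu
      exact ⟨_, hsol⟩

end TrafficFlow

open TrafficFlow
theorem mainTheorem1 (γ : ℝ) (hγ : 0 < γ) (Ul Ur : State)
    (hul : 0 < Ul.u) (hρl : 0 < Ul.ρ) (hur : 0 < Ur.u) (hρr : 0 < Ur.ρ)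
    (ha₀ : 0 < Ul.a) (ha : Ul.a < Ur.a) :
    (Ul ∈ D₂ γ → CaseOne γ Ul Ur) ∧
    (Ul ∈ D₁ γ → CaseTwo γ Ul Ur) ∧
    ∃ F : List Wave, SolvedBy γ Ul Ur F :=
  have hl : Ul.Positive := ⟨hul, hρl, ha₀⟩
  have hr : Ur.Positive := ⟨hur, hρr, ha₀.trans ha⟩
  ⟨caseOne hγ hl hr ha, caseTwo hγ hl hr ha, exists_solution hγ hl hr ha⟩
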